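/- Let $m$ be Lebesgue measure on $(0,\infty)$. For a real measurable function $x$ on $(0,\infty)$ let $x^*(t)=\inf\{\tau\ge 0: m\{|x|>\tau\}\le t\}$, $t>0$; two functions $x,y$ are equimeasurable if $m\{|x|>\tau\}=m\{|y|>\tau\}$ for all $\tau>0$. A rearrangement invariant (r.i.) space on $(0,\infty)$ is a nonzero Banach space $X$ of (classes of) real measurable functions on $(0,\infty)$ such that $x\in X$, $|y|\le|x|$ a.e. imply $y\in X$, $\|y\|_X\le\|x\|_X$, and $y\in X$, $x^*\le y^*$ imply $x\in X$, $\|x\|_X\le\|y\|_X$. For $n\in\mathbb Z$ let $\sigma_{2^n}x(t)=x(t/2^n)$ and $P_Ax=x\chi_A$. Let $\|\sigma_{2^n}\|$ be the norm of $\sigma_{2^n}$ in $X$; let $\|\sigma^0_{2^n}\|$ be the supremum of $\|P_{[0,1]}\sigma_{2^n}x\|_X/\|x\|_X$ over $0\ne x\in X$ with $x=P_{[0,1]}x$; and let $\|\sigma^\infty_{2^n}\|$ be the supremum of $\|P_{[1,\infty)}\sigma_{2^n}x\|_X/\|x\|_X$ over those $0\ne x\in X$ with $x=P_{[1,\infty)}x$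 that are (a.e.) constant on each interval $[2^k,2^{k+1})$, $k\in\mathbb Z$. Put $$\alpha_X=-\lim_{n\to\infty}\tfrac1n\log_2\|\sigma_{2^{-n}}\|,\qquad \beta_X=\lim_{n\to\infty}\tfrac1n\log_2\|\sigma_{2^{n}}\|,$$ and define $\alpha_X^0,\beta_X^0$ and $\alpha_X^\infty,\beta_X^\infty$ in the same way from $\|\sigma^0_{2^{\mp n}}\|$ and $\|\sigma^\infty_{2^{\mp n}}\|$. Let $\phi_X(t)=\|\chi_{(0,t)}\|_X$ be the fundamental function of $X$, and for a positive function $\psi$ put $$M_\psi(t)=\sup_{s>0}\frac{\psi(ts)}{\psi(s)},\quad M^0_\psi(t)=\sup_{0<s\le\min(1,1/t)}\frac{\psi(ts)}{\psi(s)},\quad M^\infty_\psi(t)=\sup_{s\ge\max(1,1/t)}\frac{\psi(ts)}{\psi(s)},$$ $$\mu_\psi=-\lim_{n\to\infty}\tfrac1n\log_2M_\psi(2^{-n}),\qquad \nu_\psi=\lim_{n\to\infty}\tfrac1n\log_2M_\psi(2^{n}),$$ and similarly $\mu^0_\psi,\nu^0_\psi$ from $M^0_\psi$ and $\mu^\infty_\psi,\nu^\infty_\psi$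 from $M^\infty_\psi$. The space $X$ is of fundamental type if $\alpha_X=\mu_{\phi_X}$, $\alpha^0_X=\mu^0_{\phi_X}$, $\alpha^\infty_X=\mu^\infty_{\phi_X}$, $\beta_X=\nu_{\phi_X}$, $\beta^0_X=\nu^0_{\phi_X}$, $\beta^\infty_X=\nu^\infty_{\phi_X}$. Let $\mathcal F(X)$ be the set of all $p\in[1,\infty]$ such that for every $n\in\mathbb N$ and every $\varepsilon>0$ there are pairwise disjointly supported equimeasurable functions $x_1,\dots,x_n\in X$ with $$(1+\varepsilon)^{-1}\|a\|_p\le\Big\|\sum_{k=1}^na_kx_k\Big\|_X\le(1+\varepsilon)\|a\|_p\qquad\text{for all }a=(a_k)_{k=1}^n\in\mathbb R^n,$$ and let $\mathcal F_c(X)$ be the set of all $p\in[1,\infty]$ for which there is a constant $C>0$ such that for every $n\in\mathbb N$ there are such functions satisfying this estimate with $C$ in place of $1+\varepsilon$. Theorem. Let $X$ be a separable r.i. space on $(0,\infty)$ of fundamental type. Then (with $1/0=\infty$): (i) if $\alpha_X^\infty\le\beta_X^0$, then $\mathcal F(X)=\mathcal F_c(X)=[1/\beta_X,1/\alpha_X]$;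 (ii) if $\alpha_X^\infty>\beta_X^0$, then $\mathcal F(X)=\mathcal F_c(X)=[1/\beta_X,1/\alpha_X^\infty]\cup[1/\beta_X^0,1/\alpha_X]$. -/

import Mathlib

open MeasureTheory Filter Topology Set
open scoped ENNReal NNReal

noncomputable section

namespace SymRep

/-! ### Measurable functions on the half-line -/

/-- Lebesgue measure on `(0, ∞)`. -/
def halfLine : Measure ℝ := volume.restrict (Ioi 0)

/-- Classes (modulo equality a.e.) of real-valued measurable functions on `(0, ∞)`. -/
abbrev Meas : Type := ℝ →ₘ[halfLine] ℝ

/-- The distribution function `τ ↦ m {s > 0 : |x s| > τ}`. -/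
def distribution (x : Meas) (τ : ℝ) : ℝ≥0∞ := halfLine {s | τ < |x s|}

/-- The nonincreasing rearrangement
`x* t = inf {τ ≥ 0 : m {s > 0 : |x s| > τ} ≤ t}`, with values in `[0, ∞]` (`inf ∅ = ∞`). -/
def rearrangement (x : Meas) (t : ℝ) : ℝ≥0∞ :=
  ⨅ (τ : ℝ≥0) (_ : distribution x τ ≤ ENNReal.ofReal t), (τ : ℝ≥0∞)

/-- Equimeasurable functions. -/
def Equimeasurable (x y : Meas) : Prop :=
  ∀ τ : ℝ, 0 < τ → distribution x τ = distribution y τ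

/-- Functions with (up to a null set) disjoint supports. -/
def DisjointSupport (x y : Meas) : Prop :=
  ∀ᵐ t ∂halfLine, x t = 0 ∨ y t = 0

/-- The projection `P_A x = x · χ_A`. -/
def proj (A : Set ℝ) (hA : MeasurableSet A) (x : Meas) : Meas :=
  AEEqFun.mk (A.indicator x) (x.aestronglyMeasurable.indicator hA)

theorem quasiMeasurePreserving_div {τ : ℝ} (hτ : 0 < τ) :
    Measure.QuasiMeasurePreserving (fun t : ℝ => t / τ) halfLine halfLine := by
  have h := (Measure.quasiMeasurePreserving_smul (volume : Measure ℝ)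
    (inv_ne_zero hτ.ne')).restrict (s := Ioi (0 : ℝ)) (t := Ioi (0 : ℝ))
    (fun t ht => by
      have ht' : (0 : ℝ) < t := ht
      show (0 : ℝ) < τ⁻¹ • t
      rw [smul_eq_mul]
      positivity)
  have e : (fun t : ℝ => t / τ) = (fun t : ℝ => τ⁻¹ • t) := by
    funext t
    rw [smul_eq_mul, div_eq_inv_mul]
  rw [e]
  exact h

/-- The dilation operator `(σ_τ x)(t) = x (t / τ)`, `τ > 0`. -/
def dilation (τ : ℝ) (hτ : 0 < τ) (x : Meas) : Meas :=
  x.compQuasiMeasurePreserving (fun t => t / τ) (quasiMeasurePreserving_div hτ)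

/-- The dilation operator `σ_{2 ^ n}`, `n ∈ ℤ`. -/
def dyadicDilation (n : ℤ) (x : Meas) : Meas :=
  dilation ((2 : ℝ) ^ n) (zpow_pos two_pos n) x

/-- The class of the characteristic function of the interval `(0, t)`. -/
def charFun (t : ℝ) : Meas :=
  AEEqFun.mk ((Ioo (0 : ℝ) t).indicator fun _ => (1 : ℝ))
    (aestronglyMeasurable_const.indicator measurableSet_Ioo)

/-- `x` is constant a.e. on each dyadic interval `[2 ^ k, 2 ^ (k + 1))`, `k ∈ ℤ`; i.e.
`x = ∑ₖ aₖ χ_{[2 ^ k, 2 ^ (k + 1))}` for some sequence `(aₖ)`. -/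
def IsDyadicStep (x : Meas) : Prop :=
  ∃ a : ℤ → ℝ, ∀ k : ℤ, ∀ᵐ t ∂halfLine, t ∈ Ico ((2 : ℝ) ^ k) ((2 : ℝ) ^ (k + 1)) → x t = a k

/-! ### Rearrangement invariant spaces -/

/-- A normed space of (classes of) measurable functions on `(0, ∞)`: a linear subspace of `Meas`
with a norm on it. -/
structure FunctionSpace where
  carrier : Submodule ℝ Meas
  normFun : AddGroupNorm carrier
  normFun_smul : ∀ (c : ℝ) (x : carrier), normFun (c • x) = |c| * normFun x

/-- The elements of a function space, as a normed space. -/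
def FunctionSpace.Elem (X : FunctionSpace) : Type := X.carrier

instance (X : FunctionSpace) : AddCommGroup X.Elem :=
  inferInstanceAs (AddCommGroup X.carrier)

instance (X : FunctionSpace) : Module ℝ X.Elem :=
  inferInstanceAs (Module ℝ X.carrier)

instance (X : FunctionSpace) : NormedAddCommGroup X.Elem :=
  AddGroupNorm.toNormedAddCommGroup (E := X.Elem) X.normFun

instance (X : FunctionSpace) : NormedSpace ℝ X.Elem where
  norm_smul_le c x := (X.normFun_smul c x).le

/-- The function underlying an element of a function space. -/
def FunctionSpace.Elem.toMeas {X : FunctionSpace} (x : X.Elem) : Meas := Subtype.val x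

/-- A Banach function lattice: the space is complete, and `x ∈ X`, `|y| ≤ |x|` a.e. imply
`y ∈ X` and `‖y‖ ≤ ‖x‖`. -/
structure FunctionSpace.IsBanachLattice (X : FunctionSpace) : Prop where
  complete : CompleteSpace X.Elem
  ideal : ∀ (x : X.Elem) (y : Meas), (∀ᵐ t ∂halfLine, |y t| ≤ |x.toMeas t|) →
    ∃ z : X.Elem, z.toMeas = y ∧ ‖z‖ ≤ ‖x‖

/-- A (nonzero) rearrangement invariant space on `(0, ∞)`: a Banach function lattice such that
`y ∈ X` and `x* ≤ y*` imply `x ∈ X` and `‖x‖ ≤ ‖y‖`. -/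
structure FunctionSpace.IsRearrangementInvariant (X : FunctionSpace) : Prop
    extends X.IsBanachLattice where
  nontrivial : ∃ x : X.Elem, x ≠ 0
  rearr : ∀ (y : X.Elem) (x : Meas),
    (∀ t : ℝ, 0 < t → rearrangement x t ≤ rearrangement y.toMeas t) →
    ∃ z : X.Elem, z.toMeas = x ∧ ‖z‖ ≤ ‖y‖

open Classical in
/-- The norm of `X` extended to all measurable functions by the value `∞` off `X`. -/
def FunctionSpace.extNorm (X : FunctionSpace) (f : Meas) : ℝ≥0∞ :=
  if h : f ∈ X.carrier then ENNReal.ofReal (X.normFun ⟨f, h⟩) else ∞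

/-! ### Dilation indices -/

/-- The norm of `σ_{2 ^ n}` in `X`. -/
def FunctionSpace.dilNorm (X : FunctionSpace) (n : ℤ) : ℝ≥0∞ :=
  ⨆ (x : X.Elem) (_ : x ≠ 0), X.extNorm (dyadicDilation n x.toMeas) / ‖x‖ₑ

/-- The norm of `σ_{2 ^ n}` at zero: the supremum of `‖P_{[0,1]} σ_{2 ^ n} x‖ / ‖x‖` over
`0 ≠ x ∈ X` with `x = P_{[0,1]} x`. -/
def FunctionSpace.dilNormZero (X : FunctionSpace) (n : ℤ) : ℝ≥0∞ :=
  ⨆ (x : X.Elem) (_ : x ≠ 0) (_ : x.toMeas = proj (Icc 0 1) measurableSet_Icc x.toMeas),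
    X.extNorm (proj (Icc 0 1) measurableSet_Icc (dyadicDilation n x.toMeas)) / ‖x‖ₑ

/-- The norm of `σ_{2 ^ n}` at infinity: the supremum of `‖P_{[1,∞)} σ_{2 ^ n} x‖ / ‖x‖` over
the dyadic step functions `0 ≠ x ∈ X` with `x = P_{[1,∞)} x`. In other words, this is the norm
`‖τ_n^∞‖` of the shift by `n`, compressed to `{k ≥ 0}`, in the lattice of all sequences
`(aₖ)_{k ∈ ℤ}` with the norm `‖∑ₖ aₖ χ_{[2 ^ k, 2 ^ (k + 1))}‖_X`. (Over arbitrary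
`x = P_{[1,∞)} x` the supremum would be `‖σ_{2 ^ n}‖` itself, because every `x` in `X` is
equimeasurable with functions supported as far to the right as one likes.) -/
def FunctionSpace.dilNormInf (X : FunctionSpace) (n : ℤ) : ℝ≥0∞ :=
  ⨆ (x : X.Elem) (_ : x ≠ 0) (_ : IsDyadicStep x.toMeas)
    (_ : x.toMeas = proj (Ici 1) measurableSet_Ici x.toMeas),
    X.extNorm (proj (Ici 1) measurableSet_Ici (dyadicDilation n x.toMeas)) / ‖x‖ₑ

/-- `lim (1 / n) log₂ (N n)`. In all uses below `N` is submultiplicative with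
`c ^ n ≤ N n ≤ C ^ n`, `0 < c ≤ C < ∞`, so that the limit exists. -/
def expRate (N : ℕ → ℝ≥0∞) : ℝ :=
  limUnder atTop fun n : ℕ => (1 / (n : ℝ)) * Real.logb 2 (N n).toReal

/-- Lower Boyd index `α_X`. -/
def FunctionSpace.lowerBoyd (X : FunctionSpace) : ℝ := -expRate fun n => X.dilNorm (-(n : ℤ))
/-- Upper Boyd index `β_X`. -/
def FunctionSpace.upperBoyd (X : FunctionSpace) : ℝ := expRate fun n => X.dilNorm (n : ℤ)
/-- `α_X^0`. -/
def FunctionSpace.lowerBoydZero (X : FunctionSpace) : ℝ :=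
  -expRate fun n => X.dilNormZero (-(n : ℤ))
/-- `β_X^0`. -/
def FunctionSpace.upperBoydZero (X : FunctionSpace) : ℝ :=
  expRate fun n => X.dilNormZero (n : ℤ)
/-- `α_X^∞`. -/
def FunctionSpace.lowerBoydInf (X : FunctionSpace) : ℝ :=
  -expRate fun n => X.dilNormInf (-(n : ℤ))
/-- `β_X^∞`. -/
def FunctionSpace.upperBoydInf (X : FunctionSpace) : ℝ :=
  expRate fun n => X.dilNormInf (n : ℤ)

/-- `M_ψ(t) = sup_{s > 0} ψ(ts) / ψ(s)`. -/
def dilFun (ψ : ℝ → ℝ) (t : ℝ) : ℝ≥0∞ :=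
  ⨆ (s : ℝ) (_ : 0 < s), ENNReal.ofReal (ψ (t * s) / ψ s)
/-- `M_ψ^0(t)`, the supremum over `0 < s ≤ min (1, 1/t)`. -/
def dilFunZero (ψ : ℝ → ℝ) (t : ℝ) : ℝ≥0∞ :=
  ⨆ (s : ℝ) (_ : 0 < s) (_ : s ≤ min 1 (1 / t)), ENNReal.ofReal (ψ (t * s) / ψ s)
/-- `M_ψ^∞(t)`, the supremum over `s ≥ max (1, 1/t)`. -/
def dilFunInf (ψ : ℝ → ℝ) (t : ℝ) : ℝ≥0∞ :=
  ⨆ (s : ℝ) (_ : max 1 (1 / t) ≤ s), ENNReal.ofReal (ψ (t * s) / ψ s)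

/-- `μ_ψ`. -/
def lowerDil (ψ : ℝ → ℝ) : ℝ := -expRate fun n => dilFun ψ ((2 : ℝ) ^ (-(n : ℤ)))
/-- `ν_ψ`. -/
def upperDil (ψ : ℝ → ℝ) : ℝ := expRate fun n => dilFun ψ ((2 : ℝ) ^ (n : ℤ))
/-- `μ_ψ^0`. -/
def lowerDilZero (ψ : ℝ → ℝ) : ℝ := -expRate fun n => dilFunZero ψ ((2 : ℝ) ^ (-(n : ℤ)))
/-- `ν_ψ^0`. -/
def upperDilZero (ψ : ℝ → ℝ) : ℝ := expRate fun n => dilFunZero ψ ((2 : ℝ) ^ (n : ℤ))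
/-- `μ_ψ^∞`. -/
def lowerDilInf (ψ : ℝ → ℝ) : ℝ := -expRate fun n => dilFunInf ψ ((2 : ℝ) ^ (-(n : ℤ)))
/-- `ν_ψ^∞`. -/
def upperDilInf (ψ : ℝ → ℝ) : ℝ := expRate fun n => dilFunInf ψ ((2 : ℝ) ^ (n : ℤ))

/-- The fundamental function `φ_X(t) = ‖χ_{(0,t)}‖_X` (any set of measure `t` gives the same
value when `X` is rearrangement invariant). -/
def FunctionSpace.fundamentalFunction (X : FunctionSpace) (t : ℝ) : ℝ :=
  (X.extNorm (charFun t)).toReal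

/-- Fundamental type: all the indices of `X` agree with those of its fundamental function. -/
structure FunctionSpace.IsFundamentalType (X : FunctionSpace) : Prop where
  lower : X.lowerBoyd = lowerDil X.fundamentalFunction
  lowerZero : X.lowerBoydZero = lowerDilZero X.fundamentalFunction
  lowerInf : X.lowerBoydInf = lowerDilInf X.fundamentalFunction
  upper : X.upperBoyd = upperDil X.fundamentalFunction
  upperZero : X.upperBoydZero = upperDilZero X.fundamentalFunction
  upperInf : X.upperBoydInf = upperDilInf X.fundamentalFunction

/-! ### Symmetric finite representability -/

/-- `x₁, …, xₙ` are pairwise disjoint equimeasurable functions with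
`C⁻¹ ‖a‖_p ≤ ‖∑ aₖ xₖ‖_X ≤ C ‖a‖_p` for all `a ∈ ℝⁿ`. -/
def FunctionSpace.IsSymmetricCopy (X : FunctionSpace) (p : ℝ≥0∞) (C : ℝ) {n : ℕ}
    (x : Fin n → X.Elem) : Prop :=
  (∀ i j, Equimeasurable (x i).toMeas (x j).toMeas) ∧
  (∀ i j, i ≠ j → DisjointSupport (x i).toMeas (x j).toMeas) ∧
  ∀ a : Fin n → ℝ,
    C⁻¹ * ‖(WithLp.toLp p a : PiLp p fun _ : Fin n => ℝ)‖ ≤ ‖∑ k, a k • x k‖ ∧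
    ‖∑ k, a k • x k‖ ≤ C * ‖(WithLp.toLp p a : PiLp p fun _ : Fin n => ℝ)‖

/-- `𝓕(X)`: the set of all `p ∈ [1, ∞]` such that `ℓ^p` is symmetrically finitely represented
in `X`. -/
def FunctionSpace.symRep (X : FunctionSpace) : Set ℝ≥0∞ :=
  {p | 1 ≤ p ∧ ∀ (n : ℕ) (ε : ℝ), 0 < ε → ∃ x : Fin n → X.Elem, X.IsSymmetricCopy p (1 + ε) x}

/-- `𝓕_c(X)`: the set of all `p ∈ [1, ∞]` such that `ℓ^p` is crudely symmetrically finitely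
represented in `X`. -/
def FunctionSpace.crudeSymRep (X : FunctionSpace) : Set ℝ≥0∞ :=
  {p | 1 ≤ p ∧ ∃ C : ℝ, 0 < C ∧ ∀ n : ℕ, ∃ x : Fin n → X.Elem, X.IsSymmetricCopy p C x}

/-- The reciprocal `1 / r ∈ [0, ∞]` of a nonnegative real number, with `1 / 0 = ∞`. -/
def recip (r : ℝ) : ℝ≥0∞ := (ENNReal.ofReal r)⁻¹

end SymRep

end

noncomputable section

namespace SymRep

/-! Write θ = 1/p. A sum of l disjoint copies of x is equimeasurable with σ_l x. So if disjoint
copies of x behave like the unit vectors of ℓ^p, then ‖σ_l x‖ grows like l^θ. Conversely, if x is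
nearly a common eigenfunction of the dilations, σ_l x ≈ l^θ x in norm, then its disjoint copies span
nearly ℓ^p. The proof shows that both representability sets consist of the p ≥ 1 with α_X ≤ θ ≤ β_X
and (θ ≤ β_X^0 or α_X^∞ ≤ θ). Cases (i) and (ii) only rewrite this condition in terms of p.

Necessity. A crude representation gives elements x with ‖σ_{2^j} x‖ comparable to 2^{jθ} for all j ≤
m, uniformly in m (`hasGrowth_of_mem_crudeSymRep`). Comparing j = 0 with j = m gives θ ≤ β_X and α_X
≤ θ. If β_X^0 < θ < α_X^∞, replace x by a dyadic step function y with comparable distribution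
(`exists_dyadicStep`) and look at the middle of a window of length 2n. The part of σ_{2^n} y on
[0,1] is reached from y by a forward dilation at zero, and the part on [1,∞) from σ_{2^{2n}} y by a
backward dilation at infinity. Both are exponentially smaller than 2^{nθ}, which is absurd
(`growth_gap`).

Sufficiency. Fundamental type turns the conditions on θ into conditions on φ = φ_X. They yield
points a < b < c, with b/a and c/b arbitrarily large, such that φ(b)/φ(a) ≥ (b/a)^{θ-δ} and
φ(c)/φ(b) ≤ (c/b)^{θ+δ} (`exists_balanced`). The function t^{-θ} min(t/b, b/t)^{2δ}, cut off to
[a,c), is then a near eigenfunction: the power is an exact one, the weight varies slowly, and the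
weight makes the boundary effects at a and c negligible (`hasNearEigenfunctions`). To get ℓ^p from
it, replace |a_k|^p by integer multiplicities j_k. The sum of the copies of σ_{j_k} f is
equimeasurable with σ_J f, J = ∑ j_k, and the rounding errors vanish relative to J^θ
(`fnNorm_sum_rpow_copy`, `mem_symRep`). -/

theorem rearrangement_mono {x y : Meas}
    (h : ∀ τ : ℝ, 0 < τ → distribution x τ ≤ distribution y τ) (t : ℝ) :
    rearrangement x t ≤ rearrangement y t := by
  refine le_iInf₂ fun τ hτ => ?_
  -- The distributions are compared at positive levels only, so level 0 is approached by levels ε >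
  -- 0.
  rcases eq_or_ne τ 0 with rfl | h0
  · refine le_of_forall_pos_le_add fun ε hε => ?_
    rcases eq_or_ne ε ∞ with rfl | hε'
    · simp
    lift ε to ℝ≥0 using hε'
    have hε0 : (0 : ℝ) < ε := by exact_mod_cast hε
    rw [ENNReal.coe_zero, zero_add]
    refine iInf₂_le ε ((h ε hε0).trans (le_trans ?_ hτ))
    exact measure_mono fun s (hs : (ε : ℝ) < |y s|) => show ((0 : ℝ≥0) : ℝ) < |y s| from
      lt_trans (by simpa using hε0) hs
  · exact iInf₂_le τ ((h τ (by positivity)).trans hτ)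

/-- The distribution function of an individual function. -/
def fnDist (f : ℝ → ℝ) (τ : ℝ) : ℝ≥0∞ := halfLine {s | τ < |f s|}

theorem fnDist_coe (x : Meas) : fnDist x = distribution x := rfl

theorem fnDist_congr {f g : ℝ → ℝ} (h : f =ᵐ[halfLine] g) : fnDist f = fnDist g := by
  funext τ
  refine measure_congr ?_
  filter_upwards [h] with s hs
  change (τ < |f s|) = (τ < |g s|)
  rw [hs]

theorem distribution_mk {f : ℝ → ℝ} (hf : AEStronglyMeasurable f halfLine) :
    distribution (AEEqFun.mk f hf) = fnDist f :=
  fnDist_congr (AEEqFun.coeFn_mk f hf)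

theorem fnDist_mono {f g : ℝ → ℝ} (h : ∀ᵐ s ∂halfLine, |f s| ≤ |g s|) (τ : ℝ) :
    fnDist f τ ≤ fnDist g τ := by
  refine measure_mono_ae ?_
  filter_upwards [h] with s hs
  exact fun (h1 : τ < |f s|) => lt_of_lt_of_le h1 hs

/-! ### Extended norms of classes and of individual functions -/

namespace FunctionSpace

variable {X : FunctionSpace}

theorem extNorm_toMeas (x : X.Elem) : X.extNorm x.toMeas = ‖x‖ₑ := by
  have h : x.toMeas ∈ X.carrier := Subtype.property (show X.carrier from x)
  rw [extNorm, dif_pos h, ← ofReal_norm]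
  rfl

theorem exists_of_extNorm_ne_top {f : Meas} (h : X.extNorm f ≠ ∞) :
    ∃ x : X.Elem, x.toMeas = f := by
  by_cases hf : f ∈ X.carrier
  · exact ⟨(⟨f, hf⟩ : X.carrier), rfl⟩
  · exact absurd (by rw [extNorm, dif_neg hf]) h

theorem toMeas_add (x y : X.Elem) : (x + y).toMeas = x.toMeas + y.toMeas := rfl
theorem toMeas_smul (c : ℝ) (x : X.Elem) : (c • x).toMeas = c • x.toMeas := rfl
theorem toMeas_zero : (0 : X.Elem).toMeas = 0 := rfl
theorem toMeas_injective : Function.Injective (FunctionSpace.Elem.toMeas (X := X)) :=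
  Subtype.val_injective

theorem extNorm_zero : X.extNorm 0 = 0 := by
  rw [← toMeas_zero (X := X), extNorm_toMeas, enorm_zero]

theorem extNorm_eq_zero {f : Meas} (h : X.extNorm f = 0) : f = 0 := by
  obtain ⟨x, rfl⟩ := exists_of_extNorm_ne_top (X := X) (f := f) (by rw [h]; simp)
  rw [extNorm_toMeas, enorm_eq_zero] at h
  rw [h, toMeas_zero]

theorem extNorm_add_le (f g : Meas) : X.extNorm (f + g) ≤ X.extNorm f + X.extNorm g := by
  by_cases hf : X.extNorm f = ∞
  · simp [hf]
  by_cases hg : X.extNorm g = ∞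
  · simp [hg]
  obtain ⟨x, rfl⟩ := exists_of_extNorm_ne_top hf
  obtain ⟨y, rfl⟩ := exists_of_extNorm_ne_top hg
  rw [← toMeas_add, extNorm_toMeas, extNorm_toMeas, extNorm_toMeas]
  exact enorm_add_le x y

theorem extNorm_smul_le (c : ℝ) (f : Meas) : X.extNorm (c • f) ≤ ‖c‖ₑ * X.extNorm f := by
  rcases eq_or_ne c 0 with rfl | hc
  · simp [extNorm_zero]
  by_cases hf : X.extNorm f = ∞
  · rw [hf, ENNReal.mul_top (by simpa using hc)]
    exact le_top
  obtain ⟨x, rfl⟩ := exists_of_extNorm_ne_top hf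
  rw [← toMeas_smul, extNorm_toMeas, extNorm_toMeas, enorm_smul]

/-- The form in which rearrangement invariance is used throughout: one inequality of extended norms
contains both membership in X and the norm estimate. -/
theorem IsRearrangementInvariant.extNorm_mono (hX : X.IsRearrangementInvariant) {f g : Meas}
    (h : ∀ τ : ℝ, 0 < τ → distribution f τ ≤ distribution g τ) :
    X.extNorm f ≤ X.extNorm g := by
  by_cases hg : X.extNorm g = ∞
  · simp [hg]
  obtain ⟨y, rfl⟩ := exists_of_extNorm_ne_top hg
  obtain ⟨z, rfl, hz⟩ := hX.rearr y f fun t _ => rearrangement_mono h t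
  rw [extNorm_toMeas, extNorm_toMeas]
  exact enorm_le_iff_norm_le.2 hz

variable (X) in
open Classical in
/-- The norm of the class of a function; `∞` if the function is not measurable. -/
def fnNorm (f : ℝ → ℝ) : ℝ≥0∞ :=
  if h : AEStronglyMeasurable f halfLine then X.extNorm (AEEqFun.mk f h) else ∞

theorem fnNorm_eq {f : ℝ → ℝ} (h : AEStronglyMeasurable f halfLine) :
    X.fnNorm f = X.extNorm (AEEqFun.mk f h) := dif_pos h

theorem fnNorm_coe (x : Meas) : X.fnNorm x = X.extNorm x := by
  rw [fnNorm_eq x.aestronglyMeasurable, AEEqFun.mk_coeFn]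

theorem aestronglyMeasurable_of_fnNorm {f : ℝ → ℝ} (h : X.fnNorm f ≠ ∞) :
    AEStronglyMeasurable f halfLine := by
  by_contra h'
  exact h (dif_neg h')

theorem fnNorm_congr {f g : ℝ → ℝ} (h : f =ᵐ[halfLine] g) : X.fnNorm f = X.fnNorm g := by
  by_cases hf : AEStronglyMeasurable f halfLine
  · rw [fnNorm_eq hf, fnNorm_eq (hf.congr h), AEEqFun.mk_eq_mk.2 h]
  · rw [fnNorm, dif_neg hf, fnNorm, dif_neg fun hg => hf (hg.congr h.symm)]

theorem fnNorm_add_le (f g : ℝ → ℝ) : X.fnNorm (f + g) ≤ X.fnNorm f + X.fnNorm g := by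
  by_cases hf : X.fnNorm f = ∞
  · simp [hf]
  by_cases hg : X.fnNorm g = ∞
  · simp [hg]
  have hf' := aestronglyMeasurable_of_fnNorm hf
  have hg' := aestronglyMeasurable_of_fnNorm hg
  rw [fnNorm_eq hf', fnNorm_eq hg', fnNorm_eq (hf'.add hg'), ← AEEqFun.mk_add_mk]
  exact extNorm_add_le _ _

theorem fnNorm_smul_le (c : ℝ) (f : ℝ → ℝ) : X.fnNorm (c • f) ≤ ‖c‖ₑ * X.fnNorm f := by
  by_cases hc : c = 0
  · rw [hc, zero_smul, fnNorm_congr (AEEqFun.coeFn_zero (μ := halfLine)).symm,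
      fnNorm_coe, extNorm_zero]
    exact zero_le
  by_cases hf : X.fnNorm f = ∞
  · rw [hf, ENNReal.mul_top (by simpa using hc)]
    exact le_top
  have hf' := aestronglyMeasurable_of_fnNorm hf
  rw [fnNorm_eq hf', fnNorm_eq (hf'.const_smul c), ← AEEqFun.smul_mk]
  exact extNorm_smul_le _ _

theorem fnNorm_smul {c : ℝ} (hc : c ≠ 0) (f : ℝ → ℝ) :
    X.fnNorm (c • f) = ‖c‖ₑ * X.fnNorm f := by
  refine le_antisymm (fnNorm_smul_le c f) ?_
  calc ‖c‖ₑ * X.fnNorm f = ‖c‖ₑ * X.fnNorm (c⁻¹ • c • f) := by rw [inv_smul_smul₀ hc]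
    _ ≤ ‖c‖ₑ * (‖c⁻¹‖ₑ * X.fnNorm (c • f)) := by gcongr; exact fnNorm_smul_le _ _
    _ = X.fnNorm (c • f) := by
      rw [← mul_assoc, ← enorm_mul, mul_inv_cancel₀ hc, enorm_one, one_mul]

theorem fnNorm_sum_le {ι : Type*} (s : Finset ι) (f : ι → ℝ → ℝ) :
    X.fnNorm (∑ i ∈ s, f i) ≤ ∑ i ∈ s, X.fnNorm (f i) := by
  classical
  induction s using Finset.induction_on with
  | empty =>
    have := fnNorm_smul_le (X := X) 0 0
    simpa using this
  | insert i s hi ih =>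
    rw [Finset.sum_insert hi, Finset.sum_insert hi]
    exact (fnNorm_add_le _ _).trans (by gcongr)

/-- Measurability is asked of the smaller function only: a non-measurable g has norm ∞. -/
theorem IsRearrangementInvariant.fnNorm_mono_dist (hX : X.IsRearrangementInvariant)
    {f g : ℝ → ℝ} (hf : AEStronglyMeasurable f halfLine)
    (h : ∀ τ : ℝ, 0 < τ → fnDist f τ ≤ fnDist g τ) : X.fnNorm f ≤ X.fnNorm g := by
  by_cases hg : X.fnNorm g = ∞
  · simp [hg]
  have hg' := aestronglyMeasurable_of_fnNorm hg
  rw [fnNorm_eq hf, fnNorm_eq hg']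
  refine hX.extNorm_mono fun τ hτ => ?_
  rw [distribution_mk, distribution_mk]
  exact h τ hτ

theorem IsRearrangementInvariant.fnNorm_mono (hX : X.IsRearrangementInvariant)
    {f g : ℝ → ℝ} (hf : AEStronglyMeasurable f halfLine)
    (h : ∀ᵐ s ∂halfLine, |f s| ≤ |g s|) : X.fnNorm f ≤ X.fnNorm g :=
  hX.fnNorm_mono_dist hf fun τ _ => fnDist_mono h τ

theorem IsRearrangementInvariant.fnNorm_congr_dist (hX : X.IsRearrangementInvariant)
    {f g : ℝ → ℝ} (hf : AEStronglyMeasurable f halfLine) (hg : AEStronglyMeasurable g halfLine)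
    (h : ∀ τ : ℝ, 0 < τ → fnDist f τ = fnDist g τ) : X.fnNorm f = X.fnNorm g :=
  le_antisymm (hX.fnNorm_mono_dist hf fun τ hτ => (h τ hτ).le)
    (hX.fnNorm_mono_dist hg fun τ hτ => (h τ hτ).ge)

end FunctionSpace

/-! ### Dilations and disjoint copies of individual functions -/

theorem fnDist_dilate (f : ℝ → ℝ) {c : ℝ} (hc : 0 < c) (τ : ℝ) :
    fnDist (fun t => f (t / c)) τ = ENNReal.ofReal c * fnDist f τ := by
  have e : {s | τ < |f (s / c)|} ∩ Ioi 0 = (fun t => t * c⁻¹) ⁻¹' ({s | τ < |f s|} ∩ Ioi 0) := by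
    ext t
    simp [div_eq_mul_inv, hc]
  rw [fnDist, fnDist, halfLine, Measure.restrict_apply' measurableSet_Ioi,
    Measure.restrict_apply' measurableSet_Ioi, e,
    Real.volume_preimage_mul_right (inv_ne_zero hc.ne'), inv_inv, abs_of_pos hc]

/-- The index `q` with `t ∈ (q, q + 1]`, for `t > 0`. -/
def cell (t : ℝ) : ℕ := ⌈t⌉₊ - 1

theorem cell_eq_iff {t : ℝ} (ht : 0 < t) (q : ℕ) : cell t = q ↔ t ∈ Ioc (q : ℝ) (q + 1) := by
  have h1 : 0 < ⌈t⌉₊ := Nat.ceil_pos.2 ht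
  have h2 : cell t = q ↔ ⌈t⌉₊ = q + 1 := by unfold cell; omega
  rw [h2, Nat.ceil_eq_iff (by omega)]
  simp

theorem measurable_cell : Measurable cell :=
  (measurable_from_top (f := fun n : ℕ => n - 1)).comp Nat.measurable_ceil

/-- The `k`-th of `n` disjoint copies of `f`. -/
def copy (n k : ℕ) (f : ℝ → ℝ) (t : ℝ) : ℝ :=
  if cell t % n = k then f (t - cell t + (cell t / n : ℕ)) else 0

theorem measurable_copy (n k : ℕ) {f : ℝ → ℝ} (hf : Measurable f) : Measurable (copy n k f) := by
  have h1 : MeasurableSet {t | cell t % n = k} :=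
    measurable_cell (MeasurableSet.of_discrete (s := {q : ℕ | q % n = k}))
  refine Measurable.ite h1 (hf.comp ?_) measurable_const
  have h2 : Measurable fun t => (cell t : ℝ) := measurable_from_top.comp measurable_cell
  have h3 : Measurable fun t => ((cell t / n : ℕ) : ℝ) :=
    (measurable_from_top (f := fun q : ℕ => ((q / n : ℕ) : ℝ))).comp measurable_cell
  exact (measurable_id.sub h2).add h3

/-- The copy translates the i-th unit cell to the cell with index i n + k and vanishes on the cells
of the other residue classes. Translation invariance and countable additivity over cells give the
claim; τ > 0 discards the zero cells. -/
theorem fnDist_copy {n k : ℕ} (hk : k < n) {f : ℝ → ℝ} (hf : Measurable f) {τ : ℝ}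
    (hτ : 0 < τ) : fnDist (copy n k f) τ = fnDist f τ := by
  set E : Set ℝ := {s | τ < |f s|} with hE
  have hEm : MeasurableSet E := measurableSet_lt measurable_const (measurable_norm.comp hf)
  have e1 : E ∩ Ioi 0 = ⋃ i : ℕ, E ∩ Ioc (i : ℝ) (i + 1) := by
    ext t
    simp only [mem_inter_iff, mem_iUnion]
    constructor
    · rintro ⟨h1, h2⟩
      exact ⟨cell t, h1, (cell_eq_iff h2 _).1 rfl⟩
    · rintro ⟨i, h1, h2⟩
      exact ⟨h1, lt_of_le_of_lt (Nat.cast_nonneg i) h2.1⟩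
  have e2 : {s | τ < |copy n k f s|} ∩ Ioi 0 =
      ⋃ i : ℕ, (fun t => t + ((i : ℝ) - (i * n + k : ℕ))) ⁻¹' (E ∩ Ioc (i : ℝ) (i + 1)) := by
    have hn : 0 < n := by omega
    ext t
    simp only [mem_inter_iff, mem_iUnion, mem_preimage, mem_ofPred_eq, mem_Ioi]
    constructor
    · rintro ⟨h1, h2⟩
      have h3 : cell t % n = k := by
        by_contra h3
        rw [copy, if_neg h3, abs_zero] at h1
        exact absurd h1 (not_lt.2 hτ.le)
      rw [copy, if_pos h3] at h1
      refine ⟨cell t / n, ?_⟩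
      have h4 : cell t / n * n + k = cell t := by
        rw [← h3, mul_comm]; exact Nat.div_add_mod _ _
      have h5 := (cell_eq_iff h2 _).1 rfl
      rw [h4]
      refine ⟨?_, ?_, ?_⟩
      · rw [hE, mem_ofPred_eq]; convert h1 using 3; ring
      · linarith [h5.1]
      · linarith [h5.2]
    · rintro ⟨i, h1, h2, h3⟩
      have h0 : (0 : ℝ) ≤ (i * n + k : ℕ) := Nat.cast_nonneg _
      have ht : 0 < t := by linarith
      have h4 : cell t = i * n + k := (cell_eq_iff ht _).2 ⟨by linarith, by linarith⟩
      refine ⟨?_, ht⟩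
      have h5 : cell t % n = k := by
        rw [h4, Nat.add_comm, Nat.add_mul_mod_self_right, Nat.mod_eq_of_lt hk]
      have h6 : cell t / n = i := by
        rw [h4, Nat.add_comm, Nat.add_mul_div_right _ _ hn, Nat.div_eq_of_lt hk, zero_add]
      rw [copy, if_pos h5, h6, h4]
      rw [hE, mem_ofPred_eq] at h1
      convert h1 using 3
      ring
  have hdisj : Pairwise (Function.onFun Disjoint fun i : ℕ => E ∩ Ioc (i : ℝ) (i + 1)) := by
    intro i j hij
    refine Set.disjoint_left.2 fun t h1 h2 => hij ?_
    have ht : 0 < t := lt_of_le_of_lt (Nat.cast_nonneg i) h1.2.1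
    rw [← (cell_eq_iff ht i).2 h1.2, (cell_eq_iff ht j).2 h2.2]
  have hdisj' : Pairwise (Function.onFun Disjoint fun i : ℕ =>
      (fun t => t + ((i : ℝ) - (i * n + k : ℕ))) ⁻¹' (E ∩ Ioc (i : ℝ) (i + 1))) := by
    intro i j hij
    refine Set.disjoint_left.2 fun t h1 h2 => hij ?_
    have a1 := h1.2.1
    have a2 := h1.2.2
    have b1 := h2.2.1
    have b2 := h2.2.2
    have h0 : (0 : ℝ) ≤ (i * n + k : ℕ) := Nat.cast_nonneg _
    have ht : 0 < t := by linarith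
    have c1 := (cell_eq_iff ht (i * n + k)).2 ⟨by linarith, by linarith⟩
    have c2 := (cell_eq_iff ht (j * n + k)).2 ⟨by linarith, by linarith⟩
    have c3 : i * n = j * n := by omega
    exact Nat.eq_of_mul_eq_mul_right (by omega) c3
  have hm : ∀ i : ℕ, MeasurableSet (E ∩ Ioc (i : ℝ) (i + 1)) := fun i =>
    hEm.inter measurableSet_Ioc
  rw [fnDist, fnDist, halfLine, Measure.restrict_apply' measurableSet_Ioi,
    Measure.restrict_apply' measurableSet_Ioi, ← hE, e1, e2, measure_iUnion hdisj hm,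
    measure_iUnion hdisj' fun i => (measurable_add_const _) (hm i)]
  exact tsum_congr fun i => measure_preimage_add_right volume _ _

theorem copy_eq_zero_or {n i j : ℕ} (hij : i ≠ j) (f g : ℝ → ℝ) (t : ℝ) :
    copy n i f t = 0 ∨ copy n j g t = 0 := by
  by_cases h : cell t % n = i
  · right; rw [copy, if_neg (by omega)]
  · left; rw [copy, if_neg h]

theorem copy_sub (n k : ℕ) (f g : ℝ → ℝ) : copy n k (f - g) = copy n k f - copy n k g := by
  funext t
  simp only [copy, Pi.sub_apply]
  split_ifs <;> simp

theorem copy_smul (n k : ℕ) (c : ℝ) (f : ℝ → ℝ) : copy n k (c • f) = c • copy n k f := by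
  funext t
  simp only [copy, Pi.smul_apply]
  split_ifs <;> simp

/-- The sum of finitely many disjointly supported functions. -/
theorem fnDist_sum {ι : Type*} (s : Finset ι) (f : ι → ℝ → ℝ)
    (hf : ∀ i ∈ s, AEStronglyMeasurable (f i) halfLine)
    (hd : ∀ i ∈ s, ∀ j ∈ s, i ≠ j → ∀ᵐ t ∂halfLine, f i t = 0 ∨ f j t = 0) {τ : ℝ} (hτ : 0 < τ) :
    fnDist (∑ i ∈ s, f i) τ = ∑ i ∈ s, fnDist (f i) τ := by
  have hd' : ∀ᵐ t ∂halfLine, ∀ i ∈ s, ∀ j ∈ s, i ≠ j → f i t = 0 ∨ f j t = 0 := by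
    refine (ae_ball_iff s.countable_toSet).2 fun i hi => (ae_ball_iff s.countable_toSet).2
      fun j hj => ?_
    by_cases hij : i = j
    · exact Eventually.of_forall fun t h => absurd hij h
    · filter_upwards [hd i hi j hj hij] with t ht _ using ht
  -- Almost everywhere at most one summand is nonzero, so the sum equals that summand.
  have e : ({t | τ < |(∑ i ∈ s, f i) t|} : Set ℝ) =ᵐ[halfLine] ⋃ i ∈ s, {t | τ < |f i t|} := by
    filter_upwards [hd'] with t ht
    refine propext ?_
    change τ < |(∑ i ∈ s, f i) t| ↔ t ∈ ⋃ i ∈ s, {t | τ < |f i t|}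
    simp only [mem_iUnion, mem_ofPred_eq, Finset.sum_apply, exists_prop]
    by_cases h : ∃ i ∈ s, f i t ≠ 0
    · obtain ⟨i, hi, h0⟩ := h
      have h1 : ∀ j ∈ s, j ≠ i → f j t = 0 := fun j hj hji => (ht j hj i hi hji).resolve_right h0
      rw [Finset.sum_eq_single_of_mem i hi h1]
      refine ⟨fun h => ⟨i, hi, h⟩, ?_⟩
      rintro ⟨j, hj, h⟩
      by_cases hji : j = i
      · rwa [← hji]
      · rw [h1 j hj hji, abs_zero] at h
        exact absurd h (not_lt.2 hτ.le)
    · push Not at h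
      rw [Finset.sum_eq_zero h, abs_zero]
      refine ⟨fun h => absurd h (not_lt.2 hτ.le), ?_⟩
      rintro ⟨j, hj, h'⟩
      rw [h j hj, abs_zero] at h'
      exact absurd h' (not_lt.2 hτ.le)
  rw [fnDist, measure_congr e, measure_biUnion_finset₀]
  · rfl
  · intro i hi j hj hij
    have := hd i hi j hj hij
    rw [Function.onFun, AEDisjoint]
    refine measure_mono_null (t := {t | ¬ (f i t = 0 ∨ f j t = 0)}) ?_ this
    rintro t ⟨h1, h2⟩
    have h1' : τ < |f i t| := h1
    have h2' : τ < |f j t| := h2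
    simp only [mem_ofPred_eq, not_or]
    constructor
    · intro h; rw [h, abs_zero] at h1'; linarith
    · intro h; rw [h, abs_zero] at h2'; linarith
  · intro i hi
    exact nullMeasurableSet_lt aemeasurable_const (hf i hi).norm.aemeasurable

theorem halfLine_Ioo {t : ℝ} : halfLine (Ioo 0 t) = ENNReal.ofReal t := by
  rw [halfLine, Measure.restrict_apply' measurableSet_Ioi, inter_eq_left.2 fun s hs => hs.1,
    Real.volume_Ioo, sub_zero]

theorem ae_halfLine {p : ℝ → Prop} (h : ∀ t, 0 < t → p t) : ∀ᵐ t ∂halfLine, p t :=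
  (ae_restrict_iff' measurableSet_Ioi).2 (Eventually.of_forall h)

theorem fnDist_indicator (A : Set ℝ) {c τ : ℝ} (hτ : 0 < τ) :
    fnDist (A.indicator fun _ => c) τ = if τ < |c| then halfLine A else 0 := by
  have : {s | τ < |A.indicator (fun _ => c) s|} = if τ < |c| then A else ∅ := by
    ext s
    by_cases hs : s ∈ A <;> by_cases hc : τ < |c| <;> simp [hs, hc, hτ.le]
  rw [fnDist, this]
  split_ifs <;> simp

theorem fnDist_indicator_le {A B : Set ℝ} (h : halfLine A ≤ halfLine B) (c : ℝ) {τ : ℝ}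
    (hτ : 0 < τ) : fnDist (A.indicator fun _ => c) τ ≤ fnDist (B.indicator fun _ => c) τ := by
  rw [fnDist_indicator A hτ, fnDist_indicator B hτ]
  split_ifs
  · exact h
  · exact le_rfl

theorem measurable_dilate {f : ℝ → ℝ} (hf : Measurable f) (c : ℝ) :
    Measurable fun t => f (t / c) := hf.comp (measurable_id.div_const c)

namespace FunctionSpace.IsRearrangementInvariant

variable {X : FunctionSpace} (hX : X.IsRearrangementInvariant)
include hX

theorem fnNorm_copy {n k : ℕ} (hk : k < n) {f : ℝ → ℝ} (hf : Measurable f) :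
    X.fnNorm (copy n k f) = X.fnNorm f :=
  hX.fnNorm_congr_dist (measurable_copy n k hf).aestronglyMeasurable hf.aestronglyMeasurable
    fun _ hτ => fnDist_copy hk hf hτ

theorem fnNorm_dilate_mono {f : ℝ → ℝ} (hf : Measurable f) {c d : ℝ} (hc : 0 < c) (hcd : c ≤ d) :
    X.fnNorm (fun t => f (t / c)) ≤ X.fnNorm fun t => f (t / d) := by
  refine hX.fnNorm_mono_dist (measurable_dilate hf c).aestronglyMeasurable fun τ _ => ?_
  rw [fnDist_dilate f hc, fnDist_dilate f (hc.trans_le hcd)]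
  gcongr

/-- A disjoint sum of copies of dilations is equimeasurable with one dilation. -/
theorem fnNorm_sum_copy_dilate {n : ℕ} {f : ℝ → ℝ} (hf : Measurable f) (j : Fin n → ℕ)
    (hj : ∀ k, 0 < j k) (hn : 0 < n) :
    X.fnNorm (∑ k : Fin n, copy n k fun t => f (t / j k)) =
      X.fnNorm fun t => f (t / (∑ k, j k : ℕ)) := by
  have hm : ∀ k : Fin n, Measurable (copy n k fun t => f (t / j k)) := fun k =>
    measurable_copy n k (measurable_dilate hf _)
  refine hX.fnNorm_congr_dist (Finset.aestronglyMeasurable_sum _ fun k _ =>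
    (hm k).aestronglyMeasurable) (measurable_dilate hf _).aestronglyMeasurable fun τ hτ => ?_
  have hpos : 0 < ∑ k, j k := Finset.sum_pos (fun k _ => hj k) ⟨⟨0, hn⟩, Finset.mem_univ _⟩
  rw [fnDist_dilate f (by exact_mod_cast hpos), fnDist_sum _ _
    (fun k _ => (hm k).aestronglyMeasurable) (fun i _ k _ hik => Eventually.of_forall
      (copy_eq_zero_or (fun h => hik (Fin.ext h)) _ _)) hτ, Nat.cast_sum,
    ENNReal.ofReal_sum_of_nonneg fun _ _ => Nat.cast_nonneg _, Finset.sum_mul]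
  refine Finset.sum_congr rfl fun k _ => ?_
  rw [fnDist_copy k.2 (measurable_dilate hf _) hτ, fnDist_dilate f (by exact_mod_cast hj k)]

/-- The dilation by l is equimeasurable with the sum of l disjoint copies of f; apply the triangle
inequality to that sum. -/
theorem fnNorm_dilate_nat_le {f : ℝ → ℝ} (hf : Measurable f) {l : ℕ} (hl : 0 < l) :
    X.fnNorm (fun t => f (t / l)) ≤ l * X.fnNorm f := by
  have h := hX.fnNorm_sum_copy_dilate (n := l) hf (fun _ => 1) (fun _ => one_pos) hl
  simp only [Nat.cast_one, div_one, Finset.sum_const, Finset.card_univ, Fintype.card_fin,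
    smul_eq_mul, mul_one] at h
  rw [← h]
  refine (fnNorm_sum_le _ _).trans ?_
  rw [Finset.sum_congr rfl fun k _ => hX.fnNorm_copy k.2 hf]
  simp

theorem fnNorm_indicator_mono {A B : Set ℝ} (hA : MeasurableSet A)
    (h : halfLine A ≤ halfLine B) (c : ℝ) :
    X.fnNorm (A.indicator fun _ => c) ≤ X.fnNorm (B.indicator fun _ => c) :=
  hX.fnNorm_mono_dist (measurable_const.indicator hA).aestronglyMeasurable fun _ hτ =>
    fnDist_indicator_le h c hτ

/-! ### The fundamental function -/

omit hX in
theorem extNorm_charFun (t : ℝ) :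
    X.extNorm (charFun t) = X.fnNorm ((Ioo 0 t).indicator fun _ => 1) :=
  (fnNorm_eq (aestronglyMeasurable_const.indicator measurableSet_Ioo)).symm

theorem extNorm_charFun_mul_le {n : ℕ} (hn : 0 < n) (s : ℝ) :
    X.extNorm (charFun (n * s)) ≤ n * X.extNorm (charFun s) := by
  have hn' : (0 : ℝ) < n := by exact_mod_cast hn
  rw [extNorm_charFun, extNorm_charFun]
  refine le_trans (le_of_eq ?_) (hX.fnNorm_dilate_nat_le
    (measurable_const.indicator measurableSet_Ioo) hn)
  congr 1
  funext t
  have : t / n ∈ Ioo 0 s ↔ t ∈ Ioo 0 (n * s) := by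
    simp only [mem_Ioo, div_lt_iff₀' hn', div_pos_iff_of_pos_right hn']
  by_cases h : t ∈ Ioo 0 (n * s)
  · rw [indicator_of_mem h, indicator_of_mem (this.2 h)]
  · rw [indicator_of_notMem h, indicator_of_notMem (mt this.1 h)]

theorem extNorm_charFun_mono {s t : ℝ} (hst : s ≤ t) :
    X.extNorm (charFun s) ≤ X.extNorm (charFun t) := by
  rw [extNorm_charFun, extNorm_charFun]
  refine hX.fnNorm_indicator_mono measurableSet_Ioo ?_ 1
  rw [halfLine_Ioo, halfLine_Ioo]
  exact ENNReal.ofReal_le_ofReal hst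

omit hX in
theorem extNorm_charFun_pos {t : ℝ} (ht : 0 < t) : 0 < X.extNorm (charFun t) := by
  refine pos_iff_ne_zero.2 fun h => ?_
  have h1 := extNorm_eq_zero h
  have h2 : distribution (charFun t) (1 / 2) = distribution 0 (1 / 2) := by rw [h1]
  rw [charFun, distribution_mk, fnDist_indicator _ (by norm_num), halfLine_Ioo,
    if_pos (by norm_num), ← fnDist_coe, fnDist_congr AEEqFun.coeFn_zero, fnDist] at h2
  have h3 : {s : ℝ | (1 / 2 : ℝ) < |(0 : ℝ → ℝ) s|} = ∅ := by
    ext s; simp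
  rw [h3, measure_empty] at h2
  exact absurd (ENNReal.ofReal_eq_zero.1 h2) (not_le.2 ht)

/-- A nonzero element of X exceeds some c > 0 on a set of positive measure, so X contains the
indicator of some (0, s). Subadditivity under integer dilation then reaches every t. -/
theorem extNorm_charFun_ne_top (t : ℝ) : X.extNorm (charFun t) ≠ ∞ := by
  obtain ⟨x, hx⟩ := hX.nontrivial
  obtain ⟨n, hn⟩ : ∃ n : ℕ, halfLine {s | 1 / ((n : ℝ) + 1) < |x.toMeas s|} ≠ 0 := by
    by_contra! h
    refine hx (toMeas_injective (AEEqFun.ext ?_))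
    rw [toMeas_zero]
    have h' := ae_all_iff.2 fun n => (measure_eq_zero_iff_ae_notMem.1 (h n))
    filter_upwards [h', AEEqFun.coeFn_zero (μ := halfLine) (β := ℝ)] with s hs hs0
    rw [hs0, Pi.zero_apply]
    by_contra h0
    obtain ⟨n, hn⟩ := exists_nat_one_div_lt (abs_pos.2 h0)
    exact hs n hn
  set c : ℝ := 1 / ((n : ℝ) + 1) with hc
  have hc0 : 0 < c := by positivity
  obtain ⟨s, hs0, hs⟩ : ∃ s : ℝ, 0 < s ∧ ENNReal.ofReal s ≤ halfLine {s | c < |x.toMeas s|} := by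
    by_cases h : halfLine {s | c < |x.toMeas s|} = ∞
    · exact ⟨1, one_pos, by rw [h]; exact le_top⟩
    · exact ⟨_, ENNReal.toReal_pos hn h, by rw [ENNReal.ofReal_toReal h]⟩
  have h1 : X.fnNorm ((Ioo 0 s).indicator fun _ => c) ≤ X.fnNorm x.toMeas := by
    refine hX.fnNorm_mono_dist (measurable_const.indicator
      measurableSet_Ioo).aestronglyMeasurable fun τ hτ => ?_
    rw [fnDist_indicator _ hτ, halfLine_Ioo]
    split_ifs with h
    · rw [abs_of_pos hc0] at h
      exact hs.trans (measure_mono fun s (hs : c < |x.toMeas s|) => h.trans hs)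
    · exact zero_le
  have h2 : X.extNorm (charFun s) ≠ ∞ := by
    have e : ((Ioo 0 s).indicator fun _ => (1 : ℝ)) = c⁻¹ • (Ioo 0 s).indicator fun _ => c := by
      funext t
      by_cases ht : t ∈ Ioo 0 s <;> simp [ht, hc0.ne']
    rw [extNorm_charFun, e, fnNorm_smul (inv_ne_zero hc0.ne')]
    refine ENNReal.mul_ne_top enorm_ne_top (ne_top_of_le_ne_top ?_ h1)
    rw [fnNorm_coe, extNorm_toMeas]
    exact enorm_ne_top
  obtain ⟨m, hm⟩ := exists_nat_gt (t / s)
  have hm' : t ≤ (m + 1 : ℕ) * s := by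
    rw [div_lt_iff₀ hs0] at hm
    push_cast
    nlinarith
  exact ne_top_of_le_ne_top (ENNReal.mul_ne_top (ENNReal.natCast_ne_top _) h2)
    ((hX.extNorm_charFun_mono hm').trans (hX.extNorm_charFun_mul_le m.succ_pos s))

theorem ofReal_fundamentalFunction (t : ℝ) :
    ENNReal.ofReal (X.fundamentalFunction t) = X.extNorm (charFun t) :=
  ENNReal.ofReal_toReal (hX.extNorm_charFun_ne_top t)

theorem fundamentalFunction_pos {t : ℝ} (ht : 0 < t) : 0 < X.fundamentalFunction t :=
  ENNReal.toReal_pos (extNorm_charFun_pos ht).ne' (hX.extNorm_charFun_ne_top t)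

theorem fundamentalFunction_mono {s t : ℝ} (hst : s ≤ t) :
    X.fundamentalFunction s ≤ X.fundamentalFunction t :=
  ENNReal.toReal_mono (hX.extNorm_charFun_ne_top t) (hX.extNorm_charFun_mono hst)

theorem fundamentalFunction_nat_mul_le {n : ℕ} (hn : 0 < n) (s : ℝ) :
    X.fundamentalFunction (n * s) ≤ n * X.fundamentalFunction s := by
  have := ENNReal.toReal_mono (ENNReal.mul_ne_top (ENNReal.natCast_ne_top n)
    (hX.extNorm_charFun_ne_top s)) (hX.extNorm_charFun_mul_le hn s)
  rwa [ENNReal.toReal_mul, ENNReal.toReal_natCast] at this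

/-- The factor 2 pays for rounding up: ⌈t⌉ ≤ t + 1 ≤ 2 t. -/
theorem fundamentalFunction_mul_le {t s : ℝ} (ht : 1 ≤ t) (hs : 0 < s) :
    X.fundamentalFunction (t * s) ≤ 2 * t * X.fundamentalFunction s := by
  have h1 := Nat.le_ceil t
  have h2 := Nat.ceil_lt_add_one (a := t) (by linarith)
  have h3 : 0 < ⌈t⌉₊ := Nat.ceil_pos.2 (by linarith)
  calc X.fundamentalFunction (t * s) ≤ X.fundamentalFunction (⌈t⌉₊ * s) :=
        hX.fundamentalFunction_mono (by gcongr)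
    _ ≤ ⌈t⌉₊ * X.fundamentalFunction s := hX.fundamentalFunction_nat_mul_le h3 s
    _ ≤ 2 * t * X.fundamentalFunction s := by
      have := (hX.fundamentalFunction_pos hs).le
      gcongr
      linarith

theorem fnNorm_indicator {A : Set ℝ} (hA : MeasurableSet A) {t : ℝ}
    (h : halfLine A = ENNReal.ofReal t) :
    X.fnNorm (A.indicator fun _ => 1) = ENNReal.ofReal (X.fundamentalFunction t) := by
  rw [hX.ofReal_fundamentalFunction, extNorm_charFun]
  exact le_antisymm (hX.fnNorm_indicator_mono hA (by rw [h, halfLine_Ioo]) 1)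
    (hX.fnNorm_indicator_mono measurableSet_Ioo (by rw [h, halfLine_Ioo]) 1)

end FunctionSpace.IsRearrangementInvariant

/-! ### Exponential growth rates -/

/-- Submultiplicative sequences with finite values that are bounded below by a geometric one. -/
structure IsSubmulSeq (N : ℕ → ℝ≥0∞) : Prop where
  mul_le : ∀ m n, N (m + n) ≤ N m * N n
  ne_top : ∀ n, N n ≠ ∞
  lower : ∃ c : ℝ, 0 < c ∧ ∀ n, ENNReal.ofReal (c ^ n) ≤ N n

namespace IsSubmulSeq

variable {N : ℕ → ℝ≥0∞} (hN : IsSubmulSeq N)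
include hN

theorem toReal_pos (n : ℕ) : 0 < (N n).toReal := by
  obtain ⟨c, hc, h⟩ := hN.lower
  exact ENNReal.toReal_pos (lt_of_lt_of_le (ENNReal.ofReal_pos.2 (pow_pos hc n)) (h n)).ne'
    (hN.ne_top n)

/-- Fekete's lemma for log₂ N. This makes the limit hidden in `expRate` a genuine one. -/
theorem tendsto_expRate :
    Tendsto (fun n : ℕ => (1 / (n : ℝ)) * Real.logb 2 (N n).toReal) atTop (𝓝 (expRate N)) := by
  have hsub : Subadditive fun n => Real.logb 2 (N n).toReal := by
    intro m n
    rw [← Real.logb_mul (hN.toReal_pos m).ne' (hN.toReal_pos n).ne', ← ENNReal.toReal_mul]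
    exact Real.logb_le_logb_of_le one_lt_two (hN.toReal_pos _)
      (ENNReal.toReal_mono (ENNReal.mul_ne_top (hN.ne_top m) (hN.ne_top n)) (hN.mul_le m n))
  have hbdd : BddBelow (range fun n : ℕ => Real.logb 2 (N n).toReal / n) := by
    obtain ⟨c, hc, h⟩ := hN.lower
    -- The 0 covers n = 0, where the quotient is 0 by convention.
    refine ⟨min 0 (Real.logb 2 c), ?_⟩
    rintro _ ⟨n, rfl⟩
    rcases Nat.eq_zero_or_pos n with rfl | hn
    · simp
    · have hn' : (0 : ℝ) < n := by exact_mod_cast hn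
      refine (min_le_right _ _).trans ?_
      rw [le_div_iff₀ hn', mul_comm, ← Real.logb_pow]
      refine Real.logb_le_logb_of_le one_lt_two (pow_pos hc n) ?_
      exact (ENNReal.ofReal_le_iff_le_toReal (hN.ne_top n)).1 (h n)
  have h := hsub.tendsto_lim hbdd
  have e : (fun n : ℕ => (1 / (n : ℝ)) * Real.logb 2 (N n).toReal) =
      fun n : ℕ => Real.logb 2 (N n).toReal / n := by
    funext n; rw [one_div, inv_mul_eq_div]
  have h' : Tendsto (fun n : ℕ => (1 / (n : ℝ)) * Real.logb 2 (N n).toReal) atTop (𝓝 hsub.lim) := by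
    rw [e]; exact h
  rw [expRate, h'.limUnder_eq]
  exact h'

omit hN in
theorem tendsto_rate (k r : ℝ) : Tendsto (fun n : ℕ => k / n + r) atTop (𝓝 r) := by
  simpa using (tendsto_const_div_atTop_nhds_zero_nat k).add_const r

omit hN in
theorem logb_rate {K : ℝ} (hK : 0 < K) (r : ℝ) {n : ℕ} (hn : 0 < n) :
    (1 / (n : ℝ)) * Real.logb 2 (K * 2 ^ (n * r)) = Real.logb 2 K / n + r := by
  have hn' : (n : ℝ) ≠ 0 := by positivity
  rw [Real.logb_mul hK.ne' (by positivity), Real.logb_rpow two_pos (by norm_num)]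
  field_simp

/-- A constant factor K contributes log₂ K / n, which vanishes in the limit; so bounds up to
constants suffice for comparing indices. -/
theorem expRate_le {K r : ℝ} (hK : 0 < K)
    (h : ∀ᶠ n : ℕ in atTop, N n ≤ ENNReal.ofReal (K * 2 ^ (n * r))) : expRate N ≤ r := by
  refine le_of_tendsto_of_tendsto hN.tendsto_expRate (tendsto_rate (Real.logb 2 K) r) ?_
  filter_upwards [h, eventually_gt_atTop 0] with n hn hn0
  rw [← logb_rate hK r hn0]
  gcongr
  · norm_num
  · exact hN.toReal_pos n
  · exact ENNReal.toReal_le_of_le_ofReal (by positivity) hn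

theorem le_expRate {K r : ℝ} (hK : 0 < K)
    (h : ∀ᶠ n : ℕ in atTop, ENNReal.ofReal (K * 2 ^ (n * r)) ≤ N n) : r ≤ expRate N := by
  refine le_of_tendsto_of_tendsto (tendsto_rate (Real.logb 2 K) r) hN.tendsto_expRate ?_
  filter_upwards [h, eventually_gt_atTop 0] with n hn hn0
  rw [← logb_rate hK r hn0]
  gcongr
  · norm_num
  · exact (ENNReal.ofReal_le_iff_le_toReal (hN.ne_top n)).1 hn

theorem eventually_le {r : ℝ} (h : expRate N < r) :
    ∀ᶠ n : ℕ in atTop, N n ≤ ENNReal.ofReal (2 ^ (n * r)) := by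
  filter_upwards [hN.tendsto_expRate.eventually (gt_mem_nhds h), eventually_gt_atTop 0]
    with n hn hn0
  have hn' : (0 : ℝ) < n := by exact_mod_cast hn0
  rw [one_div, inv_mul_lt_iff₀ hn', Real.logb_lt_iff_lt_rpow one_lt_two (hN.toReal_pos n)] at hn
  exact (ENNReal.le_ofReal_iff_toReal_le (hN.ne_top n) (by positivity)).2 hn.le

theorem expRate_mono {N' : ℕ → ℝ≥0∞} (hN' : IsSubmulSeq N') (h : ∀ n, N n ≤ N' n) :
    expRate N ≤ expRate N' := by
  refine le_of_tendsto_of_tendsto' hN.tendsto_expRate hN'.tendsto_expRate fun n => ?_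
  gcongr
  · norm_num
  · exact hN.toReal_pos n
  · exact hN'.ne_top n
  · exact h n

end IsSubmulSeq

/-! ### Dilation functions of fundamental functions -/

/-- Positive nondecreasing functions with `ψ (2 ^ n s) ≤ 2 ^ n ψ s`. -/
structure IsDilationRegular (ψ : ℝ → ℝ) : Prop where
  pos : ∀ s, 0 < s → 0 < ψ s
  mono : ∀ s t, s ≤ t → ψ s ≤ ψ t
  dil : ∀ (n : ℕ) (s : ℝ), ψ (2 ^ n * s) ≤ 2 ^ n * ψ s

theorem FunctionSpace.IsRearrangementInvariant.isDilationRegular {X : FunctionSpace}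
    (hX : X.IsRearrangementInvariant) : IsDilationRegular X.fundamentalFunction where
  pos _ hs := hX.fundamentalFunction_pos hs
  mono _ _ h := hX.fundamentalFunction_mono h
  dil n s := by
    have := hX.fundamentalFunction_nat_mul_le (n := 2 ^ n) (by positivity) s
    exact_mod_cast this

namespace IsDilationRegular

variable {ψ : ℝ → ℝ} (h : IsDilationRegular ψ)
include h

theorem ratio_mul_le {t₁ t₂ s : ℝ} (h2 : 0 < t₂) (hs : 0 < s) {a b : ℝ≥0∞}
    (ha : ENNReal.ofReal (ψ (t₁ * (t₂ * s)) / ψ (t₂ * s)) ≤ a)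
    (hb : ENNReal.ofReal (ψ (t₂ * s) / ψ s) ≤ b) :
    ENNReal.ofReal (ψ (t₁ * t₂ * s) / ψ s) ≤ a * b := by
  have p1 := h.pos s hs
  have p2 := h.pos (t₂ * s) (mul_pos h2 hs)
  have e : ψ (t₁ * t₂ * s) / ψ s =
      ψ (t₂ * s) / ψ s * (ψ (t₁ * (t₂ * s)) / ψ (t₂ * s)) := by
    rw [mul_assoc]; field_simp
  rw [e, ENNReal.ofReal_mul (by positivity), mul_comm]
  gcongr

theorem ratio_le_pow (n : ℕ) {s : ℝ} (hs : 0 < s) :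
    ENNReal.ofReal (ψ (2 ^ (n : ℤ) * s) / ψ s) ≤ ENNReal.ofReal (2 ^ n) := by
  rw [zpow_natCast]
  refine ENNReal.ofReal_le_ofReal ((div_le_iff₀ (h.pos s hs)).2 (h.dil n s))

theorem one_le_ratio (n : ℕ) {s : ℝ} (hs : 0 < s) :
    ENNReal.ofReal (1 ^ n) ≤ ENNReal.ofReal (ψ (2 ^ (n : ℤ) * s) / ψ s) := by
  rw [zpow_natCast, one_pow]
  refine ENNReal.ofReal_le_ofReal ((one_le_div (h.pos s hs)).2 (h.mono _ _ ?_))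
  exact le_mul_of_one_le_left hs.le (one_le_pow₀ one_le_two)

theorem ratio_neg_le_one (n : ℕ) {s : ℝ} (hs : 0 < s) :
    ENNReal.ofReal (ψ (2 ^ (-(n : ℤ)) * s) / ψ s) ≤ 1 := by
  rw [zpow_neg, zpow_natCast, ← ENNReal.ofReal_one]
  refine ENNReal.ofReal_le_ofReal ((div_le_one (h.pos s hs)).2 (h.mono _ _ ?_))
  exact mul_le_of_le_one_left hs.le (inv_le_one_of_one_le₀ (one_le_pow₀ one_le_two))

theorem le_ratio_neg (n : ℕ) {s : ℝ} (hs : 0 < s) :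
    ENNReal.ofReal ((1 / 2) ^ n) ≤ ENNReal.ofReal (ψ (2 ^ (-(n : ℤ)) * s) / ψ s) := by
  rw [zpow_neg, zpow_natCast, one_div, inv_pow]
  refine ENNReal.ofReal_le_ofReal ((le_div_iff₀ (h.pos s hs)).2 ?_)
  have := h.dil n ((2 ^ n)⁻¹ * s)
  rw [← mul_assoc, mul_inv_cancel₀ (by positivity), one_mul] at this
  rwa [inv_mul_le_iff₀ (by positivity)]

theorem dilFun_mul_le {t₁ t₂ : ℝ} (h2 : 0 < t₂) :
    dilFun ψ (t₁ * t₂) ≤ dilFun ψ t₁ * dilFun ψ t₂ :=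
  iSup₂_le fun s hs => h.ratio_mul_le h2 hs
    (le_iSup₂ (f := fun (s : ℝ) (_ : 0 < s) => ENNReal.ofReal (ψ (t₁ * s) / ψ s)) (t₂ * s)
      (mul_pos h2 hs))
    (le_iSup₂ (f := fun (s : ℝ) (_ : 0 < s) => ENNReal.ofReal (ψ (t₂ * s) / ψ s)) s hs)

omit h in
theorem le_dilFunZero {t s : ℝ} (hs : 0 < s) (h1 : s ≤ 1) (h2 : t * s ≤ 1) (ht : 0 < t) :
    ENNReal.ofReal (ψ (t * s) / ψ s) ≤ dilFunZero ψ t :=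
  le_iSup_of_le s (le_iSup₂_of_le hs (le_min h1 ((le_div_iff₀' ht).2 h2)) le_rfl)

omit h in
theorem le_dilFunInf {t s : ℝ} (h1 : 1 ≤ s) (h2 : 1 ≤ t * s) (ht : 0 < t) :
    ENNReal.ofReal (ψ (t * s) / ψ s) ≤ dilFunInf ψ t :=
  le_iSup₂_of_le s (max_le h1 ((div_le_iff₀' ht).2 h2)) le_rfl

/-- The quotient is split at t₂ s, which must not leave (0, 1]. It stays there because t₁ ≥ 1 gives
t₂ s ≤ t₁ t₂ s ≤ 1. At infinity the same works for t₁ ≤ 1. -/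
theorem dilFunZero_mul_le {t₁ t₂ : ℝ} (h1 : 1 ≤ t₁) (h2 : 1 ≤ t₂) :
    dilFunZero ψ (t₁ * t₂) ≤ dilFunZero ψ t₁ * dilFunZero ψ t₂ := by
  refine iSup_le fun s => iSup₂_le fun hs hs' => ?_
  have p1 : 0 < t₁ := by linarith
  have p2 : 0 < t₂ := by linarith
  obtain ⟨a, b⟩ := le_min_iff.1 hs'
  rw [le_div_iff₀' (by positivity)] at b
  have c : t₂ * s ≤ 1 := by nlinarith [mul_pos p2 hs]
  exact h.ratio_mul_le p2 hs (le_dilFunZero (by positivity) c (by linarith) p1)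
    (le_dilFunZero hs a c p2)

theorem dilFunInf_mul_le {t₁ t₂ : ℝ} (p1 : 0 < t₁) (p2 : 0 < t₂) (h1 : t₁ ≤ 1) :
    dilFunInf ψ (t₁ * t₂) ≤ dilFunInf ψ t₁ * dilFunInf ψ t₂ := by
  refine iSup₂_le fun s hs' => ?_
  obtain ⟨a, b⟩ := max_le_iff.1 hs'
  have hs : 0 < s := by linarith
  rw [div_le_iff₀' (by positivity)] at b
  have c : 1 ≤ t₂ * s := by nlinarith [mul_pos p2 hs]
  exact h.ratio_mul_le p2 hs (le_dilFunInf c (by linarith) p1) (le_dilFunInf a c p2)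

theorem isSubmulSeq_dilFun : IsSubmulSeq fun n => dilFun ψ (2 ^ (n : ℤ)) where
  mul_le m n := by
    rw [Nat.cast_add, zpow_add₀ two_ne_zero]
    exact h.dilFun_mul_le (by positivity)
  ne_top n := ne_top_of_le_ne_top ENNReal.ofReal_ne_top
    (iSup₂_le fun s hs => h.ratio_le_pow n hs)
  lower := ⟨1, one_pos, fun n => le_iSup₂_of_le 1 one_pos (h.one_le_ratio n one_pos)⟩

theorem isSubmulSeq_dilFun_neg : IsSubmulSeq fun n => dilFun ψ (2 ^ (-(n : ℤ))) where
  mul_le m n := by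
    rw [Nat.cast_add, neg_add, zpow_add₀ two_ne_zero]
    exact h.dilFun_mul_le (by positivity)
  ne_top n := ne_top_of_le_ne_top ENNReal.one_ne_top
    (iSup₂_le fun s hs => h.ratio_neg_le_one n hs)
  lower := ⟨1 / 2, by norm_num, fun n => le_iSup₂_of_le 1 one_pos (h.le_ratio_neg n one_pos)⟩

theorem isSubmulSeq_dilFunZero : IsSubmulSeq fun n => dilFunZero ψ (2 ^ (n : ℤ)) where
  mul_le m n := by
    rw [Nat.cast_add, zpow_add₀ two_ne_zero, zpow_natCast, zpow_natCast]
    exact h.dilFunZero_mul_le (one_le_pow₀ one_le_two) (one_le_pow₀ one_le_two)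
  ne_top n := ne_top_of_le_ne_top ENNReal.ofReal_ne_top
    (iSup_le fun s => iSup₂_le fun hs _ => h.ratio_le_pow n hs)
  lower := ⟨1, one_pos, fun n => (h.one_le_ratio n (s := (2 ^ n)⁻¹) (by positivity)).trans
    (le_dilFunZero (by positivity) (inv_le_one_of_one_le₀ (one_le_pow₀ one_le_two))
      (by rw [zpow_natCast, mul_inv_cancel₀ (by positivity)]) (by positivity))⟩

theorem isSubmulSeq_dilFunInf_neg : IsSubmulSeq fun n => dilFunInf ψ (2 ^ (-(n : ℤ))) where
  mul_le m n := by
    rw [Nat.cast_add, neg_add, zpow_add₀ two_ne_zero]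
    refine h.dilFunInf_mul_le (by positivity) (by positivity) ?_
    rw [zpow_neg, zpow_natCast]
    exact inv_le_one_of_one_le₀ (one_le_pow₀ one_le_two)
  ne_top n := ne_top_of_le_ne_top ENNReal.one_ne_top
    (iSup₂_le fun s hs => h.ratio_neg_le_one n (by linarith [(max_le_iff.1 hs).1]))
  lower := ⟨1 / 2, by norm_num, fun n => (h.le_ratio_neg n (s := 2 ^ n) (by positivity)).trans
    (le_dilFunInf (one_le_pow₀ one_le_two)
      (by rw [zpow_neg, zpow_natCast, inv_mul_cancel₀ (by positivity)]) (by positivity))⟩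

end IsDilationRegular

/-! ### Norms of the dilation operators -/

theorem dyadicDilation_eq (n : ℤ) (x : Meas) :
    dyadicDilation n x =ᵐ[halfLine] fun t => x (t / 2 ^ n) :=
  AEEqFun.coeFn_compQuasiMeasurePreserving x (quasiMeasurePreserving_div (zpow_pos two_pos n))

theorem proj_eq {A : Set ℝ} (hA : MeasurableSet A) (x : Meas) :
    proj A hA x =ᵐ[halfLine] A.indicator x := AEEqFun.coeFn_mk _ _

theorem dyadicDilation_add (m n : ℤ) (x : Meas) :
    dyadicDilation (m + n) x = dyadicDilation m (dyadicDilation n x) := by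
  refine AEEqFun.ext ?_
  filter_upwards [dyadicDilation_eq (m + n) x, dyadicDilation_eq m (dyadicDilation n x),
    (quasiMeasurePreserving_div (zpow_pos two_pos m)).ae (dyadicDilation_eq n x)] with t h1 h2 h3
  rw [h1, h2, h3, zpow_add₀ two_ne_zero, div_div]

theorem dyadicDilation_zero (n : ℤ) : dyadicDilation n 0 = 0 := by
  refine AEEqFun.ext ?_
  filter_upwards [dyadicDilation_eq n 0, AEEqFun.coeFn_zero (μ := halfLine) (β := ℝ),
    (quasiMeasurePreserving_div (zpow_pos two_pos n)).ae
      (AEEqFun.coeFn_zero (μ := halfLine) (β := ℝ))] with t h1 h2 h3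
  rw [h1, h2, h3]
  rfl

theorem proj_zero {A : Set ℝ} (hA : MeasurableSet A) : proj A hA 0 = 0 := by
  refine AEEqFun.ext ?_
  filter_upwards [proj_eq hA 0, AEEqFun.coeFn_zero (μ := halfLine) (β := ℝ)] with t h1 h2
  rw [h1, h2]
  by_cases h : t ∈ A
  · rw [indicator_of_mem h, h2]
  · rw [indicator_of_notMem h]; rfl

theorem proj_proj {A : Set ℝ} (hA : MeasurableSet A) (x : Meas) :
    proj A hA x = proj A hA (proj A hA x) := by
  refine AEEqFun.ext ?_
  filter_upwards [proj_eq hA x, proj_eq hA (proj A hA x)] with t h1 h2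
  rw [h2]
  by_cases h : t ∈ A
  · rw [indicator_of_mem h]
  · rw [h1, indicator_of_notMem h, indicator_of_notMem h]

/-- Cutting off before a dilation does not matter if the dilation maps into the set. -/
theorem proj_dyadicDilation_proj {A : Set ℝ} (hA : MeasurableSet A) {n : ℤ}
    (h : ∀ t, 0 < t → t ∈ A → t / 2 ^ n ∈ A) (x : Meas) :
    proj A hA (dyadicDilation n (proj A hA x)) = proj A hA (dyadicDilation n x) := by
  refine AEEqFun.ext ?_
  filter_upwards [proj_eq hA (dyadicDilation n (proj A hA x)), proj_eq hA (dyadicDilation n x),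
    dyadicDilation_eq n (proj A hA x), dyadicDilation_eq n x,
    (quasiMeasurePreserving_div (zpow_pos two_pos n)).ae (proj_eq hA x),
    ae_halfLine fun t ht => ht] with t h1 h2 h3 h4 h5 ht
  rw [h1, h2]
  by_cases hA : t ∈ A
  · rw [indicator_of_mem hA, indicator_of_mem hA, h3, h4, h5, indicator_of_mem (h t ht hA)]
  · rw [indicator_of_notMem hA, indicator_of_notMem hA]

theorem div_mem_Icc {n : ℤ} (hn : 0 ≤ n) (t : ℝ) (ht : 0 < t) (h : t ∈ Icc (0 : ℝ) 1) :
    t / 2 ^ n ∈ Icc (0 : ℝ) 1 :=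
  ⟨by positivity, (div_le_self ht.le (one_le_zpow₀ one_le_two hn)).trans h.2⟩

theorem div_mem_Ici {n : ℤ} (hn : n ≤ 0) (t : ℝ) (ht : 0 < t) (h : t ∈ Ici (1 : ℝ)) :
    t / 2 ^ n ∈ Ici (1 : ℝ) := by
  have h1 : (1 : ℝ) ≤ t := h
  refine h1.trans ((le_div_iff₀ (by positivity)).2 ?_)
  exact mul_le_of_le_one_right ht.le (zpow_le_one_of_nonpos₀ one_le_two hn)

theorem mem_Ico_zpow_div (n k : ℤ) (t : ℝ) :
    t / 2 ^ n ∈ Ico ((2 : ℝ) ^ (k - n)) (2 ^ (k - n + 1)) ↔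
      t ∈ Ico ((2 : ℝ) ^ k) (2 ^ (k + 1)) := by
  have h : (0 : ℝ) < 2 ^ n := by positivity
  rw [mem_Ico, mem_Ico, le_div_iff₀ h, div_lt_iff₀ h, ← zpow_add₀ two_ne_zero,
    ← zpow_add₀ two_ne_zero, sub_add_cancel, show k - n + 1 + n = k + 1 by ring]

theorem IsDyadicStep.dyadicDilation {x : Meas} (hx : IsDyadicStep x) (n : ℤ) :
    IsDyadicStep (dyadicDilation n x) := by
  obtain ⟨a, ha⟩ := hx
  refine ⟨fun k => a (k - n), fun k => ?_⟩
  filter_upwards [dyadicDilation_eq n x,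
    (quasiMeasurePreserving_div (zpow_pos two_pos n)).ae (ha (k - n))] with t h1 h2 ht
  rw [h1, h2 ((mem_Ico_zpow_div n k t).2 ht)]

theorem IsDyadicStep.proj_Ici {x : Meas} (hx : IsDyadicStep x) :
    IsDyadicStep (proj (Ici 1) measurableSet_Ici x) := by
  obtain ⟨a, ha⟩ := hx
  refine ⟨fun k => if 0 ≤ k then a k else 0, fun k => ?_⟩
  filter_upwards [proj_eq measurableSet_Ici x, ha k] with t h1 h2 ht
  rw [h1]
  split_ifs with hk
  · rw [indicator_of_mem, h2 ht]
    exact le_trans (one_le_zpow₀ one_le_two hk) ht.1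
  · rw [indicator_of_notMem]
    have : (2 : ℝ) ^ (k + 1) ≤ 1 := zpow_le_one_of_nonpos₀ one_le_two (by omega)
    simpa using ht.2.trans_le this

/-! ### Submultiplicativity of the norms of the dilations -/

namespace FunctionSpace

variable {X : FunctionSpace}

variable (X) in
/-- The norm of an operator restricted to the elements of `X` with a given property. -/
def opSup (T : Meas → Meas) (S : Meas → Prop) : ℝ≥0∞ :=
  ⨆ (x : X.Elem) (_ : x ≠ 0) (_ : S x.toMeas), X.extNorm (T x.toMeas) / ‖x‖ₑ

variable {T T₁ T₂ : Meas → Meas} {S : Meas → Prop}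

theorem dilNorm_eq (n : ℤ) : X.dilNorm n = X.opSup (dyadicDilation n) fun _ => True := by
  simp [dilNorm, opSup]

theorem dilNormZero_eq (n : ℤ) : X.dilNormZero n =
    X.opSup (fun x => proj (Icc 0 1) measurableSet_Icc (dyadicDilation n x))
      fun x => x = proj (Icc 0 1) measurableSet_Icc x := rfl

theorem dilNormInf_eq (n : ℤ) : X.dilNormInf n =
    X.opSup (fun x => proj (Ici 1) measurableSet_Ici (dyadicDilation n x))
      fun x => IsDyadicStep x ∧ x = proj (Ici 1) measurableSet_Ici x := by
  simp only [dilNormInf, opSup, iSup_and]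

theorem le_opSup (hT : T 0 = 0) {f : Meas} (hf : S f) (hf' : X.extNorm f ≠ ∞) :
    X.extNorm (T f) ≤ X.opSup T S * X.extNorm f := by
  obtain ⟨x, rfl⟩ := exists_of_extNorm_ne_top hf'
  by_cases hx : x = 0
  · rw [hx, toMeas_zero, hT, extNorm_zero]
    exact zero_le
  · rw [extNorm_toMeas]
    refine (ENNReal.div_le_iff (by simpa using hx) enorm_ne_top).1 ?_
    exact le_iSup₂_of_le x hx (le_iSup_of_le hf le_rfl)

theorem opSup_le {C : ℝ≥0∞} (h : ∀ f, S f → X.extNorm f ≠ ∞ → X.extNorm (T f) ≤ C * X.extNorm f) :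
    X.opSup T S ≤ C := by
  refine iSup₂_le fun x _ => iSup_le fun hS => ENNReal.div_le_of_le_mul ?_
  rw [← extNorm_toMeas]
  exact h _ hS (by rw [extNorm_toMeas]; exact enorm_ne_top)

/-- Finiteness of the norm of T₂ keeps T₂ f inside X, where the bound for T₁ applies. -/
theorem opSup_mul_le (h1 : T₁ 0 = 0) (h2 : T₂ 0 = 0) (hS : ∀ f, S f → S (T₂ f))
    (hT : ∀ f, S f → T f = T₁ (T₂ f)) (ht : X.opSup T₂ S ≠ ∞) :
    X.opSup T S ≤ X.opSup T₁ S * X.opSup T₂ S := by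
  refine opSup_le fun f hf hf' => ?_
  have h := le_opSup h2 hf hf'
  rw [hT f hf, mul_assoc]
  refine (le_opSup h1 (hS f hf) (ne_top_of_le_ne_top (ENNReal.mul_ne_top ht hf') h)).trans ?_
  gcongr

theorem le_opSup_of_ratio (hT : T 0 = 0) {f : Meas} (hf : S f) (hf' : X.extNorm f ≠ ∞)
    (hf0 : X.extNorm f ≠ 0) {c : ℝ≥0∞} (h : c * X.extNorm f ≤ X.extNorm (T f)) :
    c ≤ X.opSup T S :=
  (ENNReal.mul_le_mul_iff_left hf0 hf').1 (h.trans (le_opSup hT hf hf'))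

theorem extNorm_dyadicDilation (n : ℤ) (x : Meas) :
    X.extNorm (dyadicDilation n x) = X.fnNorm fun t => x (t / 2 ^ n) := by
  rw [← fnNorm_coe, fnNorm_congr (dyadicDilation_eq n x)]

namespace IsRearrangementInvariant

variable (hX : X.IsRearrangementInvariant)
include hX

theorem extNorm_mono_abs {f g : Meas} (h : ∀ᵐ t ∂halfLine, |f t| ≤ |g t|) :
    X.extNorm f ≤ X.extNorm g := by
  rw [← fnNorm_coe, ← fnNorm_coe]
  exact hX.fnNorm_mono f.aestronglyMeasurable h

theorem extNorm_proj_le {A : Set ℝ} (hA : MeasurableSet A) (x : Meas) :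
    X.extNorm (proj A hA x) ≤ X.extNorm x := by
  refine hX.extNorm_mono_abs ?_
  filter_upwards [proj_eq hA x] with t h
  rw [h]
  by_cases hA : t ∈ A
  · rw [indicator_of_mem hA]
  · rw [indicator_of_notMem hA, abs_zero]
    exact abs_nonneg _

theorem extNorm_dyadicDilation_nat_le (n : ℕ) (x : Meas) :
    X.extNorm (dyadicDilation n x) ≤ 2 ^ n * X.extNorm x := by
  rw [extNorm_dyadicDilation, ← fnNorm_coe x]
  have := hX.fnNorm_dilate_nat_le (l := 2 ^ n) x.stronglyMeasurable.measurable (by positivity)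
  push_cast at this
  rwa [zpow_natCast]

theorem extNorm_dyadicDilation_mono (x : Meas) {m n : ℤ} (h : m ≤ n) :
    X.extNorm (dyadicDilation m x) ≤ X.extNorm (dyadicDilation n x) := by
  rw [extNorm_dyadicDilation, extNorm_dyadicDilation]
  exact hX.fnNorm_dilate_mono x.stronglyMeasurable.measurable (by positivity)
    (zpow_le_zpow_right₀ one_le_two h)

omit hX in
theorem extNorm_dyadicDilation_zero (x : Meas) :
    X.extNorm (dyadicDilation 0 x) = X.extNorm x := by
  rw [extNorm_dyadicDilation, ← fnNorm_coe x]
  simp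

theorem extNorm_dyadicDilation_neg_le (n : ℕ) (x : Meas) :
    X.extNorm (dyadicDilation (-n) x) ≤ X.extNorm x :=
  (hX.extNorm_dyadicDilation_mono x (by omega)).trans (extNorm_dyadicDilation_zero x).le

omit hX in
theorem dyadicDilation_charFun (n : ℤ) (s : ℝ) :
    dyadicDilation n (charFun s) = charFun (2 ^ n * s) := by
  have e : ∀ s, charFun s =ᵐ[halfLine] (Ioo 0 s).indicator fun _ => (1 : ℝ) := fun s =>
    AEEqFun.coeFn_mk _ _
  refine AEEqFun.ext ?_
  have h2 : (0 : ℝ) < 2 ^ n := by positivity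
  filter_upwards [dyadicDilation_eq n (charFun s), e (2 ^ n * s),
    (quasiMeasurePreserving_div (zpow_pos two_pos n)).ae (e s)] with t h1 h3 h4
  rw [h1, h3, h4]
  have : t / 2 ^ n ∈ Ioo 0 s ↔ t ∈ Ioo 0 (2 ^ n * s) := by
    simp only [mem_Ioo, div_lt_iff₀' h2, div_pos_iff_of_pos_right h2]
  by_cases h : t ∈ Ioo 0 (2 ^ n * s)
  · rw [indicator_of_mem h, indicator_of_mem (this.2 h)]
  · rw [indicator_of_notMem h, indicator_of_notMem (mt this.1 h)]

omit hX in
theorem proj_Icc_charFun {s : ℝ} (hs : s ≤ 1) :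
    proj (Icc 0 1) measurableSet_Icc (charFun s) = charFun s := by
  have e : charFun s =ᵐ[halfLine] (Ioo 0 s).indicator fun _ => (1 : ℝ) :=
    AEEqFun.coeFn_mk _ _
  refine AEEqFun.ext ?_
  filter_upwards [proj_eq measurableSet_Icc (charFun s), e] with t h1 h2
  rw [h1]
  by_cases h : t ∈ Icc (0 : ℝ) 1
  · rw [indicator_of_mem h]
  · rw [indicator_of_notMem h, h2, indicator_of_notMem]
    exact fun h' => h ⟨h'.1.le, h'.2.le.trans hs⟩

theorem dilNorm_nat_le (n : ℕ) : X.dilNorm n ≤ ENNReal.ofReal (2 ^ n) := by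
  rw [dilNorm_eq, ENNReal.ofReal_pow two_pos.le, ENNReal.ofReal_ofNat]
  exact opSup_le fun f _ _ => hX.extNorm_dyadicDilation_nat_le n f

theorem isSubmulSeq_dilNorm : IsSubmulSeq fun n => X.dilNorm (n : ℤ) where
  mul_le m n := by
    simp only [dilNorm_eq, Nat.cast_add]
    refine opSup_mul_le (dyadicDilation_zero _) (dyadicDilation_zero _) (fun _ h => h)
      (fun f _ => dyadicDilation_add _ _ f) ?_
    rw [← dilNorm_eq]
    exact ne_top_of_le_ne_top ENNReal.ofReal_ne_top (hX.dilNorm_nat_le n)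
  ne_top n := ne_top_of_le_ne_top ENNReal.ofReal_ne_top (hX.dilNorm_nat_le n)
  lower := by
    refine ⟨1, one_pos, fun n => ?_⟩
    rw [dilNorm_eq, one_pow, ENNReal.ofReal_one]
    refine le_opSup_of_ratio (dyadicDilation_zero _) trivial (hX.extNorm_charFun_ne_top 1)
      (extNorm_charFun_pos one_pos).ne' ?_
    rw [one_mul, ← extNorm_dyadicDilation_zero (X := X) (charFun 1)]
    conv_rhs => rw [dyadicDilation_charFun]
    rw [dyadicDilation_charFun]
    refine hX.extNorm_charFun_mono ?_
    simpa using one_le_pow₀ (one_le_two : (1 : ℝ) ≤ 2)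

theorem dilNorm_neg_le (n : ℕ) : X.dilNorm (-n) ≤ 1 := by
  rw [dilNorm_eq]
  refine opSup_le fun f _ _ => ?_
  rw [one_mul]
  exact hX.extNorm_dyadicDilation_neg_le n f

theorem le_extNorm_charFun_neg (n : ℕ) (s : ℝ) :
    ENNReal.ofReal ((1 / 2) ^ n) * X.extNorm (charFun s) ≤
      X.extNorm (charFun (2 ^ (-(n : ℤ)) * s)) := by
  rw [← hX.ofReal_fundamentalFunction, ← hX.ofReal_fundamentalFunction,
    ← ENNReal.ofReal_mul (by positivity)]
  refine ENNReal.ofReal_le_ofReal ?_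
  have := hX.isDilationRegular.dil n (2 ^ (-(n : ℤ)) * s)
  rw [← mul_assoc, zpow_neg, zpow_natCast, mul_inv_cancel₀ (by positivity), one_mul] at this
  rwa [one_div, inv_pow, inv_mul_le_iff₀ (by positivity), zpow_neg, zpow_natCast]

theorem isSubmulSeq_dilNorm_neg : IsSubmulSeq fun n => X.dilNorm (-(n : ℤ)) where
  mul_le m n := by
    simp only [dilNorm_eq, Nat.cast_add, neg_add]
    refine opSup_mul_le (dyadicDilation_zero _) (dyadicDilation_zero _) (fun _ h => h)
      (fun f _ => dyadicDilation_add _ _ f) ?_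
    rw [← dilNorm_eq]
    exact ne_top_of_le_ne_top ENNReal.one_ne_top (hX.dilNorm_neg_le n)
  ne_top n := ne_top_of_le_ne_top ENNReal.one_ne_top (hX.dilNorm_neg_le n)
  lower := by
    refine ⟨1 / 2, by norm_num, fun n => ?_⟩
    rw [dilNorm_eq]
    refine le_opSup_of_ratio (dyadicDilation_zero _) trivial (hX.extNorm_charFun_ne_top 1)
      (extNorm_charFun_pos one_pos).ne' ?_
    rw [dyadicDilation_charFun]
    exact hX.le_extNorm_charFun_neg n 1

theorem dilNormZero_le_dilNorm (n : ℤ) : X.dilNormZero n ≤ X.dilNorm n := by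
  rw [dilNormZero_eq, dilNorm_eq]
  exact opSup_le fun f _ hf => (hX.extNorm_proj_le _ _).trans
    (le_opSup (dyadicDilation_zero n) trivial hf)

theorem dilNormInf_le_dilNorm (n : ℤ) : X.dilNormInf n ≤ X.dilNorm n := by
  rw [dilNormInf_eq, dilNorm_eq]
  exact opSup_le fun f _ hf => (hX.extNorm_proj_le _ _).trans
    (le_opSup (dyadicDilation_zero n) trivial hf)

theorem one_le_dilNormZero (n : ℕ) : 1 ≤ X.dilNormZero n := by
  rw [dilNormZero_eq]
  have h1 : ((2 : ℝ) ^ n)⁻¹ ≤ 1 := inv_le_one_of_one_le₀ (one_le_pow₀ one_le_two)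
  refine le_opSup_of_ratio (f := charFun (2 ^ n)⁻¹) (by rw [dyadicDilation_zero, proj_zero])
    (proj_Icc_charFun h1).symm (hX.extNorm_charFun_ne_top _)
    (extNorm_charFun_pos (by positivity)).ne' ?_
  rw [one_mul, dyadicDilation_charFun, zpow_natCast, mul_inv_cancel₀ (by positivity),
    proj_Icc_charFun le_rfl]
  exact hX.extNorm_charFun_mono h1

theorem isSubmulSeq_dilNormZero : IsSubmulSeq fun n => X.dilNormZero (n : ℤ) where
  mul_le m n := by
    simp only [dilNormZero_eq, Nat.cast_add]
    refine opSup_mul_le (by rw [dyadicDilation_zero, proj_zero])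
      (by rw [dyadicDilation_zero, proj_zero]) (fun f _ => proj_proj _ _) (fun f _ => ?_) ?_
    -- For m ≥ 0 the values of σ_{2^m} x on [0,1] depend only on x on [0,1], so the intermediate
    -- cut-off is harmless.
    · rw [proj_dyadicDilation_proj measurableSet_Icc (div_mem_Icc (Nat.cast_nonneg m)),
        dyadicDilation_add]
    · rw [← dilNormZero_eq]
      exact ne_top_of_le_ne_top ENNReal.ofReal_ne_top
        ((hX.dilNormZero_le_dilNorm n).trans (hX.dilNorm_nat_le n))
  ne_top n := ne_top_of_le_ne_top ENNReal.ofReal_ne_top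
    ((hX.dilNormZero_le_dilNorm n).trans (hX.dilNorm_nat_le n))
  lower := ⟨1, one_pos, fun n => by simpa using hX.one_le_dilNormZero n⟩

omit hX in
theorem isDyadicStep_mk_indicator (k : ℤ) {f : Meas}
    (hf : f =ᵐ[halfLine] (Ico ((2 : ℝ) ^ k) (2 ^ (k + 1))).indicator fun _ => 1) :
    IsDyadicStep f := by
  refine ⟨fun j => if j = k then 1 else 0, fun j => ?_⟩
  filter_upwards [hf] with t ht htj
  rw [ht]
  split_ifs with h
  · rw [indicator_of_mem (h ▸ htj)]
  · rw [indicator_of_notMem]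
    intro htk
    have h1 := (zpow_lt_zpow_iff_right₀ (one_lt_two (α := ℝ))).1 (htj.1.trans_lt htk.2)
    have h2 := (zpow_lt_zpow_iff_right₀ (one_lt_two (α := ℝ))).1 (htk.1.trans_lt htj.2)
    omega

omit hX in
theorem halfLine_Ico_zpow (k : ℤ) :
    halfLine (Ico ((2 : ℝ) ^ k) (2 ^ (k + 1))) = ENNReal.ofReal (2 ^ k) := by
  have hk : (0 : ℝ) < 2 ^ k := by positivity
  have hsub : Ico ((2 : ℝ) ^ k) (2 ^ (k + 1)) ⊆ Ioi 0 := fun s hs => hk.trans_le hs.1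
  rw [halfLine, Measure.restrict_apply' measurableSet_Ioi, inter_eq_left.2 hsub, Real.volume_Ico, zpow_add_one₀ two_ne_zero]
  congr 1
  ring

/-- Backward dilations see only the part on [1,∞), so intermediate cut-offs are harmless, and both
operations preserve dyadic steps. The lower bound is tested on the dyadic block [2^n, 2^{n+1}),
which is carried onto [1, 2). -/
theorem isSubmulSeq_dilNormInf_neg : IsSubmulSeq fun n => X.dilNormInf (-(n : ℤ)) where
  mul_le m n := by
    simp only [dilNormInf_eq, Nat.cast_add, neg_add]
    refine opSup_mul_le (by rw [dyadicDilation_zero, proj_zero])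
      (by rw [dyadicDilation_zero, proj_zero])
      (fun f hf => ⟨(hf.1.dyadicDilation _).proj_Ici, proj_proj _ _⟩) (fun f _ => ?_) ?_
    · rw [proj_dyadicDilation_proj measurableSet_Ici (div_mem_Ici (by omega)),
        dyadicDilation_add]
    · rw [← dilNormInf_eq]
      exact ne_top_of_le_ne_top ENNReal.one_ne_top
        ((hX.dilNormInf_le_dilNorm _).trans (hX.dilNorm_neg_le n))
  ne_top n := ne_top_of_le_ne_top ENNReal.one_ne_top
    ((hX.dilNormInf_le_dilNorm _).trans (hX.dilNorm_neg_le n))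
  lower := by
    refine ⟨1 / 2, by norm_num, fun n => ?_⟩
    have hm : ∀ k : ℤ, Measurable ((Ico ((2 : ℝ) ^ k) (2 ^ (k + 1))).indicator fun _ => (1 : ℝ)) :=
      fun k => measurable_const.indicator measurableSet_Ico
    set f : ℤ → Meas := fun k => AEEqFun.mk _ (hm k).aestronglyMeasurable
    have hf : ∀ k, f k =ᵐ[halfLine] (Ico ((2 : ℝ) ^ k) (2 ^ (k + 1))).indicator fun _ => 1 :=
      fun k => AEEqFun.coeFn_mk _ _
    have hproj : ∀ k : ℤ, 0 ≤ k → f k = proj (Ici 1) measurableSet_Ici (f k) := by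
      intro k hk
      refine AEEqFun.ext ?_
      filter_upwards [proj_eq measurableSet_Ici (f k), hf k] with t h1 h2
      rw [h1]
      by_cases h : t ∈ Ici (1 : ℝ)
      · rw [indicator_of_mem h]
      · rw [h2, indicator_of_notMem h, indicator_of_notMem]
        exact fun h' => h (le_trans (one_le_zpow₀ one_le_two hk) h'.1)
    have hdil : dyadicDilation (-(n : ℤ)) (f n) = f 0 := by
      refine AEEqFun.ext ?_
      filter_upwards [dyadicDilation_eq (-n) (f n), hf 0, (quasiMeasurePreserving_div
        (zpow_pos two_pos (-(n : ℤ)))).ae (hf n)] with t h1 h2 h3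
      rw [h1, h2, h3]
      have := mem_Ico_zpow_div (-n) 0 t
      rw [zero_sub, neg_neg] at this
      by_cases h : t ∈ Ico ((2 : ℝ) ^ (0 : ℤ)) (2 ^ ((0 : ℤ) + 1))
      · rw [indicator_of_mem h, indicator_of_mem (this.2 h)]
      · rw [indicator_of_notMem h, indicator_of_notMem (mt this.1 h)]
    have hnorm : ∀ k, X.extNorm (f k) = X.extNorm (charFun (2 ^ k)) := fun k => by
      rw [← fnNorm_coe, fnNorm_congr (hf k), hX.fnNorm_indicator measurableSet_Ico
        (halfLine_Ico_zpow k), hX.ofReal_fundamentalFunction]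
    rw [dilNormInf_eq]
    refine le_opSup_of_ratio (f := f n) (by rw [dyadicDilation_zero, proj_zero])
      ⟨isDyadicStep_mk_indicator n (hf n), hproj n (by omega)⟩ ?_ ?_ ?_
    · rw [hnorm]; exact hX.extNorm_charFun_ne_top _
    · rw [hnorm]; exact (extNorm_charFun_pos (by positivity)).ne'
    · rw [hdil, ← hproj 0 le_rfl, hnorm, hnorm]
      refine (hX.le_extNorm_charFun_neg n _).trans (le_of_eq ?_)
      rw [← zpow_add₀ two_ne_zero, neg_add_cancel]

end IsRearrangementInvariant

end FunctionSpace

/-! ### Dyadic majorants -/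

/-- Realises a prescribed value d ∈ [0,∞] as the measure of an initial interval, so that
inequalities between distributions can be proved as inclusions of sets. -/
theorem halfLine_setOf_ofReal_lt (d : ℝ≥0∞) : halfLine {s | ENNReal.ofReal s < d} = d := by
  by_cases hd : d = ∞
  · have : {s : ℝ | ENNReal.ofReal s < d} = univ := by
      ext s; simp [hd]
    rw [this, hd, halfLine, Measure.restrict_apply_univ, Real.volume_Ioi]
  · have e : {s : ℝ | ENNReal.ofReal s < d} ∩ Ioi 0 = Ioo 0 d.toReal ∩ Ioi 0 := by
      ext s
      simp only [mem_inter_iff, mem_ofPred_eq, mem_Ioi, mem_Ioo]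
      constructor
      · rintro ⟨h, hs⟩
        exact ⟨⟨hs, (ENNReal.ofReal_lt_iff_lt_toReal hs.le hd).1 h⟩, hs⟩
      · rintro ⟨⟨hs, h⟩, -⟩
        exact ⟨(ENNReal.ofReal_lt_iff_lt_toReal hs.le hd).2 h, hs⟩
    rw [halfLine, Measure.restrict_apply' measurableSet_Ioi, e,
      ← Measure.restrict_apply' measurableSet_Ioi]
    exact halfLine_Ioo.trans (ENNReal.ofReal_toReal hd)

theorem distribution_smul_two (x : Meas) (τ : ℝ) :
    distribution ((2 : ℝ) • x) τ = distribution x (τ / 2) := by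
  rw [← fnDist_coe, fnDist_congr (AEEqFun.coeFn_smul (2 : ℝ) x), fnDist, distribution]
  congr 1
  ext s
  change τ < |2 * x s| ↔ τ / 2 < |x s|
  rw [abs_mul, abs_two, div_lt_iff₀' two_pos]

theorem distribution_dyadicDilation (n : ℤ) (x : Meas) (τ : ℝ) :
    distribution (dyadicDilation n x) τ = ENNReal.ofReal (2 ^ n) * distribution x τ := by
  rw [← fnDist_coe, fnDist_congr (dyadicDilation_eq n x), fnDist_dilate _ (by positivity),
    fnDist_coe]

/-- This and the next lemma say that x* and the distribution function are generalised inverses, with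
the strictness each direction allows. -/
theorem lt_distribution_of_lt_rearrangement {x : Meas} {t τ : ℝ} (hτ : 0 ≤ τ)
    (h : ENNReal.ofReal τ < rearrangement x t) : ENNReal.ofReal t < distribution x τ := by
  by_contra! h'
  exact absurd (iInf₂_le (⟨τ, hτ⟩ : ℝ≥0) h') (not_le.2 (by
    rwa [ENNReal.ofReal_eq_coe_nnreal hτ] at h))

theorem le_rearrangement_of_lt_distribution {x : Meas} {t τ : ℝ}
    (h : ENNReal.ofReal t < distribution x τ) : ENNReal.ofReal τ ≤ rearrangement x t := by
  refine le_iInf₂ fun σ hσ => ?_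
  by_contra! h'
  have h1 : (σ : ℝ) < τ := by
    rw [← ENNReal.ofReal_coe_nnreal] at h'
    exact (ENNReal.ofReal_lt_ofReal_iff'.1 h').1
  refine absurd (h.trans_le (le_trans ?_ hσ)) (lt_irrefl _)
  exact measure_mono fun s (hs : τ < |x s|) => h1.trans hs

theorem floor_logb_eq_iff {t : ℝ} (ht : 0 < t) (k : ℤ) :
    ⌊Real.logb 2 t⌋ = k ↔ t ∈ Ico ((2 : ℝ) ^ k) (2 ^ (k + 1)) := by
  rw [Int.floor_eq_iff, mem_Ico, Real.le_logb_iff_rpow_le one_lt_two ht,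
    Real.logb_lt_iff_lt_rpow one_lt_two ht, Real.rpow_intCast]
  norm_cast

namespace FunctionSpace.IsRearrangementInvariant

variable {X : FunctionSpace} (hX : X.IsRearrangementInvariant)
include hX

/-- If x*(t) = ∞, then |x| exceeds every c on a set of measure greater than t, so c φ(t) ≤ ‖x‖ for
all integers c > 0. -/
theorem rearrangement_ne_top {x : Meas} (hx : X.extNorm x ≠ ∞) {t : ℝ} (ht : 0 < t) :
    rearrangement x t ≠ ∞ := by
  intro h
  have h1 : ∀ c : ℕ, 0 < c → c * X.extNorm (charFun t) ≤ X.extNorm x := by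
    intro c hc
    have hc' : (0 : ℝ) < c := by exact_mod_cast hc
    have e : ((Ioo 0 t).indicator fun _ => (c : ℝ)) = (c : ℝ) • (Ioo 0 t).indicator fun _ => 1 := by
      funext s
      by_cases hs : s ∈ Ioo 0 t <;> simp [hs]
    have h2 : X.fnNorm ((Ioo 0 t).indicator fun _ => (c : ℝ)) ≤ X.fnNorm x := by
      refine hX.fnNorm_mono_dist (measurable_const.indicator
        measurableSet_Ioo).aestronglyMeasurable fun τ hτ => ?_
      rw [fnDist_indicator _ hτ, halfLine_Ioo]
      split_ifs
      · exact (lt_distribution_of_lt_rearrangement hτ.le (by rw [h]; simp)).le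
      · exact zero_le
    rwa [e, fnNorm_smul hc'.ne', ← extNorm_charFun, fnNorm_coe, Real.enorm_natCast] at h2
  have h0 := hX.ofReal_fundamentalFunction t
  have hp := hX.fundamentalFunction_pos ht
  obtain ⟨c, hc⟩ := exists_nat_gt ((X.extNorm x).toReal / X.fundamentalFunction t)
  rw [div_lt_iff₀ hp] at hc
  have hc0 : 0 < c := by
    rcases Nat.eq_zero_or_pos c with rfl | h
    · rw [Nat.cast_zero, zero_mul] at hc
      exact absurd hc (not_lt.2 ENNReal.toReal_nonneg)
    · exact h
  have h3 := ENNReal.toReal_mono hx (h1 c hc0)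
  rw [← h0, ENNReal.toReal_mul, ENNReal.toReal_natCast, ENNReal.toReal_ofReal hp.le] at h3
  linarith

/-- Up to equivalence of distributions, a function in `X` can be replaced by a dyadic step
function. -/
theorem exists_dyadicStep {x : Meas} (hx : X.extNorm x ≠ ∞) :
    ∃ y : Meas, IsDyadicStep y ∧ ∀ τ : ℝ, 0 < τ → distribution x τ ≤ distribution y τ ∧
      distribution y τ ≤ 2 * distribution x (τ / 2) := by
  -- The step function is 2 x*(2^k) on [2^k, 2^{k+1}), the value at the left endpoint because x*
  -- decreases. The factor 2 turns τ ≤ x*(2^k) into the strict inequality that the distribution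
  -- requires. The other direction loses a factor 2 in measure, as t ≤ 2 · 2^k.
  set r : ℤ → ℝ := fun k => 2 * (rearrangement x (2 ^ k)).toReal with hr
  set f : ℝ → ℝ := fun t => r ⌊Real.logb 2 t⌋ with hf
  have hfm : Measurable f :=
    (measurable_from_top (f := r)).comp
      (Int.measurable_floor.comp (Real.measurable_log.div_const (Real.log 2)))
  have hr0 : ∀ k, 0 ≤ r k := fun k => mul_nonneg two_pos.le ENNReal.toReal_nonneg
  have hfin : ∀ k : ℤ, rearrangement x (2 ^ k) ≠ ∞ := fun k =>
    hX.rearrangement_ne_top hx (by positivity)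
  refine ⟨AEEqFun.mk f hfm.aestronglyMeasurable, ⟨r, fun k => ?_⟩, fun τ hτ => ?_⟩
  · filter_upwards [AEEqFun.coeFn_mk f hfm.aestronglyMeasurable, ae_halfLine fun t ht => ht]
      with t h1 ht htk
    rw [h1, hf]
    simp only
    rw [(floor_logb_eq_iff ht k).2 htk]
  · rw [distribution_mk]
    constructor
    · rw [← halfLine_setOf_ofReal_lt (distribution x τ)]
      refine measure_mono_ae (ae_halfLine fun t ht => ?_)
      intro (h : ENNReal.ofReal t < distribution x τ)
      change τ < |r ⌊Real.logb 2 t⌋|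
      have hk := (floor_logb_eq_iff ht _).1 rfl
      rw [abs_of_nonneg (hr0 _)]
      have h2 := le_rearrangement_of_lt_distribution
        (lt_of_le_of_lt (ENNReal.ofReal_le_ofReal hk.1) h)
      have h3 := (ENNReal.ofReal_le_iff_le_toReal (hfin _)).1 h2
      simp only [hr]
      linarith
    · rw [← halfLine_setOf_ofReal_lt (2 * distribution x (τ / 2))]
      refine measure_mono_ae (ae_halfLine fun t ht => ?_)
      intro (h : τ < |r ⌊Real.logb 2 t⌋|)
      change ENNReal.ofReal t < 2 * distribution x (τ / 2)
      have hk := (floor_logb_eq_iff ht _).1 rfl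
      set k := ⌊Real.logb 2 t⌋
      rw [abs_of_nonneg (hr0 _)] at h
      have h2 : τ / 2 < (rearrangement x (2 ^ k)).toReal := by
        simp only [hr] at h; linarith
      have h3 := lt_distribution_of_lt_rearrangement (by positivity)
        ((ENNReal.ofReal_lt_iff_lt_toReal (by positivity) (hfin k)).2 h2)
      have h4 : t ≤ 2 * 2 ^ k := by
        have := hk.2
        rw [zpow_add_one₀ two_ne_zero] at this
        linarith
      calc ENNReal.ofReal t ≤ ENNReal.ofReal (2 * 2 ^ k) := ENNReal.ofReal_le_ofReal h4
        _ = 2 * ENNReal.ofReal (2 ^ k) := by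
          rw [ENNReal.ofReal_mul two_pos.le, ENNReal.ofReal_ofNat]
        _ < 2 * distribution x (τ / 2) :=
          ENNReal.mul_lt_mul_right two_ne_zero ENNReal.ofNat_ne_top h3

theorem extNorm_le_proj_add (f : Meas) : X.extNorm f ≤
    X.extNorm (proj (Icc 0 1) measurableSet_Icc f) +
      X.extNorm (proj (Ici 1) measurableSet_Ici f) := by
  set A := proj (Icc 0 1) measurableSet_Icc f with hA
  set B := proj (Ici 1) measurableSet_Ici f with hB
  rw [← fnNorm_coe, ← fnNorm_coe, ← fnNorm_coe]
  refine le_trans (hX.fnNorm_mono (g := |(A : ℝ → ℝ)| + |(B : ℝ → ℝ)|)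
    (AEEqFun.aestronglyMeasurable _) ?_) ((fnNorm_add_le _ _).trans ?_)
  · filter_upwards [proj_eq measurableSet_Icc f, proj_eq measurableSet_Ici f,
      ae_halfLine fun t ht => ht] with t a b ht
    refine le_trans ?_ (le_abs_self _)
    rw [Pi.add_apply, Pi.abs_apply, Pi.abs_apply]
    rcases le_total t 1 with h | h
    · rw [hA, a, indicator_of_mem (show t ∈ Icc (0 : ℝ) 1 from ⟨ht.le, h⟩)]
      exact le_add_of_nonneg_right (abs_nonneg _)
    · rw [hB, b, indicator_of_mem (show t ∈ Ici (1 : ℝ) from h)]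
      exact le_add_of_nonneg_left (abs_nonneg _)
  · refine add_le_add ?_ ?_
    · exact hX.fnNorm_mono A.aestronglyMeasurable.norm (by simp)
    · exact hX.fnNorm_mono B.aestronglyMeasurable.norm (by simp)

/-- No support condition on y is needed: cutting y off to [0,1] first changes nothing, because 2^n ≥
1. The analogue at infinity uses 2^{-n} ≤ 1. -/
theorem extNorm_proj_Icc_le (n : ℕ) {y : Meas} (hy : X.extNorm y ≠ ∞) :
    X.extNorm (proj (Icc 0 1) measurableSet_Icc (dyadicDilation n y)) ≤
      X.dilNormZero n * X.extNorm y := by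
  have hy0 := hX.extNorm_proj_le measurableSet_Icc (A := Icc (0 : ℝ) 1) y
  rw [← proj_dyadicDilation_proj measurableSet_Icc (div_mem_Icc (Nat.cast_nonneg n)),
    dilNormZero_eq]
  refine (le_opSup (T := fun x => proj (Icc 0 1) measurableSet_Icc (dyadicDilation n x))
    (S := fun x => x = proj (Icc 0 1) measurableSet_Icc x) (by rw [dyadicDilation_zero, proj_zero]) (proj_proj measurableSet_Icc y)
    (ne_top_of_le_ne_top hy hy0)).trans ?_
  exact mul_le_mul_right hy0 _

theorem extNorm_proj_Ici_le (n : ℕ) {y : Meas} (hd : IsDyadicStep y) (hy : X.extNorm y ≠ ∞) :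
    X.extNorm (proj (Ici 1) measurableSet_Ici (dyadicDilation (-n) y)) ≤
      X.dilNormInf (-n) * X.extNorm y := by
  have hy0 := hX.extNorm_proj_le measurableSet_Ici (A := Ici (1 : ℝ)) y
  rw [← proj_dyadicDilation_proj measurableSet_Ici (div_mem_Ici (by omega)), dilNormInf_eq]
  have hS : IsDyadicStep (proj (Ici 1) measurableSet_Ici y) ∧
      proj (Ici 1) measurableSet_Ici y =
        proj (Ici 1) measurableSet_Ici (proj (Ici 1) measurableSet_Ici y) :=
    ⟨hd.proj_Ici, proj_proj measurableSet_Ici _⟩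
  refine (le_opSup (T := fun x => proj (Ici 1) measurableSet_Ici (dyadicDilation (-n) x))
    (S := fun x => IsDyadicStep x ∧ x = proj (Ici 1) measurableSet_Ici x)
    (by rw [dyadicDilation_zero, proj_zero]) hS (ne_top_of_le_ne_top hy hy0)).trans ?_
  exact mul_le_mul_right hy0 _

/-! ### Growth of the norms of dilations -/

omit hX in
variable (X) in
/-- There are elements of `X` whose dilations grow like `2 ^ (j θ)` for arbitrarily long time. -/
def _root_.SymRep.FunctionSpace.HasGrowth (θ : ℝ) : Prop :=
  ∃ C : ℝ, 0 < C ∧ ∀ m : ℕ, ∃ x : Meas, ∀ j : ℕ, j ≤ m →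
    ENNReal.ofReal (C⁻¹ * 2 ^ (j * θ)) ≤ X.extNorm (dyadicDilation j x) ∧
    X.extNorm (dyadicDilation j x) ≤ ENNReal.ofReal (C * 2 ^ (j * θ))

variable {θ : ℝ} (hθ : X.HasGrowth θ)
include hθ

theorem le_upperBoyd : θ ≤ X.upperBoyd := by
  obtain ⟨C, hC, h⟩ := hθ
  refine hX.isSubmulSeq_dilNorm.le_expRate (K := C⁻¹ * C⁻¹) (by positivity)
    (Eventually.of_forall fun m => ?_)
  obtain ⟨x, hx⟩ := h m
  have h0 := hx 0 m.zero_le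
  have h1 := hx m le_rfl
  simp only [zero_mul, Real.rpow_zero, mul_one, extNorm_dyadicDilation_zero,
    CharP.cast_eq_zero] at h0
  rw [dilNorm_eq]
  refine le_opSup_of_ratio (f := x) (dyadicDilation_zero _) trivial
    (ne_top_of_le_ne_top ENNReal.ofReal_ne_top h0.2)
    (lt_of_lt_of_le (ENNReal.ofReal_pos.2 (by positivity)) h0.1).ne' (le_trans ?_ h1.1)
  refine (mul_le_mul_right h0.2 _).trans ?_
  rw [← ENNReal.ofReal_mul (by positivity)]
  refine ENNReal.ofReal_le_ofReal (le_of_eq ?_)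
  field_simp

/-- The backward dilation is tested on σ_{2^m} x, which it returns to x. -/
theorem lowerBoyd_le : X.lowerBoyd ≤ θ := by
  obtain ⟨C, hC, h⟩ := hθ
  refine neg_le.1 (hX.isSubmulSeq_dilNorm_neg.le_expRate (K := C⁻¹ * C⁻¹) (by positivity)
    (Eventually.of_forall fun m => ?_))
  obtain ⟨x, hx⟩ := h m
  have h0 := hx 0 m.zero_le
  have h1 := hx m le_rfl
  simp only [zero_mul, Real.rpow_zero, mul_one, extNorm_dyadicDilation_zero,
    CharP.cast_eq_zero] at h0
  rw [dilNorm_eq]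
  refine le_opSup_of_ratio (f := dyadicDilation m x) (dyadicDilation_zero _) trivial
    (ne_top_of_le_ne_top ENNReal.ofReal_ne_top h1.2)
    (lt_of_lt_of_le (ENNReal.ofReal_pos.2 (by positivity)) h1.1).ne' ?_
  rw [← dyadicDilation_add, neg_add_cancel, extNorm_dyadicDilation_zero]
  refine le_trans ((mul_le_mul_right h1.2 _).trans ?_) h0.1
  rw [← ENNReal.ofReal_mul (by positivity)]
  refine ENNReal.ofReal_le_ofReal (le_of_eq ?_)
  rw [mul_neg, Real.rpow_neg two_pos.le]
  field_simp

/-- In the middle of a long growth window, the part of the dilated function on [0,1] has come from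
the left end too slowly to have norm 2^{nθ}, since β^0 < θ. The part on [1,∞), traced back from the
right end, has shrunk too fast, since α^∞ > θ. The two parts together cannot have the required norm.
-/
theorem growth_gap (h0 : X.upperBoydZero < θ) (h1 : θ < X.lowerBoydInf) : False := by
  obtain ⟨C, hC, h⟩ := hθ
  obtain ⟨r₀, hr₀, hr₀'⟩ := exists_between h0
  obtain ⟨r₁, hr₁, hr₁'⟩ := exists_between h1
  have hz := hX.isSubmulSeq_dilNormZero.eventually_le hr₀
  have hi := hX.isSubmulSeq_dilNormInf_neg.eventually_le (lt_neg.1 hr₁')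
  have hlim : ∀ c : ℝ, 0 < c → Tendsto (fun n : ℕ => (2 : ℝ) ^ (n * (-c))) atTop (𝓝 0) := by
    intro c hc
    have : (2 : ℝ) ^ (-c) < 1 := Real.rpow_lt_one_of_one_lt_of_neg one_lt_two (by linarith)
    refine (tendsto_pow_atTop_nhds_zero_of_lt_one (by positivity) this).congr fun n => ?_
    rw [mul_comm, Real.rpow_mul two_pos.le, Real.rpow_natCast]
  have hl := (hlim (θ - r₀) (by linarith)).add (hlim (r₁ - θ) (by linarith))
  rw [add_zero] at hl
  -- After division by 2^{nθ} the two parts contribute at most 4C times this sum, against the lower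
  -- bound C⁻¹; this fixes the threshold C⁻²/4.
  obtain ⟨n, hzn, hin, hn⟩ := (hz.and (hi.and (hl.eventually
    (gt_mem_nhds (show 0 < C⁻¹ * C⁻¹ / 4 by positivity))))).exists
  obtain ⟨x, hx⟩ := h (n + n)
  have hx0 := hx 0 (Nat.zero_le _)
  simp only [zero_mul, Real.rpow_zero, mul_one, extNorm_dyadicDilation_zero,
    CharP.cast_eq_zero] at hx0
  obtain ⟨y, hy, hxy⟩ := hX.exists_dyadicStep (ne_top_of_le_ne_top ENNReal.ofReal_ne_top hx0.2)
  have hle : ∀ j : ℕ, X.extNorm (dyadicDilation j x) ≤ X.extNorm (dyadicDilation j y) := by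
    intro j
    refine hX.extNorm_mono fun τ hτ => ?_
    rw [distribution_dyadicDilation, distribution_dyadicDilation]
    gcongr
    exact (hxy τ hτ).1
  -- The distribution of y is dominated by that of 2 σ_2 x; the scalar and the dilation each cost a
  -- factor 2 in norm.
  have hge : ∀ j : ℕ, j ≤ n + n →
      X.extNorm (dyadicDilation j y) ≤ ENNReal.ofReal (4 * C * 2 ^ (j * θ)) := by
    intro j hj
    calc X.extNorm (dyadicDilation j y)
        ≤ X.extNorm ((2 : ℝ) • dyadicDilation (1 : ℕ) (dyadicDilation j x)) := by
          refine hX.extNorm_mono fun τ hτ => ?_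
          rw [distribution_smul_two, distribution_dyadicDilation, distribution_dyadicDilation,
            distribution_dyadicDilation, mul_left_comm]
          gcongr
          simpa using (hxy τ hτ).2
      _ ≤ 2 * (2 * X.extNorm (dyadicDilation j x)) := by
          refine (extNorm_smul_le _ _).trans ?_
          have := hX.extNorm_dyadicDilation_nat_le 1 (dyadicDilation j x)
          rw [pow_one] at this
          have e : ‖(2 : ℝ)‖ₑ = 2 := by simpa using Real.enorm_natCast 2
          rw [e]
          gcongr
      _ ≤ 2 * (2 * ENNReal.ofReal (C * 2 ^ (j * θ))) := by gcongr; exact (hx j hj).2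
      _ = ENNReal.ofReal (4 * C * 2 ^ (j * θ)) := by
          rw [show 4 * C * 2 ^ (j * θ) = 2 * (2 * (C * 2 ^ (j * θ))) by ring,
            ENNReal.ofReal_mul two_pos.le, ENNReal.ofReal_mul two_pos.le, ENNReal.ofReal_ofNat]
  have hy0 := hge 0 (Nat.zero_le _)
  simp only [zero_mul, Real.rpow_zero, mul_one, extNorm_dyadicDilation_zero,
    CharP.cast_eq_zero] at hy0
  have hy1 := hge (n + n) le_rfl
  have hA' : X.extNorm (proj (Icc 0 1) measurableSet_Icc (dyadicDilation n y)) ≤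
      ENNReal.ofReal (2 ^ (n * r₀) * (4 * C)) := by
    rw [ENNReal.ofReal_mul (by positivity)]
    exact (hX.extNorm_proj_Icc_le n (ne_top_of_le_ne_top ENNReal.ofReal_ne_top hy0)).trans
      (mul_le_mul' hzn hy0)
  have hB' : X.extNorm (proj (Ici 1) measurableSet_Ici (dyadicDilation n y)) ≤
      ENNReal.ofReal (2 ^ (n * -r₁) * (4 * C * 2 ^ ((n + n : ℕ) * θ))) := by
    have e : dyadicDilation n y = dyadicDilation (-n) (dyadicDilation (n + n : ℕ) y) := by
      rw [← dyadicDilation_add]; congr 1; push_cast; ring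
    rw [e, ENNReal.ofReal_mul (by positivity)]
    exact (hX.extNorm_proj_Ici_le n (hy.dyadicDilation _)
      (ne_top_of_le_ne_top ENNReal.ofReal_ne_top hy1)).trans (mul_le_mul' hin hy1)
  have hAB := hX.extNorm_le_proj_add (dyadicDilation n y)
  have key := ((hx n (by omega)).1.trans (hle n)).trans (hAB.trans (add_le_add hA' hB'))
  rw [← ENNReal.ofReal_add (by positivity) (by positivity),
    ENNReal.ofReal_le_ofReal_iff (by positivity)] at key
  set u : ℝ := 2 ^ (n * θ) with hu
  have hu0 : 0 < u := by positivity
  have e1 : (2 : ℝ) ^ (n * r₀) = u * 2 ^ (n * (-(θ - r₀))) := by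
    rw [hu, ← Real.rpow_add two_pos]; congr 1; ring
  have e2 : (2 : ℝ) ^ (n * -r₁) * (4 * C * 2 ^ ((n + n : ℕ) * θ)) =
      u * 2 ^ (n * (-(r₁ - θ))) * (4 * C) := by
    rw [show (2 : ℝ) ^ (n * -r₁) * (4 * C * 2 ^ ((n + n : ℕ) * θ)) =
      2 ^ (n * -r₁) * 2 ^ ((n + n : ℕ) * θ) * (4 * C) by ring, hu, ← Real.rpow_add two_pos,
      ← Real.rpow_add two_pos]
    congr 2
    push_cast
    ring
  rw [e1, e2] at key
  have key2 : u * C⁻¹ ≤ u * ((2 ^ (n * (-(θ - r₀))) + 2 ^ (n * (-(r₁ - θ)))) * (4 * C)) := by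
    linarith
  have key3 := le_of_mul_le_mul_left key2 hu0
  have key4 := mul_lt_mul_of_pos_right hn (show 0 < 4 * C by positivity)
  have e3 : C⁻¹ * C⁻¹ / 4 * (4 * C) = C⁻¹ := by field_simp
  linarith

end FunctionSpace.IsRearrangementInvariant

/-! ### Crude symmetric representability implies growth -/

/-- The reciprocal of an exponent, as a real number. -/
def expRecip (p : ℝ≥0∞) : ℝ := p⁻¹.toReal

theorem norm_toLp_indicator {p : ℝ≥0∞} (hp : 1 ≤ p) {n : ℕ} (s : Finset (Fin n))
    (hs : s.Nonempty) :
    ‖(WithLp.toLp p fun k => if k ∈ s then 1 else 0 : PiLp p fun _ : Fin n => ℝ)‖ =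
      (s.card : ℝ) ^ expRecip p := by
  rcases eq_or_ne p ∞ with rfl | hp'
  · rw [PiLp.norm_eq_ciSup, expRecip, ENNReal.inv_top, ENNReal.toReal_zero, Real.rpow_zero]
    obtain ⟨i, hi⟩ := hs
    have : Nonempty (Fin n) := ⟨i⟩
    refine le_antisymm (ciSup_le fun k => ?_) ?_
    · change ‖(if k ∈ s then 1 else 0 : ℝ)‖ ≤ 1
      split_ifs <;> simp
    · refine le_ciSup_of_le (Set.finite_range _).bddAbove i ?_
      change 1 ≤ ‖(if i ∈ s then 1 else 0 : ℝ)‖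
      simp [hi]
  · have hp0 : 0 < p.toReal := ENNReal.toReal_pos (by positivity) hp'
    rw [PiLp.norm_eq_sum hp0, expRecip, ENNReal.toReal_inv, one_div]
    congr 1
    have : ∀ k : Fin n, ‖(if k ∈ s then 1 else 0 : ℝ)‖ ^ p.toReal = if k ∈ s then 1 else 0 := by
      intro k
      split_ifs
      · simp
      · simp [hp0.ne']
    refine (Finset.sum_congr rfl fun k _ => this k).trans ?_
    simp

namespace FunctionSpace

variable {X : FunctionSpace}

theorem toMeas_sum {ι : Type*} (s : Finset ι) (x : ι → X.Elem) :
    (∑ i ∈ s, x i).toMeas = ∑ i ∈ s, (x i).toMeas :=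
  map_sum X.carrier.subtype (fun i => (show X.carrier from x i)) s

theorem coeFn_sum {ι : Type*} (s : Finset ι) (f : ι → Meas) :
    (∑ i ∈ s, f i : Meas) =ᵐ[halfLine] ∑ i ∈ s, (f i : ℝ → ℝ) := by
  classical
  induction s using Finset.induction_on with
  | empty => simpa using AEEqFun.coeFn_zero
  | insert i s hi ih =>
    rw [Finset.sum_insert hi, Finset.sum_insert hi]
    filter_upwards [AEEqFun.coeFn_add (f i) (∑ i ∈ s, f i), ih] with t h1 h2
    rw [h1, Pi.add_apply, Pi.add_apply, h2]

/-- Test the ℓ^p estimate on 0-1 vectors with 2^j ones: the sum of the corresponding x_k is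
equimeasurable with σ_{2^j} x_0, and the vector has ℓ^p norm 2^{j/p}. -/
theorem IsRearrangementInvariant.hasGrowth_of_mem_crudeSymRep (hX : X.IsRearrangementInvariant)
    {p : ℝ≥0∞} (hp : p ∈ X.crudeSymRep) : X.HasGrowth (expRecip p) := by
  obtain ⟨hp1, C, hC, h⟩ := hp
  refine ⟨C, hC, fun m => ?_⟩
  obtain ⟨x, heq, hdis, hnorm⟩ := h (2 ^ m)
  set i₀ : Fin (2 ^ m) := ⟨0, by positivity⟩
  refine ⟨(x i₀).toMeas, fun j hj => ?_⟩
  obtain ⟨s, -, hs⟩ : ∃ s ⊆ (Finset.univ : Finset (Fin (2 ^ m))), s.card = 2 ^ j :=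
    Finset.exists_subset_card_eq (by
      rw [Finset.card_univ, Fintype.card_fin]; exact Nat.pow_le_pow_right two_pos hj)
  have hs0 : s.Nonempty := Finset.card_pos.1 (by rw [hs]; positivity)
  have key := hnorm fun k => if k ∈ s then 1 else 0
  rw [norm_toLp_indicator hp1 s hs0, hs] at key
  have e1 : ∑ k, (if k ∈ s then (1 : ℝ) else 0) • x k = ∑ k ∈ s, x k := by
    simp [ite_smul, Finset.sum_ite_mem]
  rw [e1] at key
  have e2 : X.extNorm (dyadicDilation j (x i₀).toMeas) = ENNReal.ofReal ‖∑ k ∈ s, x k‖ := by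
    rw [ofReal_norm, ← extNorm_toMeas, toMeas_sum]
    refine le_antisymm (hX.extNorm_mono fun τ hτ => ?_) (hX.extNorm_mono fun τ hτ => ?_) <;>
    · rw [distribution_dyadicDilation, ← fnDist_coe (∑ k ∈ s, (x k).toMeas),
        fnDist_congr (coeFn_sum s _), fnDist_sum s _ (fun i _ => (x i).toMeas.aestronglyMeasurable)
        (fun i _ k _ hik => hdis i k hik) hτ,
        Finset.sum_congr rfl fun k _ => (by
          rw [fnDist_coe]; exact heq k i₀ τ hτ :
            fnDist (x k).toMeas τ = distribution (x i₀).toMeas τ), Finset.sum_const, hs,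
        nsmul_eq_mul, zpow_natCast, ENNReal.ofReal_pow two_pos.le, ENNReal.ofReal_ofNat]
      simp
  have e3 : (((2 ^ j : ℕ) : ℝ)) ^ expRecip p = 2 ^ (j * expRecip p) := by
    rw [Real.rpow_mul two_pos.le, Real.rpow_natCast]
    push_cast
    rfl
  rw [e3] at key
  rw [e2]
  exact ⟨ENNReal.ofReal_le_ofReal key.1, ENNReal.ofReal_le_ofReal key.2⟩

end FunctionSpace

/-! ### Balanced points of a fundamental function -/

theorem eventually_le_two_pow (R : ℝ) : ∀ᶠ n : ℕ in atTop, R ≤ (2 : ℝ) ^ n :=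
  (tendsto_pow_atTop_atTop_of_one_lt one_lt_two).eventually_ge_atTop R

/-- If `θ` is between the dilation indices of `ψ`, and not in the gap `(ν_ψ^0, μ_ψ^∞)`, then
there are points with a long interval of average growth at least `θ - δ` to the left and a long
interval of average growth at most `θ + δ` to the right. -/
theorem IsDilationRegular.exists_balanced {ψ : ℝ → ℝ} (h : IsDilationRegular ψ)
    (hmul : ∀ t s, 1 ≤ t → 0 < s → ψ (t * s) ≤ 2 * t * ψ s) {θ δ R : ℝ}
    (h1 : lowerDil ψ ≤ θ) (h2 : θ ≤ upperDil ψ) (h3 : θ ≤ upperDilZero ψ ∨ lowerDilInf ψ ≤ θ)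
    (hδ : 0 < δ) (hR : 1 ≤ R) :
    ∃ a b c : ℝ, 0 < a ∧ R * a ≤ b ∧ R * b ≤ c ∧ (b / a) ^ (θ - δ) ≤ ψ b / ψ a ∧
      ψ c / ψ b ≤ (c / b) ^ (θ + δ) := by
  by_contra! hcon
  have hR0 : 0 < R := by linarith
  -- A: growth below exponent θ - δ over every long interval ending at b. B: growth above exponent θ
  -- + δ over every long interval starting at b. Without a balanced point, every b satisfies A or B.
  set A : ℝ → Prop := fun b => ∀ a, 0 < a → R * a ≤ b → ψ b / ψ a < (b / a) ^ (θ - δ) with hA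
  set B : ℝ → Prop := fun b => ∀ c, R * b ≤ c → (c / b) ^ (θ + δ) < ψ c / ψ b with hB
  have hAB : ∀ b, A b ∨ B b := by
    intro b
    by_contra! hb
    simp only [hA, hB] at hb
    push Not at hb
    obtain ⟨⟨a, ha, hab, h'⟩, c, hbc, h''⟩ := hb
    exact absurd h'' (not_le.2 (hcon a b c ha hab hbc h'))
  -- If B held at b', the growth from b' to b would be both below exponent θ - δ and above exponent
  -- θ + δ. So A is inherited to the left, up to a factor R.
  have hAA : ∀ b b', A b → 0 < b' → R * b' ≤ b → A b' := by
    intro b b' hb hb' hbb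
    refine (hAB b').resolve_right fun hBb => ?_
    have e1 := hb b' hb' hbb
    have e2 := hBb b hbb
    have e3 : 1 ≤ b / b' := (one_le_div hb').2 (le_trans (le_mul_of_one_le_left hb'.le hR) hbb)
    have e4 : (b / b') ^ (θ - δ) ≤ (b / b') ^ (θ + δ) :=
      Real.rpow_le_rpow_of_exponent_le e3 (by linarith)
    linarith
  have hAbound : ∀ (n : ℕ) (s : ℝ), 0 < s → R ≤ 2 ^ n → A (2 ^ n * s) →
      ψ (2 ^ n * s) / ψ s ≤ 2 ^ (n * (θ - δ)) := by
    intro n s hs hn hA'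
    have := hA' s hs (by gcongr)
    rw [mul_div_cancel_right₀ _ hs.ne', ← Real.rpow_natCast, ← Real.rpow_mul two_pos.le] at this
    rw [Real.rpow_natCast] at this
    exact this.le
  have hBbound : ∀ (n : ℕ) (s : ℝ), 0 < s → R ≤ 2 ^ n → B ((2 ^ n)⁻¹ * s) →
      ψ ((2 ^ n)⁻¹ * s) / ψ s ≤ 2 ^ (n * -(θ + δ)) := by
    intro n s hs hn hB'
    have h2n : (0 : ℝ) < 2 ^ n := by positivity
    have := hB' s (by
      rw [← mul_assoc, ← div_eq_mul_inv]
      exact mul_le_of_le_one_left hs.le ((div_le_one h2n).2 hn))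
    rw [show s / ((2 ^ n)⁻¹ * s) = 2 ^ n by field_simp, ← Real.rpow_natCast 2 n,
      ← Real.rpow_mul two_pos.le, Real.rpow_natCast] at this
    rw [mul_neg, Real.rpow_neg two_pos.le, ← inv_div]
    exact inv_anti₀ (by positivity) this.le
  -- A everywhere forces ν_ψ ≤ θ - δ and A nowhere forces μ_ψ ≥ θ + δ. Otherwise A holds near 0 and
  -- B near ∞, which puts θ strictly inside the gap (ν_ψ^0, μ_ψ^∞).
  by_cases hall : ∀ b, 0 < b → A b
  · have : upperDil ψ ≤ θ - δ := by
      refine h.isSubmulSeq_dilFun.expRate_le one_pos ?_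
      filter_upwards [eventually_le_two_pow R] with n hn
      refine iSup₂_le fun s hs => ENNReal.ofReal_le_ofReal ?_
      rw [zpow_natCast, one_mul]
      exact hAbound n s hs hn (hall _ (by positivity))
    linarith
  by_cases hnone : ∀ b, 0 < b → ¬ A b
  · have : -lowerDil ψ ≤ -(θ + δ) := by
      rw [lowerDil, neg_neg]
      refine h.isSubmulSeq_dilFun_neg.expRate_le one_pos ?_
      filter_upwards [eventually_le_two_pow R] with n hn
      refine iSup₂_le fun s hs => ENNReal.ofReal_le_ofReal ?_
      rw [zpow_neg, zpow_natCast, one_mul]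
      exact hBbound n s hs hn ((hAB _).resolve_left (hnone _ (by positivity)))
    linarith
  push Not at hall hnone
  obtain ⟨b₂, hb₂, hA₂⟩ := hall
  obtain ⟨b₁, hb₁, hA₁⟩ := hnone
  have hz : upperDilZero ψ ≤ θ - δ := by
    -- Scaling by β moves (0, 1] into the region where A is known; by regularity of ψ this costs
    -- only the constant 2 β⁻¹.
    set β : ℝ := min 1 (b₁ / R) with hβ
    have hβ0 : 0 < β := lt_min one_pos (by positivity)
    refine h.isSubmulSeq_dilFunZero.expRate_le (K := 2 * β⁻¹) (by positivity) ?_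
    filter_upwards [eventually_le_two_pow R] with n hn
    refine iSup_le fun s => iSup₂_le fun hs hs' => ENNReal.ofReal_le_ofReal ?_
    rw [zpow_natCast] at hs' ⊢
    have hs1 : 2 ^ n * s ≤ 1 := (le_div_iff₀' (by positivity)).1 (le_min_iff.1 hs').2
    have hA' : A (2 ^ n * (β * s)) := by
      refine hAA b₁ _ hA₁ (by positivity) ?_
      have : β * (2 ^ n * s) ≤ b₁ / R := (mul_le_of_le_one_right hβ0.le hs1).trans (min_le_right _ _)
      rw [le_div_iff₀' hR0] at this
      linarith
    have k1 := hAbound n (β * s) (by positivity) hn hA'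
    have k2 := hmul β⁻¹ (2 ^ n * (β * s)) ((one_le_inv₀ hβ0).2 (min_le_left _ _)) (by positivity)
    rw [show β⁻¹ * (2 ^ n * (β * s)) = 2 ^ n * s by field_simp] at k2
    have k3 : ψ (β * s) ≤ ψ s := h.mono _ _ (mul_le_of_le_one_left hs.le (min_le_left _ _))
    have p1 := h.pos (β * s) (by positivity)
    have p2 := h.pos (2 ^ n * (β * s)) (by positivity)
    calc ψ (2 ^ n * s) / ψ s ≤ 2 * β⁻¹ * ψ (2 ^ n * (β * s)) / ψ (β * s) := by gcongr
      _ = 2 * β⁻¹ * (ψ (2 ^ n * (β * s)) / ψ (β * s)) := mul_div_assoc _ _ _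
      _ ≤ 2 * β⁻¹ * 2 ^ (n * (θ - δ)) := by gcongr
  have hi : -lowerDilInf ψ ≤ -(θ + δ) := by
    rw [lowerDilInf, neg_neg]
    -- Scaling by β moves [1, ∞) beyond R b₂, where A must fail and so B holds; the cost is the
    -- constant 2 β.
    set β : ℝ := max 1 (R * b₂) with hβ
    have hβ1 : 1 ≤ β := le_max_left _ _
    have hβ0 : 0 < β := by linarith
    refine h.isSubmulSeq_dilFunInf_neg.expRate_le (K := 2 * β) (by positivity) ?_
    filter_upwards [eventually_le_two_pow R] with n hn
    refine iSup₂_le fun s hs' => ENNReal.ofReal_le_ofReal ?_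
    rw [zpow_neg, zpow_natCast] at hs' ⊢
    have hs : 0 < s := by linarith [(max_le_iff.1 hs').1]
    have hs1 : 1 ≤ (2 ^ n)⁻¹ * s := by
      have := (max_le_iff.1 hs').2
      rwa [div_le_iff₀' (by positivity)] at this
    have hB' : B ((2 ^ n)⁻¹ * (β * s)) := by
      refine (hAB _).resolve_left fun hA' => hA₂ (hAA _ _ hA' hb₂ ?_)
      calc R * b₂ ≤ β := le_max_right _ _
        _ ≤ β * ((2 ^ n)⁻¹ * s) := le_mul_of_one_le_right hβ0.le hs1
        _ = (2 ^ n)⁻¹ * (β * s) := by ring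
    have k1 := hBbound n (β * s) (by positivity) hn hB'
    have k2 := hmul β s hβ1 hs
    have k3 : ψ ((2 ^ n)⁻¹ * s) ≤ ψ ((2 ^ n)⁻¹ * (β * s)) := h.mono _ _ (by
      gcongr; exact le_mul_of_one_le_left hs.le hβ1)
    have p1 := h.pos (β * s) (by positivity)
    have p2 := h.pos s hs
    rw [div_le_iff₀ p1] at k1
    rw [div_le_iff₀ p2]
    calc ψ ((2 ^ n)⁻¹ * s) ≤ 2 ^ (n * -(θ + δ)) * ψ (β * s) := k3.trans k1
      _ ≤ 2 ^ (n * -(θ + δ)) * (2 * β * ψ s) := by gcongr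
      _ = 2 * β * 2 ^ (n * -(θ + δ)) * ψ s := by ring
  rcases h3 with h3 | h3 <;> linarith

/-! ### Approximate common eigenfunctions of the dilations -/

/-- A power function with a slowly varying weight centred at `b`. -/
def tent (θ κ b t : ℝ) : ℝ := t ^ (-θ) * min (t / b) (b / t) ^ κ

theorem measurable_tent (θ κ b : ℝ) : Measurable (tent θ κ b) := by
  unfold tent
  fun_prop

section tent

variable {θ κ b : ℝ} (hθ : 0 ≤ θ) (hκ : 0 ≤ κ) (hb : 0 < b)

include hb in
theorem tent_pos {t : ℝ} (ht : 0 < t) : 0 < tent θ κ b t :=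
  mul_pos (by positivity) (Real.rpow_pos_of_pos (lt_min (by positivity) (by positivity)) _)

include hκ hb in
theorem tent_weight_le {s t L : ℝ} (hs : 0 < s) (ht : 0 < t) (h1 : s ≤ L * t) (h2 : t ≤ L * s) :
    min (s / b) (b / s) ^ κ ≤ L ^ κ * min (t / b) (b / t) ^ κ := by
  have hL : 0 < L := by
    by_contra! h
    nlinarith
  have hm : ∀ t : ℝ, 0 < t → 0 < min (t / b) (b / t) := fun t ht =>
    lt_min (by positivity) (by positivity)
  rw [← Real.mul_rpow hL.le (hm t ht).le]
  refine Real.rpow_le_rpow (hm s hs).le ?_ hκ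
  rw [mul_min_of_nonneg _ _ hL.le]
  refine min_le_min ?_ ?_
  · rw [← mul_div_assoc]; gcongr
  · rw [← mul_div_assoc, div_le_div_iff₀ hs ht]; nlinarith

include hθ hκ hb in
theorem tent_le {s t L : ℝ} (hs : 0 < s) (ht : 0 < t) (h1 : s ≤ L * t) (h2 : t ≤ L * s) :
    tent θ κ b s ≤ L ^ θ * L ^ κ * tent θ κ b t := by
  have hL : 0 < L := by
    by_contra! h
    nlinarith
  have e : s ^ (-θ) ≤ L ^ θ * t ^ (-θ) := by
    rw [Real.rpow_neg hs.le, Real.rpow_neg ht.le, inv_le_iff_one_le_mul₀ (by positivity),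
      mul_right_comm, ← Real.mul_rpow hL.le hs.le, ← div_eq_mul_inv, one_le_div (by positivity)]
    exact Real.rpow_le_rpow ht.le h2 hθ
  have hw := tent_weight_le hκ hb hs ht h1 h2
  have hm : 0 < min (s / b) (b / s) := lt_min (by positivity) (by positivity)
  calc tent θ κ b s ≤ L ^ θ * t ^ (-θ) * (L ^ κ * min (t / b) (b / t) ^ κ) := by
        unfold tent; gcongr
    _ = _ := by unfold tent; ring

include hκ hb in
-- The power t^{-θ} is an exact eigenfunction of the dilation, so the error comes from the weight
-- alone, which changes by a factor between L^{-κ} and L^κ.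
theorem abs_tent_div_sub_le {t L : ℝ} (ht : 0 < t) (hL : 1 ≤ L) :
    |tent θ κ b (t / L) - L ^ θ * tent θ κ b t| ≤ L ^ θ * (L ^ κ - 1) * tent θ κ b t := by
  have hL0 : 0 < L := by linarith
  have hs : 0 < t / L := by positivity
  have e : (t / L) ^ (-θ) = L ^ θ * t ^ (-θ) := by
    rw [Real.div_rpow ht.le hL0.le, Real.rpow_neg hL0.le, div_inv_eq_mul, mul_comm]
  have e1 : t / L ≤ L * t := (div_le_self ht.le hL).trans (le_mul_of_one_le_left ht.le hL)
  have e2 : t ≤ L * (t / L) := by rw [mul_div_cancel₀ _ hL0.ne']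
  have w1 := tent_weight_le hκ hb hs ht e1 e2
  have w2 := tent_weight_le hκ hb ht hs e2 e1
  have hm : 0 < min (t / b) (b / t) ^ κ :=
    Real.rpow_pos_of_pos (lt_min (by positivity) (by positivity)) _
  have hLk : 1 ≤ L ^ κ := Real.one_le_rpow hL hκ
  unfold tent
  rw [e]
  set u := min (t / b) (b / t) ^ κ
  set v := min (t / L / b) (b / (t / L)) ^ κ
  have hv : |v - u| ≤ (L ^ κ - 1) * u := by
    rw [abs_le]
    constructor <;> nlinarith
  calc |L ^ θ * t ^ (-θ) * v - L ^ θ * (t ^ (-θ) * u)| = L ^ θ * t ^ (-θ) * |v - u| := by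
        rw [show L ^ θ * t ^ (-θ) * v - L ^ θ * (t ^ (-θ) * u) = L ^ θ * t ^ (-θ) * (v - u) by ring,
          abs_mul, abs_of_pos (by positivity)]
    _ ≤ L ^ θ * t ^ (-θ) * ((L ^ κ - 1) * u) := by gcongr
    _ = _ := by ring

include hθ hκ hb in
-- Where t and t/L both lie in [a, c) only the weight matters. Otherwise exactly one of them does,
-- or neither: either t is within a factor L above a, or t/L is within a factor L below c. There the
-- function is comparable to its value at that endpoint.
theorem abs_indicator_tent_sub_le {a c L : ℝ} (ha : 0 < a) (hc : 0 < c) (hL : 1 ≤ L) {t : ℝ}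
    (ht : 0 < t) : |(Ico a c).indicator (tent θ κ b) (t / L) - L ^ θ * (Ico a c).indicator (tent θ κ b) t| ≤
      L ^ θ * (L ^ κ - 1) * (Ico a c).indicator (tent θ κ b) t +
      L ^ θ * (L ^ θ * L ^ κ * tent θ κ b a) * (Ioo 0 (L * a)).indicator (fun _ => 1) t +
      L ^ θ * (L ^ θ * L ^ κ * tent θ κ b c) * (Ioo 0 (L * c)).indicator (fun _ => 1) t := by
  have hL0 : 0 < L := by linarith
  have hLk : 1 ≤ L ^ κ := Real.one_le_rpow hL hκ
  have hLt : 1 ≤ L ^ θ := Real.one_le_rpow hL hθ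
  have q1 : 0 ≤ L ^ θ * (L ^ κ - 1) * (Ico a c).indicator (tent θ κ b) t := by
    refine mul_nonneg (mul_nonneg (by positivity) (by linarith)) (indicator_nonneg ?_ t)
    exact fun s hs => (tent_pos hb (ha.trans_le hs.1)).le
  have q2 : 0 ≤ L ^ θ * (L ^ θ * L ^ κ * tent θ κ b a) *
      (Ioo 0 (L * a)).indicator (fun _ => (1 : ℝ)) t := by
    have := tent_pos (θ := θ) (κ := κ) hb ha
    exact mul_nonneg (by positivity) (indicator_nonneg (fun _ _ => zero_le_one) t)
  have q3 : 0 ≤ L ^ θ * (L ^ θ * L ^ κ * tent θ κ b c) *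
      (Ioo 0 (L * c)).indicator (fun _ => (1 : ℝ)) t := by
    have := tent_pos (θ := θ) (κ := κ) hb hc
    exact mul_nonneg (by positivity) (indicator_nonneg (fun _ _ => zero_le_one) t)
  have m1 : t / L ∈ Ico a c ↔ L * a ≤ t ∧ t < L * c := by
    rw [mem_Ico, le_div_iff₀' hL0, div_lt_iff₀' hL0]
  by_cases h1 : t ∈ Ico a c
  · by_cases h2 : t / L ∈ Ico a c
    · have k := abs_tent_div_sub_le (θ := θ) hκ hb ht hL
      rw [indicator_of_mem h1] at q1 ⊢
      rw [indicator_of_mem h2]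
      linarith
    · have h3 : t < L * a := by
        by_contra! h
        exact h2 (m1.2 ⟨h, h1.2.trans_le (le_mul_of_one_le_left hc.le hL)⟩)
      have k := tent_le hθ hκ hb ht ha h3.le (h1.1.trans (le_mul_of_one_le_left ht.le hL))
      have k0 := tent_pos (θ := θ) (κ := κ) hb ht
      rw [indicator_of_notMem h2, zero_sub, abs_neg, indicator_of_mem h1,
        indicator_of_mem (show t ∈ Ioo 0 (L * a) from ⟨ht, h3⟩), abs_of_pos (by positivity), mul_one]
      rw [indicator_of_mem h1] at q1
      have := mul_le_mul_of_nonneg_left k (zero_le_one.trans hLt)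
      linarith
  · by_cases h2 : t / L ∈ Ico a c
    · have h3 := m1.1 h2
      have h4 : c ≤ t := by
        by_contra! h
        exact h1 ⟨(le_mul_of_one_le_left ha.le hL).trans h3.1, h⟩
      have hs : 0 < t / L := by positivity
      have k := tent_le hθ hκ hb hs hc (h2.2.le.trans (le_mul_of_one_le_left hc.le hL))
        (by rwa [mul_div_cancel₀ _ hL0.ne'])
      have k0 := tent_pos (θ := θ) (κ := κ) hb hs
      have k1 := tent_pos (θ := θ) (κ := κ) hb hc
      rw [indicator_of_mem h2, indicator_of_notMem h1, mul_zero, sub_zero, mul_zero, zero_add,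
        abs_of_pos k0, indicator_of_mem (show t ∈ Ioo 0 (L * c) from ⟨ht, h3.2⟩), mul_one]
      -- The extra L^θ is not forced here; it gives the two boundary terms the same shape.
      have := le_mul_of_one_le_left (a := L ^ θ) (b := L ^ θ * L ^ κ * tent θ κ b c)
        (by positivity) hLt
      linarith
    · have : |(Ico a c).indicator (tent θ κ b) (t / L) -
        L ^ θ * (Ico a c).indicator (tent θ κ b) t| = 0 := by
        rw [indicator_of_notMem h2, indicator_of_notMem h1]; simp
      linarith

end tent

namespace FunctionSpace

variable {X : FunctionSpace}

variable (X) in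
/-- The dilations have approximate common eigenfunctions in `X`, with eigenvalues `l ^ θ`. -/
def HasNearEigenfunctions (θ : ℝ) : Prop :=
  ∀ (N : ℕ) (η : ℝ), 0 < η → ∃ f : ℝ → ℝ, Measurable f ∧ X.fnNorm f ≠ 0 ∧ X.fnNorm f ≠ ∞ ∧
    ∀ l : ℕ, 0 < l → l ≤ N →
      X.fnNorm ((fun t => f (t / l)) - ((l : ℝ) ^ θ) • f) ≤ ENNReal.ofReal η * X.fnNorm f

variable (hX : X.IsRearrangementInvariant)
include hX

theorem IsRearrangementInvariant.fnNorm_tent_sub_le {θ κ a b c : ℝ} (hθ : 0 ≤ θ) (hκ : 0 ≤ κ)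
    (hb : 0 < b) (ha : 0 < a) (hc : 0 < c) {l : ℕ} (hl : 0 < l) :
    X.fnNorm ((fun t => (Ico a c).indicator (tent θ κ b) (t / l)) -
        ((l : ℝ) ^ θ) • (Ico a c).indicator (tent θ κ b)) ≤
      ENNReal.ofReal ((l : ℝ) ^ θ * ((l : ℝ) ^ κ - 1)) * X.fnNorm ((Ico a c).indicator (tent θ κ b))
      + ENNReal.ofReal ((l : ℝ) ^ θ * ((l : ℝ) ^ θ * (l : ℝ) ^ κ * tent θ κ b a) *
        (l * X.fundamentalFunction a)) +
      ENNReal.ofReal ((l : ℝ) ^ θ * ((l : ℝ) ^ θ * (l : ℝ) ^ κ * tent θ κ b c) *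
        (l * X.fundamentalFunction c)) := by
  set g := (Ico a c).indicator (tent θ κ b) with hg
  have hgm : Measurable g := (measurable_tent θ κ b).indicator measurableSet_Ico
  have hl1 : (1 : ℝ) ≤ l := by exact_mod_cast hl
  have hlk : 1 ≤ (l : ℝ) ^ κ := Real.one_le_rpow hl1 hκ
  have pa := tent_pos (θ := θ) (κ := κ) hb ha
  have pc := tent_pos (θ := θ) (κ := κ) hb hc
  have hterm : ∀ (M s : ℝ), 0 ≤ M → X.fnNorm (M • (Ioo 0 (l * s)).indicator fun _ => (1 : ℝ)) ≤
      ENNReal.ofReal (M * (l * X.fundamentalFunction s)) := by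
    intro M s hM
    refine (fnNorm_smul_le _ _).trans ?_
    rw [← IsRearrangementInvariant.extNorm_charFun, ← hX.ofReal_fundamentalFunction,
      Real.enorm_eq_ofReal hM, ENNReal.ofReal_mul hM]
    gcongr
    exact hX.fundamentalFunction_nat_mul_le hl s
  refine le_trans (hX.fnNorm_mono (g := ((l : ℝ) ^ θ * ((l : ℝ) ^ κ - 1)) • g +
    ((l : ℝ) ^ θ * ((l : ℝ) ^ θ * (l : ℝ) ^ κ * tent θ κ b a)) • (Ioo 0 (l * a)).indicator
      (fun _ => (1 : ℝ)) +
    ((l : ℝ) ^ θ * ((l : ℝ) ^ θ * (l : ℝ) ^ κ * tent θ κ b c)) • (Ioo 0 (l * c)).indicator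
      (fun _ => (1 : ℝ)))
    ((measurable_dilate hgm l).sub (hgm.const_smul _)).aestronglyMeasurable
    (ae_halfLine fun t ht => ?_)) ?_
  · refine le_trans ?_ (le_abs_self _)
    exact abs_indicator_tent_sub_le hθ hκ hb ha hc hl1 ht
  · refine (fnNorm_add_le _ _).trans (add_le_add ((fnNorm_add_le _ _).trans (add_le_add ?_ ?_)) ?_)
    · refine (fnNorm_smul_le _ _).trans (le_of_eq ?_)
      rw [Real.enorm_eq_ofReal (mul_nonneg (by positivity) (by linarith))]
    · exact hterm _ _ (by positivity)
    · exact hterm _ _ (by positivity)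

/-- Keep only [b/2, b): there the weight is at least 1/2, the power at least b^{-θ}, and φ(b/2) ≥
φ(b)/2. -/
theorem IsRearrangementInvariant.le_fnNorm_tent {θ κ a b c : ℝ} (hθ : 0 ≤ θ) (hκ : 0 ≤ κ)
    (hκ1 : κ ≤ 1) (hb : 0 < b) (hab : 2 * a ≤ b) (hbc : b ≤ c) :
    ENNReal.ofReal (b ^ (-θ) * X.fundamentalFunction b / 4) ≤
      X.fnNorm ((Ico a c).indicator (tent θ κ b)) := by
  have h1 : X.fnNorm ((b ^ (-θ) / 2) • (Ico (b / 2) b).indicator fun _ => (1 : ℝ)) ≤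
      X.fnNorm ((Ico a c).indicator (tent θ κ b)) := by
    refine hX.fnNorm_mono ((measurable_const.indicator
      measurableSet_Ico).const_smul _).aestronglyMeasurable (ae_halfLine fun t ht => ?_)
    rw [Pi.smul_apply]
    by_cases h : t ∈ Ico (b / 2) b
    · have h' : t ∈ Ico a c := ⟨by linarith [h.1], h.2.trans_le hbc⟩
      have e1 : b ^ (-θ) ≤ t ^ (-θ) :=
        Real.rpow_le_rpow_of_nonpos ht h.2.le (by linarith)
      have e2 : (1 / 2 : ℝ) ≤ min (t / b) (b / t) := by
        refine le_min ?_ ?_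
        · rw [le_div_iff₀ hb]; linarith [h.1]
        · rw [le_div_iff₀ ht]; linarith [h.2]
      have e3 : (1 / 2 : ℝ) ≤ min (t / b) (b / t) ^ κ := by
        calc (1 / 2 : ℝ) = (1 / 2) ^ (1 : ℝ) := (Real.rpow_one _).symm
          _ ≤ (1 / 2) ^ κ := Real.rpow_le_rpow_of_exponent_ge (by norm_num) (by norm_num) hκ1
          _ ≤ _ := Real.rpow_le_rpow (by norm_num) e2 hκ
      rw [indicator_of_mem h, indicator_of_mem h', smul_eq_mul, mul_one,
        abs_of_pos (by positivity), abs_of_pos (tent_pos hb ht), tent, div_eq_mul_inv,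
        ← one_div]
      gcongr
    · rw [indicator_of_notMem h, smul_zero, abs_zero]
      exact abs_nonneg _
  refine le_trans ?_ h1
  have hb2 : (b ^ (-θ) / 2) ≠ 0 := by positivity
  have hm : halfLine (Ico (b / 2) b) = ENNReal.ofReal (b / 2) := by
    have hsub : Ico (b / 2) b ⊆ Ioi 0 := fun s hs => lt_of_lt_of_le (half_pos hb) hs.1
    rw [halfLine, Measure.restrict_apply' measurableSet_Ioi, inter_eq_left.2 hsub,
      Real.volume_Ico]
    congr 1; ring
  rw [fnNorm_smul hb2, hX.fnNorm_indicator measurableSet_Ico hm,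
    Real.enorm_eq_ofReal (by positivity), ← ENNReal.ofReal_mul (by positivity)]
  refine ENNReal.ofReal_le_ofReal ?_
  have := hX.isDilationRegular.dil 1 (b / 2)
  rw [pow_one, mul_div_cancel₀ _ two_ne_zero] at this
  have hb3 : 0 < b ^ (-θ) := by positivity
  nlinarith

theorem IsRearrangementInvariant.fnNorm_tent_ne_top {θ κ a b c : ℝ} (hθ : 0 ≤ θ) (hκ : 0 ≤ κ)
    (hb : 0 < b) (ha : 0 < a) : X.fnNorm ((Ico a c).indicator (tent θ κ b)) ≠ ∞ := by
  have h1 : X.fnNorm ((Ico a c).indicator (tent θ κ b)) ≤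
      X.fnNorm (a ^ (-θ) • (Ioo 0 c).indicator fun _ => (1 : ℝ)) := by
    refine hX.fnNorm_mono ((measurable_tent θ κ b).indicator
      measurableSet_Ico).aestronglyMeasurable (ae_halfLine fun t ht => ?_)
    rw [Pi.smul_apply]
    by_cases h : t ∈ Ico a c
    · have e1 : t ^ (-θ) ≤ a ^ (-θ) := Real.rpow_le_rpow_of_nonpos ha h.1 (by linarith)
      have e2 : min (t / b) (b / t) ^ κ ≤ 1 := by
        refine Real.rpow_le_one (le_min (by positivity) (by positivity)) ?_ hκ
        rcases le_total t b with h | h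
        · exact (min_le_left _ _).trans ((div_le_one hb).2 h)
        · exact (min_le_right _ _).trans ((div_le_one ht).2 h)
      rw [indicator_of_mem h, indicator_of_mem (show t ∈ Ioo 0 c from ⟨ht, h.2⟩), smul_eq_mul,
        mul_one, abs_of_pos (tent_pos hb ht), abs_of_pos (by positivity), tent]
      calc t ^ (-θ) * min (t / b) (b / t) ^ κ ≤ a ^ (-θ) * 1 := by gcongr
        _ = a ^ (-θ) := mul_one _
    · rw [indicator_of_notMem h, abs_zero]
      exact abs_nonneg _
  refine ne_top_of_le_ne_top (ENNReal.mul_ne_top (a := ‖a ^ (-θ)‖ₑ) enorm_ne_top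
    (hX.extNorm_charFun_ne_top c)) (h1.trans ?_)
  rw [extNorm_charFun]
  exact fnNorm_smul_le _ _

/-- The weight exponent is κ = 2δ: at a and c it overcomes the slack δ in the growth of φ and leaves
a factor R^{-δ}. So δ is fixed first, making the weight error small, and R afterwards, making the
boundary errors small. -/
theorem IsRearrangementInvariant.hasNearEigenfunctions {θ : ℝ} (hθ : 0 ≤ θ) (hθ1 : θ ≤ 1)
    (h1 : lowerDil X.fundamentalFunction ≤ θ) (h2 : θ ≤ upperDil X.fundamentalFunction)
    (h3 : θ ≤ upperDilZero X.fundamentalFunction ∨ lowerDilInf X.fundamentalFunction ≤ θ) :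
    X.HasNearEigenfunctions θ := by
  intro N η hη
  -- K ≥ 1 bounds l, l^θ and l^{2δ} for all admissible l.
  set K : ℝ := N + 1 with hK
  have hK1 : 1 ≤ K := by simp [hK]
  have hK0 : 0 < K := by linarith
  obtain ⟨δ, hδ0, hδ1, hδ⟩ : ∃ δ : ℝ, 0 < δ ∧ 2 * δ ≤ 1 ∧ K * (K ^ (2 * δ) - 1) ≤ η / 2 := by
    have hc : Tendsto (fun δ : ℝ => K * (K ^ (2 * δ) - 1)) (𝓝[>] 0) (𝓝 0) := by
      have : Continuous fun δ : ℝ => K * (K ^ (2 * δ) - 1) :=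
        continuous_const.mul ((continuous_const.rpow (by fun_prop) fun _ =>
          Or.inl hK0.ne').sub continuous_const)
      have h := this.tendsto 0
      simp only [mul_zero, Real.rpow_zero, sub_self] at h
      exact h.mono_left nhdsWithin_le_nhds
    obtain ⟨δ, h1, h2, h3⟩ := ((hc.eventually (ge_mem_nhds (half_pos hη))).and
      (Ioo_mem_nhdsGT (show (0 : ℝ) < 1 / 2 by norm_num))).exists
    exact ⟨δ, h2, by linarith, h1⟩
  -- K^4 bounds the product of two factors l^θ, one l^{2δ} and one l. With the 8, each boundary term
  -- is at most η/4 of the lower bound b^{-θ} φ(b)/4 for the norm.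
  obtain ⟨R, hR2, hR⟩ : ∃ R : ℝ, 2 ≤ R ∧ 8 * K ^ 4 * R ^ (-δ) ≤ η / 2 := by
    have := (tendsto_rpow_neg_atTop hδ0).const_mul (8 * K ^ 4)
    rw [mul_zero] at this
    exact ((eventually_ge_atTop 2).and (this.eventually (ge_mem_nhds (half_pos hη)))).exists
  obtain ⟨a, b, c, ha, hab, hbc, hl, hr⟩ := hX.isDilationRegular.exists_balanced
    (fun t s ht hs => hX.fundamentalFunction_mul_le ht hs) h1 h2 h3 hδ0
    (show 1 ≤ R by linarith)
  set φ := X.fundamentalFunction with hφ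
  have hb : 0 < b := lt_of_lt_of_le (by positivity) hab
  have hc : 0 < c := lt_of_lt_of_le (by positivity) hbc
  have hab2 : 2 * a ≤ b := le_trans (by gcongr) hab
  have hbc2 : b ≤ c := le_trans (by nlinarith) hbc
  have pa := hX.fundamentalFunction_pos ha
  have pb := hX.fundamentalFunction_pos hb
  have pc := hX.fundamentalFunction_pos hc
  rw [← hφ] at pa pb pc
  have hRa : R ≤ b / a := (le_div_iff₀ ha).2 hab
  have hRc : R ≤ c / b := (le_div_iff₀ hb).2 hbc
  have hexp : ∀ {u : ℝ}, R ≤ u → u ^ (-δ) ≤ R ^ (-δ) := fun h =>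
    Real.rpow_le_rpow_of_nonpos (by linarith) h (by linarith)
  have ga : tent θ (2 * δ) b a * φ a ≤ b ^ (-θ) * φ b * R ^ (-δ) := by
    have w : min (a / b) (b / a) = (b / a)⁻¹ := by
      rw [inv_div, min_eq_left]
      have : 1 ≤ b / a := by linarith
      exact ((div_le_one hb).2 (by linarith)).trans this
    rw [le_div_iff₀ pa] at hl
    have e1 : a ^ (-θ) = b ^ (-θ) * (b / a) ^ θ := by
      rw [Real.div_rpow hb.le ha.le, Real.rpow_neg ha.le, Real.rpow_neg hb.le]
      field_simp
    have hu : 0 < b / a := by positivity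
    rw [tent, w, Real.inv_rpow hu.le, ← Real.rpow_neg hu.le, e1]
    calc b ^ (-θ) * (b / a) ^ θ * (b / a) ^ (-(2 * δ)) * φ a
        = b ^ (-θ) * (b / a) ^ (-δ) * ((b / a) ^ (θ - δ) * φ a) := by
          have : (b / a) ^ θ * (b / a) ^ (-(2 * δ)) = (b / a) ^ (-δ) * (b / a) ^ (θ - δ) := by
            rw [← Real.rpow_add hu, ← Real.rpow_add hu]; congr 1; ring
          linear_combination (b ^ (-θ) * φ a) * this
      _ ≤ b ^ (-θ) * R ^ (-δ) * φ b := by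
          have := hexp hRa
          have := mul_le_mul_of_nonneg_left this (show 0 ≤ b ^ (-θ) by positivity)
          exact mul_le_mul this hl (by positivity) (by positivity)
      _ = _ := by ring
  have gc : tent θ (2 * δ) b c * φ c ≤ b ^ (-θ) * φ b * R ^ (-δ) := by
    have hu : 0 < c / b := by positivity
    have w : min (c / b) (b / c) = (c / b)⁻¹ := by
      rw [inv_div, min_eq_right]
      have : 1 ≤ c / b := by linarith
      exact ((div_le_one hc).2 hbc2).trans this
    rw [div_le_iff₀ pb] at hr
    have e1 : c ^ (-θ) = b ^ (-θ) * (c / b) ^ (-θ) := by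
      rw [← Real.mul_rpow hb.le hu.le, mul_div_cancel₀ _ hb.ne']
    rw [tent, w, Real.inv_rpow hu.le, ← Real.rpow_neg hu.le, e1]
    calc b ^ (-θ) * (c / b) ^ (-θ) * (c / b) ^ (-(2 * δ)) * φ c
        ≤ b ^ (-θ) * (c / b) ^ (-θ) * (c / b) ^ (-(2 * δ)) * ((c / b) ^ (θ + δ) * φ b) := by
          gcongr
      _ = b ^ (-θ) * (c / b) ^ (-δ) * φ b := by
          have : (c / b) ^ (-θ) * (c / b) ^ (-(2 * δ)) * (c / b) ^ (θ + δ) = (c / b) ^ (-δ) := by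
            rw [← Real.rpow_add hu, ← Real.rpow_add hu]; congr 1; ring
          linear_combination (b ^ (-θ) * φ b) * this
      _ ≤ b ^ (-θ) * R ^ (-δ) * φ b := by
          have := hexp hRc
          have := mul_le_mul_of_nonneg_left this (show 0 ≤ b ^ (-θ) by positivity)
          exact mul_le_mul_of_nonneg_right this pb.le
      _ = _ := by ring
  have hlow := hX.le_fnNorm_tent (a := a) (c := c) hθ (κ := 2 * δ) (by positivity) hδ1 hb hab2 hbc2
  refine ⟨(Ico a c).indicator (tent θ (2 * δ) b),
    (measurable_tent _ _ _).indicator measurableSet_Ico,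
    (lt_of_lt_of_le (ENNReal.ofReal_pos.2 (by positivity)) hlow).ne',
    hX.fnNorm_tent_ne_top hθ (by positivity) hb ha, fun l hl0 hlN => ?_⟩
  set F := X.fnNorm ((Ico a c).indicator (tent θ (2 * δ) b))
  have hl1 : (1 : ℝ) ≤ l := by exact_mod_cast hl0
  have hlK : (l : ℝ) ≤ K := by
    have : (l : ℝ) ≤ N := by exact_mod_cast hlN
    linarith
  have hlθ : (l : ℝ) ^ θ ≤ K := by
    calc (l : ℝ) ^ θ ≤ (l : ℝ) ^ (1 : ℝ) := Real.rpow_le_rpow_of_exponent_le hl1 hθ1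
      _ = l := Real.rpow_one _
      _ ≤ K := hlK
  have hlκ : (l : ℝ) ^ (2 * δ) ≤ K := by
    calc (l : ℝ) ^ (2 * δ) ≤ (l : ℝ) ^ (1 : ℝ) := Real.rpow_le_rpow_of_exponent_le hl1 hδ1
      _ = l := Real.rpow_one _
      _ ≤ K := hlK
  have hlκ' : (l : ℝ) ^ (2 * δ) ≤ K ^ (2 * δ) := by gcongr
  have hl1κ : 1 ≤ (l : ℝ) ^ (2 * δ) := Real.one_le_rpow hl1 (by positivity)
  have hend : ∀ s : ℝ, 0 < s → tent θ (2 * δ) b s * φ s ≤ b ^ (-θ) * φ b * R ^ (-δ) →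
      ENNReal.ofReal ((l : ℝ) ^ θ * ((l : ℝ) ^ θ * (l : ℝ) ^ (2 * δ) * tent θ (2 * δ) b s) *
        (l * φ s)) ≤ ENNReal.ofReal (η / 4) * F := by
    intro s hs hg
    have ps := tent_pos (θ := θ) (κ := 2 * δ) hb hs
    have pf := hX.fundamentalFunction_pos hs
    rw [← hφ] at pf
    refine le_trans ?_ (mul_le_mul_right hlow _)
    rw [← ENNReal.ofReal_mul (by positivity)]
    refine ENNReal.ofReal_le_ofReal ?_
    calc (l : ℝ) ^ θ * ((l : ℝ) ^ θ * (l : ℝ) ^ (2 * δ) * tent θ (2 * δ) b s) * (l * φ s)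
        ≤ K * (K * K * tent θ (2 * δ) b s) * (K * φ s) := by gcongr
      _ = K ^ 4 * (tent θ (2 * δ) b s * φ s) := by ring
      _ ≤ K ^ 4 * (b ^ (-θ) * φ b * R ^ (-δ)) := by gcongr
      _ = (8 * K ^ 4 * R ^ (-δ)) * (b ^ (-θ) * φ b / 8) := by ring
      _ ≤ (η / 2) * (b ^ (-θ) * φ b / 8) := by gcongr
      _ = η / 4 * (b ^ (-θ) * φ b / 4) := by ring
  refine (hX.fnNorm_tent_sub_le hθ (by positivity) hb ha hc hl0).trans ?_
  have hfirst : (l : ℝ) ^ θ * ((l : ℝ) ^ (2 * δ) - 1) ≤ η / 2 :=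
    le_trans (mul_le_mul hlθ (by linarith) (by linarith) hK0.le) hδ
  calc _ ≤ ENNReal.ofReal (η / 2) * F + ENNReal.ofReal (η / 4) * F + ENNReal.ofReal (η / 4) * F :=
        add_le_add (add_le_add (by gcongr) (hend a ha ga)) (hend c hc gc)
    _ = ENNReal.ofReal η * F := by
        rw [← add_mul, ← add_mul, ← ENNReal.ofReal_add (by positivity) (by positivity),
          ← ENNReal.ofReal_add (by positivity) (by positivity)]
        congr 2
        ring

end FunctionSpace

/-! ### Symmetric copies from approximate eigenfunctions -/

theorem expRecip_nonneg (p : ℝ≥0∞) : 0 ≤ expRecip p := ENNReal.toReal_nonneg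

theorem expRecip_le_one {p : ℝ≥0∞} (hp : 1 ≤ p) : expRecip p ≤ 1 :=
  ENNReal.toReal_le_of_le_ofReal zero_le_one (by simpa using hp)

theorem sum_smul_copy_apply {n : ℕ} (hn : 0 < n) (a : Fin n → ℝ) (f : ℝ → ℝ) (t : ℝ) :
    (∑ k : Fin n, a k • copy n (k : ℕ) f) t =
      a ⟨cell t % n, Nat.mod_lt _ hn⟩ * copy n (cell t % n) f t := by
  rw [Finset.sum_apply, Finset.sum_eq_single (⟨cell t % n, Nat.mod_lt _ hn⟩ : Fin n)]
  · rfl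
  · intro k _ hk
    have : cell t % n ≠ (k : ℕ) := fun h => hk (Fin.ext h.symm)
    simp [copy, this]
  · simp

theorem measurable_sum_smul_copy {n : ℕ} (a : Fin n → ℝ) {f : ℝ → ℝ} (hf : Measurable f) :
    Measurable (∑ k : Fin n, a k • copy n (k : ℕ) f) := by
  have h := Finset.measurable_sum Finset.univ fun (k : Fin n) _ =>
    (measurable_copy n k hf).const_smul (a k)
  convert h using 1
  funext t
  exact Finset.sum_apply _ _ _

namespace FunctionSpace

variable {X : FunctionSpace}

theorem fnNorm_le_add_sub (f g : ℝ → ℝ) : X.fnNorm f ≤ X.fnNorm g + X.fnNorm (f - g) := by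
  have := fnNorm_add_le (X := X) g (f - g)
  rwa [add_sub_cancel] at this

theorem fnNorm_le_add_sub' (f g : ℝ → ℝ) : X.fnNorm g ≤ X.fnNorm f + X.fnNorm (f - g) := by
  have h := fnNorm_le_add_sub (X := X) g f
  have h2 := fnNorm_smul (X := X) (c := -1) (by norm_num) (f - g)
  rw [neg_one_smul, neg_sub, enorm_neg, enorm_one, one_mul] at h2
  rwa [h2] at h

variable (hX : X.IsRearrangementInvariant)
include hX

theorem IsRearrangementInvariant.fnNorm_sum_smul_copy_mono {n : ℕ} (hn : 0 < n) {a b : Fin n → ℝ}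
    (h : ∀ k, |a k| ≤ |b k|) {f : ℝ → ℝ} (hf : Measurable f) :
    X.fnNorm (∑ k : Fin n, a k • copy n k f) ≤ X.fnNorm (∑ k : Fin n, b k • copy n k f) := by
  refine hX.fnNorm_mono (measurable_sum_smul_copy a hf).aestronglyMeasurable
    (Eventually.of_forall fun t => ?_)
  rw [sum_smul_copy_apply hn, sum_smul_copy_apply hn, abs_mul, abs_mul]
  exact mul_le_mul_of_nonneg_right (h _) (abs_nonneg _)

omit hX in
theorem HasNearEigenfunctions.exists_normalized {θ : ℝ} (h : X.HasNearEigenfunctions θ) (N : ℕ)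
    {η : ℝ} (hη : 0 < η) : ∃ f : ℝ → ℝ, Measurable f ∧ X.fnNorm f = 1 ∧
      ∀ l : ℕ, 0 < l → l ≤ N →
        X.fnNorm ((fun t => f (t / l)) - ((l : ℝ) ^ θ) • f) ≤ ENNReal.ofReal η := by
  obtain ⟨f, hf, h0, ht, hl⟩ := h N η hη
  have hc : 0 < (X.fnNorm f).toReal := ENNReal.toReal_pos h0 ht
  set c := (X.fnNorm f).toReal⁻¹
  have hc0 : c ≠ 0 := inv_ne_zero hc.ne'
  have he : ‖c‖ₑ * X.fnNorm f = 1 := by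
    rw [Real.enorm_eq_ofReal (inv_nonneg.2 hc.le), ENNReal.ofReal_inv_of_pos hc,
      ENNReal.ofReal_toReal ht, ENNReal.inv_mul_cancel h0 ht]
  refine ⟨c • f, hf.const_smul c, by rw [fnNorm_smul hc0, he], fun l hl0 hlN => ?_⟩
  have e : (fun t => (c • f) (t / l)) - ((l : ℝ) ^ θ) • c • f =
      c • ((fun t => f (t / l)) - ((l : ℝ) ^ θ) • f) := by
    funext t
    simp only [Pi.sub_apply, Pi.smul_apply, smul_eq_mul]
    ring
  rw [e, fnNorm_smul hc0]
  calc _ ≤ ‖c‖ₑ * (ENNReal.ofReal η * X.fnNorm f) := mul_le_mul_right (hl l hl0 hlN) _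
    _ = ENNReal.ofReal η := by rw [mul_left_comm, he, mul_one]

omit hX in
theorem enorm_sum_smul_eq {n : ℕ} {f : ℝ → ℝ} (hf : Measurable f) {x : Fin n → X.Elem}
    (hx : ∀ k, (x k).toMeas = AEEqFun.mk (copy n k f) (measurable_copy n k hf).aestronglyMeasurable)
    (a : Fin n → ℝ) : ‖∑ k, a k • x k‖ₑ = X.fnNorm (∑ k : Fin n, a k • copy n k f) := by
  rw [← extNorm_toMeas, ← fnNorm_coe, toMeas_sum]
  refine fnNorm_congr ?_
  have h : ∀ᵐ t ∂halfLine, ∀ k, (a k • (x k).toMeas) t = a k • copy n k f t := by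
    refine ae_all_iff.2 fun k => ?_
    rw [hx k]
    filter_upwards [AEEqFun.coeFn_smul (a k) (AEEqFun.mk (copy n k f)
      (measurable_copy n k hf).aestronglyMeasurable), AEEqFun.coeFn_mk (copy n k f)
      (measurable_copy n k hf).aestronglyMeasurable] with t h1 h2
    rw [h1, Pi.smul_apply, h2]
  filter_upwards [h, coeFn_sum Finset.univ fun k => (a k • x k).toMeas] with t h1 h2
  rw [h2, Finset.sum_apply, Finset.sum_apply]
  exact Finset.sum_congr rfl fun k _ => h1 k

/-- By homogeneity it suffices to test coefficient vectors of ℓ^p norm 1 on the copies of a single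
function. -/
theorem IsRearrangementInvariant.exists_isSymmetricCopy {p : ℝ≥0∞} (hp : 1 ≤ p) {n : ℕ} {C : ℝ}
    {f : ℝ → ℝ} (hf : Measurable f) (hf1 : X.fnNorm f ≠ ∞)
    (h : ∀ a : Fin n → ℝ, ‖(WithLp.toLp p a : PiLp p fun _ : Fin n => ℝ)‖ = 1 →
      ENNReal.ofReal C⁻¹ ≤ X.fnNorm (∑ k : Fin n, a k • copy n k f) ∧
      X.fnNorm (∑ k : Fin n, a k • copy n k f) ≤ ENNReal.ofReal C) (hC : 0 < C) :
    ∃ x : Fin n → X.Elem, X.IsSymmetricCopy p C x := by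
  have hm : ∀ k : Fin n, AEStronglyMeasurable (copy n k f) halfLine := fun k =>
    (measurable_copy n k hf).aestronglyMeasurable
  have hex : ∀ k : Fin n, ∃ x : X.Elem, x.toMeas = AEEqFun.mk (copy n k f) (hm k) := fun k =>
    exists_of_extNorm_ne_top (by rwa [← fnNorm_eq, hX.fnNorm_copy k.2 hf])
  choose x hx using hex
  refine ⟨x, fun i j τ hτ => ?_, fun i j hij => ?_, fun a => ?_⟩
  · rw [hx, hx, distribution_mk, distribution_mk, fnDist_copy i.2 hf hτ, fnDist_copy j.2 hf hτ]
  · rw [DisjointSupport, hx, hx]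
    filter_upwards [AEEqFun.coeFn_mk _ (hm i), AEEqFun.coeFn_mk _ (hm j)] with t h1 h2
    rw [h1, h2]
    exact copy_eq_zero_or (fun h => hij (Fin.ext h)) f f t
  · have : Fact (1 ≤ p) := ⟨hp⟩
    set A := ‖(WithLp.toLp p a : PiLp p fun _ : Fin n => ℝ)‖ with hA
    rcases eq_or_ne A 0 with h0 | h0
    · have ha : a = 0 := by
        have := norm_eq_zero.1 (hA ▸ h0)
        simpa using this
      rw [h0, ha]
      simp
    · have hA0 : 0 < A := lt_of_le_of_ne (norm_nonneg _) h0.symm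
      have hn : ‖(WithLp.toLp p (A⁻¹ • a) : PiLp p fun _ : Fin n => ℝ)‖ = 1 := by
        rw [WithLp.toLp_smul, norm_smul, ← hA, Real.norm_of_nonneg (inv_nonneg.2 hA0.le),
          inv_mul_cancel₀ h0]
      have hk := h _ hn
      rw [← enorm_sum_smul_eq hf hx, ← ofReal_norm, ENNReal.ofReal_le_ofReal_iff (norm_nonneg _),
        ENNReal.ofReal_le_ofReal_iff hC.le] at hk
      have e : ∑ k, (A⁻¹ • a) k • x k = A⁻¹ • ∑ k, a k • x k := by
        rw [Finset.smul_sum]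
        exact Finset.sum_congr rfl fun k _ => by rw [Pi.smul_apply, smul_assoc]
      rw [e, norm_smul, Real.norm_of_nonneg (inv_nonneg.2 hA0.le), le_inv_mul_iff₀ hA0,
        inv_mul_le_iff₀ hA0] at hk
      exact ⟨by linarith [hk.1], by linarith [hk.2]⟩

/-- Round u_k to integers j_k. Then u_k^θ f ≈ j_k^θ f ≈ σ_{j_k} f, the copies of the latter add up
to an equimeasurable image of σ_J f, and σ_J f ≈ J^θ f ≈ M^θ f. The error is 2n from the n copies, 1
from σ_J and at most n from J^θ - M^θ, independently of M. -/
theorem IsRearrangementInvariant.fnNorm_sum_rpow_copy {θ : ℝ} (h0 : 0 ≤ θ) (h1 : θ ≤ 1) {n M : ℕ}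
    (hn : 0 < n) {f : ℝ → ℝ} (hf : Measurable f) (hf1 : X.fnNorm f = 1)
    (hl : ∀ l : ℕ, 0 < l → l ≤ M + n → X.fnNorm ((fun t => f (t / l)) - ((l : ℝ) ^ θ) • f) ≤ 1)
    {u : Fin n → ℝ} (hu : ∀ k, 0 ≤ u k) (hM : ∑ k, u k = M) :
    X.fnNorm (∑ k : Fin n, (u k ^ θ) • copy n k f) ≤ ENNReal.ofReal (M ^ θ + (3 * n + 1)) ∧
    ENNReal.ofReal (M ^ θ) ≤
      X.fnNorm (∑ k : Fin n, (u k ^ θ) • copy n k f) + ENNReal.ofReal (3 * n + 1) := by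
  -- Adding 1 to the floor keeps every dilation factor positive, also when u k = 0, and still gives
  -- j k ≤ u k + 1.
  set j : Fin n → ℕ := fun k => ⌊u k⌋₊ + 1 with hj
  have hj0 : ∀ k, 0 < j k := fun k => Nat.succ_pos _
  have hju : ∀ k, u k ≤ j k := fun k => by
    simp only [hj]; push_cast; exact (Nat.lt_floor_add_one (u k)).le
  have hju' : ∀ k, (j k : ℝ) ≤ u k + 1 := fun k => by
    simp only [hj]; push_cast; linarith [Nat.floor_le (hu k)]
  set J := ∑ k, j k with hJ
  have hMJ : (M : ℝ) ≤ J := by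
    rw [hJ, ← hM, Nat.cast_sum]
    exact Finset.sum_le_sum fun k _ => hju k
  have hJM : (J : ℝ) ≤ M + n := by
    rw [hJ, ← hM, Nat.cast_sum]
    refine (Finset.sum_le_sum fun k _ => hju' k).trans (le_of_eq ?_)
    simp [Finset.sum_add_distrib]
  have hJM' : J ≤ M + n := by exact_mod_cast hJM
  have hjJ : ∀ k, j k ≤ M + n := fun k =>
    (Finset.single_le_sum (fun i _ => Nat.zero_le (j i)) (Finset.mem_univ k)).trans hJM'
  have hJ0 : 0 < J := (hj0 ⟨0, hn⟩).trans_le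
    (Finset.single_le_sum (fun i _ => Nat.zero_le (j i)) (Finset.mem_univ _))
  set T := ∑ k : Fin n, (u k ^ θ) • copy n k f with hT
  set Y := ∑ k : Fin n, copy n k fun t => f (t / j k) with hY
  have hYnorm : X.fnNorm Y = X.fnNorm fun t => f (t / J) :=
    hX.fnNorm_sum_copy_dilate hf j hj0 hn
  have hYT : X.fnNorm (Y - T) ≤ ENNReal.ofReal (2 * n) := by
    have e : Y - T = ∑ k : Fin n, copy n k
        (((fun t => f (t / j k)) - ((j k : ℝ) ^ θ) • f) + ((j k : ℝ) ^ θ - u k ^ θ) • f) := by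
      rw [hY, hT, ← Finset.sum_sub_distrib]
      refine Finset.sum_congr rfl fun k _ => ?_
      rw [← copy_smul, ← copy_sub]
      congr 1
      funext t
      simp only [Pi.sub_apply, Pi.add_apply, Pi.smul_apply, smul_eq_mul]
      ring
    rw [e]
    refine (fnNorm_sum_le _ _).trans ((Finset.sum_le_sum (g := fun _ => 2) fun k _ => ?_).trans ?_)
    · rw [hX.fnNorm_copy k.2 (((measurable_dilate hf _).sub (hf.const_smul _)).add
        (hf.const_smul _))]
      refine (fnNorm_add_le _ _).trans ?_
      rw [← one_add_one_eq_two]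
      refine add_le_add (hl _ (hj0 k) (hjJ k)) ((fnNorm_smul_le _ _).trans ?_)
      have e1 : u k ^ θ ≤ (j k : ℝ) ^ θ := Real.rpow_le_rpow (hu k) (hju k) h0
      have e2 : (j k : ℝ) ^ θ ≤ u k ^ θ + 1 := by
        calc (j k : ℝ) ^ θ ≤ (u k + 1) ^ θ := Real.rpow_le_rpow (by positivity) (hju' k) h0
          _ ≤ u k ^ θ + 1 ^ θ := Real.rpow_add_le_add_rpow (hu k) zero_le_one h0 h1
          _ = u k ^ θ + 1 := by rw [Real.one_rpow]
      rw [hf1, mul_one, Real.enorm_eq_ofReal (by linarith), ← ENNReal.ofReal_one]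
      exact ENNReal.ofReal_le_ofReal (by linarith)
    · rw [Finset.sum_const, Finset.card_univ, Fintype.card_fin, nsmul_eq_mul,
        ENNReal.ofReal_mul two_pos.le, ENNReal.ofReal_natCast, ENNReal.ofReal_ofNat, mul_comm]
  have hJf : X.fnNorm (((J : ℝ) ^ θ) • f) = ENNReal.ofReal (J ^ θ) := by
    rw [fnNorm_smul (by positivity), hf1, mul_one, Real.enorm_eq_ofReal (by positivity)]
  have hlJ := hl J hJ0 hJM'
  have hMJθ : (M : ℝ) ^ θ ≤ (J : ℝ) ^ θ := by gcongr
  have hn1 : (1 : ℝ) ≤ n := by exact_mod_cast hn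
  have hJMθ : (J : ℝ) ^ θ ≤ (M : ℝ) ^ θ + n := by
    calc (J : ℝ) ^ θ ≤ ((M : ℝ) + n) ^ θ := by gcongr
      _ ≤ (M : ℝ) ^ θ + (n : ℝ) ^ θ := Real.rpow_add_le_add_rpow (by positivity) (by positivity) h0 h1
      _ ≤ (M : ℝ) ^ θ + (n : ℝ) ^ (1 : ℝ) := by gcongr
      _ = (M : ℝ) ^ θ + n := by rw [Real.rpow_one]
  constructor
  · calc X.fnNorm T ≤ X.fnNorm Y + X.fnNorm (Y - T) := fnNorm_le_add_sub' _ _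
      _ ≤ (ENNReal.ofReal (J ^ θ) + 1) + ENNReal.ofReal (2 * n) := by
          refine add_le_add ?_ hYT
          rw [hYnorm, ← hJf]
          exact (fnNorm_le_add_sub _ _).trans (add_le_add le_rfl hlJ)
      _ = ENNReal.ofReal (J ^ θ + 1 + 2 * n) := by
          rw [ENNReal.ofReal_add (by positivity) (by positivity),
            ENNReal.ofReal_add (by positivity) zero_le_one, ENNReal.ofReal_one]
      _ ≤ _ := ENNReal.ofReal_le_ofReal (by linarith)
  · calc ENNReal.ofReal (M ^ θ) ≤ X.fnNorm (((J : ℝ) ^ θ) • f) := by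
          rw [hJf]; exact ENNReal.ofReal_le_ofReal hMJθ
      _ ≤ X.fnNorm Y + 1 := by
          rw [hYnorm]
          exact (fnNorm_le_add_sub' _ _).trans (add_le_add le_rfl hlJ)
      _ ≤ X.fnNorm T + ENNReal.ofReal (2 * n) + 1 := by
          gcongr
          exact (fnNorm_le_add_sub _ _).trans (add_le_add le_rfl hYT)
      _ = X.fnNorm T + ENNReal.ofReal (2 * n + 1) := by
          rw [ENNReal.ofReal_add (by positivity) zero_le_one, ENNReal.ofReal_one, add_assoc]
      _ ≤ _ := by gcongr; linarith

/-- For θ = 0 lattice monotonicity suffices: a combination with maximal coefficient 1 dominates one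
copy of f and is dominated by the sum of all n copies, which is equimeasurable with σ_n f ≈ f. -/
theorem IsRearrangementInvariant.top_mem_symRep (h : X.HasNearEigenfunctions 0) :
    ∞ ∈ X.symRep := by
  refine ⟨le_top, fun n ε hε => ?_⟩
  obtain ⟨f, hf, hf1, hl⟩ := h.exists_normalized n hε
  refine hX.exists_isSymmetricCopy le_top hf (by rw [hf1]; simp) (fun a ha => ?_) (by linarith)
  have hn : 0 < n := by
    rcases Nat.eq_zero_or_pos n with rfl | hn
    · rw [PiLp.norm_eq_ciSup] at ha
      simp at ha
    · exact hn
  have : Nonempty (Fin n) := ⟨⟨0, hn⟩⟩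
  rw [PiLp.norm_eq_ciSup] at ha
  have hle : ∀ k, |a k| ≤ 1 := fun k => ha ▸ le_ciSup (f := fun k => |a k|)
    (Set.finite_range _).bddAbove k
  obtain ⟨k₀, hk₀⟩ : ∃ k, |a k| = 1 := by
    obtain ⟨k, hk⟩ := exists_eq_ciSup_of_finite (f := fun k => |a k|)
    exact ⟨k, hk.trans ha⟩
  constructor
  · have e : X.fnNorm (∑ k : Fin n, (if k = k₀ then (1 : ℝ) else 0) • copy n k f) = 1 := by
      simp only [ite_smul, one_smul, zero_smul, Finset.sum_ite_eq', Finset.mem_univ, if_true]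
      rw [hX.fnNorm_copy k₀.2 hf, hf1]
    refine le_trans ?_ (hX.fnNorm_sum_smul_copy_mono
      (a := fun k => if k = k₀ then (1 : ℝ) else 0) hn (fun k => ?_) hf)
    · rw [e, ← ENNReal.ofReal_one]
      exact ENNReal.ofReal_le_ofReal (inv_le_one_of_one_le₀ (by linarith))
    · split_ifs with hk
      · rw [hk, hk₀, abs_one]
      · rw [abs_zero]; exact abs_nonneg _
  · refine (hX.fnNorm_sum_smul_copy_mono (b := fun _ => 1) hn
      (fun k => by rw [abs_one]; exact hle k) hf).trans ?_
    have e := hX.fnNorm_sum_copy_dilate (n := n) hf (fun _ => 1) (fun _ => one_pos) hn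
    simp only [Nat.cast_one, div_one, Finset.sum_const, Finset.card_univ, Fintype.card_fin,
      smul_eq_mul, mul_one] at e
    simp only [one_smul]
    rw [e]
    refine (fnNorm_le_add_sub _ f).trans ?_
    have := hl n hn le_rfl
    rw [Real.rpow_zero, one_smul] at this
    rw [hf1, ENNReal.ofReal_add zero_le_one hε.le, ENNReal.ofReal_one]
    gcongr

/-- For ‖a‖_p = 1 the numbers u_k = M |a_k|^p sum to M, and u_k^θ = M^θ |a_k|. After division by M^θ
the additive error 3n + 1 becomes negligible for large M, since θ > 0 when p < ∞. -/
theorem IsRearrangementInvariant.mem_symRep {p : ℝ≥0∞} (hp : 1 ≤ p)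
    (h : X.HasNearEigenfunctions (expRecip p)) : p ∈ X.symRep := by
  rcases eq_or_ne p ∞ with rfl | hp'
  · rw [expRecip, ENNReal.inv_top, ENNReal.toReal_zero] at h
    exact hX.top_mem_symRep h
  refine ⟨hp, fun n ε hε => ?_⟩
  have hq : 0 < p.toReal := ENNReal.toReal_pos (by positivity) hp'
  set θ := expRecip p with hθ
  have hθq : θ = p.toReal⁻¹ := by rw [hθ, expRecip, ENNReal.toReal_inv]
  have hθ0 : 0 < θ := by rw [hθq]; positivity
  have hθ1 : θ ≤ 1 := expRecip_le_one hp
  -- Chosen so that 1 - δ = (1 + ε)⁻¹ and δ ≤ ε: a relative error δ serves both bounds.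
  set δ := ε / (1 + ε) with hδ
  have hδ0 : 0 < δ := by positivity
  obtain ⟨M, hM, hM0⟩ : ∃ M : ℕ, (3 * n + 1) / δ ≤ (M : ℝ) ^ θ ∧ 0 < M :=
    ((((tendsto_rpow_atTop hθ0).comp tendsto_natCast_atTop_atTop).eventually_ge_atTop
      ((3 * n + 1) / δ)).and (eventually_gt_atTop 0)).exists
  obtain ⟨f, hf, hf1, hl⟩ := h.exists_normalized (M + n) one_pos
  rw [ENNReal.ofReal_one] at hl
  refine hX.exists_isSymmetricCopy hp hf (by rw [hf1]; simp) (fun a ha => ?_) (by linarith)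
  have hsum : ∑ k, |a k| ^ p.toReal = 1 := by
    rw [PiLp.norm_eq_sum hq] at ha
    have h2 := congrArg (fun r : ℝ => r ^ p.toReal) ha
    simp only [Real.one_rpow] at h2
    rw [← Real.rpow_mul (Finset.sum_nonneg fun _ _ => by positivity), one_div,
      inv_mul_cancel₀ hq.ne', Real.rpow_one] at h2
    exact h2
  have hn : 0 < n := by
    rcases Nat.eq_zero_or_pos n with rfl | hn
    · simp at hsum
    · exact hn
  have hM0' : (0 : ℝ) < M := by exact_mod_cast hM0
  have key := hX.fnNorm_sum_rpow_copy hθ0.le hθ1 hn hf hf1 hl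
    (u := fun k => M * |a k| ^ p.toReal) (fun k => by positivity)
    (by rw [← Finset.mul_sum, hsum, mul_one])
  have e : ∑ k : Fin n, ((M * |a k| ^ p.toReal) ^ θ) • copy n k f =
      ((M : ℝ) ^ θ) • ∑ k : Fin n, |a k| • copy n k f := by
    rw [Finset.smul_sum]
    refine Finset.sum_congr rfl fun k _ => ?_
    rw [smul_smul, Real.mul_rpow hM0'.le (by positivity), ← Real.rpow_mul (abs_nonneg _), hθq,
      mul_inv_cancel₀ hq.ne', Real.rpow_one]
  have e2 : X.fnNorm (∑ k : Fin n, |a k| • copy n k f) =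
      X.fnNorm (∑ k : Fin n, a k • copy n k f) :=
    le_antisymm (hX.fnNorm_sum_smul_copy_mono hn (fun k => (abs_abs _).le) hf)
      (hX.fnNorm_sum_smul_copy_mono hn (fun k => (abs_abs _).ge) hf)
  have hMθ : 0 < (M : ℝ) ^ θ := by positivity
  rw [e, fnNorm_smul hMθ.ne', e2, Real.enorm_eq_ofReal hMθ.le] at key
  set F := X.fnNorm (∑ k : Fin n, a k • copy n k f)
  have hMt : ENNReal.ofReal ((M : ℝ) ^ θ) ≠ ∞ := ENNReal.ofReal_ne_top
  have hMz : ENNReal.ofReal ((M : ℝ) ^ θ) ≠ 0 := (ENNReal.ofReal_pos.2 hMθ).ne'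
  have hM' : (3 * n + 1 : ℝ) ≤ (M : ℝ) ^ θ * δ := (div_le_iff₀ hδ0).1 hM
  have hδε : δ ≤ ε := div_le_self hε.le (by linarith)
  have hδ1 : (1 + ε)⁻¹ + δ = 1 := by rw [hδ]; field_simp
  constructor
  · refine (ENNReal.mul_le_mul_iff_right hMz hMt).1 ?_
    refine (ENNReal.add_le_add_iff_right
      (ENNReal.ofReal_ne_top (r := 3 * n + 1))).1 (le_trans ?_ key.2)
    rw [← ENNReal.ofReal_mul hMθ.le, ← ENNReal.ofReal_add (by positivity) (by positivity)]
    refine ENNReal.ofReal_le_ofReal ?_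
    nlinarith
  · refine (ENNReal.mul_le_mul_iff_right hMz hMt).1 (key.1.trans ?_)
    rw [← ENNReal.ofReal_mul hMθ.le]
    refine ENNReal.ofReal_le_ofReal ?_
    nlinarith

omit hX in
theorem symRep_subset_crudeSymRep : X.symRep ⊆ X.crudeSymRep := fun _ hp =>
  ⟨hp.1, 1 + 1, by norm_num, fun n => hp.2 n 1 one_pos⟩

end FunctionSpace

/-! ### Exponents and their reciprocals -/

theorem recip_le_iff {p : ℝ≥0∞} (hp : 1 ≤ p) {r : ℝ} (hr : 0 ≤ r) :
    recip r ≤ p ↔ expRecip p ≤ r := by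
  have hpt : p⁻¹ ≠ ∞ := ENNReal.inv_ne_top.2 (by positivity)
  rw [recip, ENNReal.inv_le_iff_inv_le, ENNReal.le_ofReal_iff_toReal_le hpt hr, expRecip]

/-- No sign condition on r: for negative r both sides hold, as `recip r` is then ∞. -/
theorem le_recip_iff {p : ℝ≥0∞} (hp : 1 ≤ p) (r : ℝ) : p ≤ recip r ↔ r ≤ expRecip p := by
  have hpt : p⁻¹ ≠ ∞ := ENNReal.inv_ne_top.2 (by positivity)
  rw [recip, ENNReal.le_inv_iff_le_inv, ENNReal.ofReal_le_iff_le_toReal hpt, expRecip]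

theorem one_le_recip {r : ℝ} (hr : r ≤ 1) : 1 ≤ recip r :=
  ENNReal.one_le_inv.2 (ENNReal.ofReal_le_one.2 hr)

theorem mem_Icc_recip {p : ℝ≥0∞} {r s : ℝ} (hr : 0 ≤ r) (hr1 : r ≤ 1) :
    p ∈ Icc (recip r) (recip s) ↔ 1 ≤ p ∧ s ≤ expRecip p ∧ expRecip p ≤ r := by
  constructor
  · rintro ⟨h1, h2⟩
    have hp : 1 ≤ p := (one_le_recip hr1).trans h1
    exact ⟨hp, (le_recip_iff hp s).1 h2, (recip_le_iff hp hr).1 h1⟩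
  · rintro ⟨hp, h1, h2⟩
    exact ⟨(recip_le_iff hp hr).2 h2, (le_recip_iff hp s).2 h1⟩

/-! ### Characterisation of the exponents by the indices -/

namespace FunctionSpace.IsRearrangementInvariant

variable {X : FunctionSpace} (hX : X.IsRearrangementInvariant)
include hX

theorem upperBoydZero_nonneg : 0 ≤ X.upperBoydZero :=
  hX.isSubmulSeq_dilNormZero.le_expRate one_pos (Eventually.of_forall fun n => by
    simpa using hX.one_le_dilNormZero n)

theorem upperBoyd_le_one : X.upperBoyd ≤ 1 :=
  hX.isSubmulSeq_dilNorm.expRate_le one_pos (Eventually.of_forall fun n => by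
    simpa using hX.dilNorm_nat_le n)

theorem upperBoydZero_le : X.upperBoydZero ≤ X.upperBoyd :=
  hX.isSubmulSeq_dilNormZero.expRate_mono hX.isSubmulSeq_dilNorm fun n =>
    hX.dilNormZero_le_dilNorm n

theorem lowerBoyd_le_lowerBoydInf : X.lowerBoyd ≤ X.lowerBoydInf :=
  neg_le_neg (hX.isSubmulSeq_dilNormInf_neg.expRate_mono hX.isSubmulSeq_dilNorm_neg fun _ =>
    hX.dilNormInf_le_dilNorm _)

theorem index_bounds_of_mem_crudeSymRep {p : ℝ≥0∞} (hp : p ∈ X.crudeSymRep) :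
    X.lowerBoyd ≤ expRecip p ∧ expRecip p ≤ X.upperBoyd ∧
      (expRecip p ≤ X.upperBoydZero ∨ X.lowerBoydInf ≤ expRecip p) := by
  have hg := hX.hasGrowth_of_mem_crudeSymRep hp
  refine ⟨hX.lowerBoyd_le hg, hX.le_upperBoyd hg, ?_⟩
  by_contra! h
  exact hX.growth_gap hg h.1 h.2

theorem mem_symRep_of_index_bounds (hfund : X.IsFundamentalType) {p : ℝ≥0∞} (hp : 1 ≤ p)
    (h : X.lowerBoyd ≤ expRecip p ∧ expRecip p ≤ X.upperBoyd ∧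
      (expRecip p ≤ X.upperBoydZero ∨ X.lowerBoydInf ≤ expRecip p)) : p ∈ X.symRep := by
  rw [hfund.lower, hfund.upper, hfund.upperZero, hfund.lowerInf] at h
  exact hX.mem_symRep hp
    (hX.hasNearEigenfunctions (expRecip_nonneg p) (expRecip_le_one hp) h.1 h.2.1 h.2.2)

theorem crudeSymRep_eq (hfund : X.IsFundamentalType) : X.crudeSymRep = X.symRep :=
  Subset.antisymm (fun _ hp => hX.mem_symRep_of_index_bounds hfund hp.1
    (hX.index_bounds_of_mem_crudeSymRep hp)) symRep_subset_crudeSymRep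

theorem mem_symRep_iff (hfund : X.IsFundamentalType) (p : ℝ≥0∞) : p ∈ X.symRep ↔
    1 ≤ p ∧ X.lowerBoyd ≤ expRecip p ∧ expRecip p ≤ X.upperBoyd ∧
      (expRecip p ≤ X.upperBoydZero ∨ X.lowerBoydInf ≤ expRecip p) :=
  ⟨fun hp => ⟨hp.1, hX.index_bounds_of_mem_crudeSymRep (symRep_subset_crudeSymRep hp)⟩,
    fun h => hX.mem_symRep_of_index_bounds hfund h.1 h.2⟩

end FunctionSpace.IsRearrangementInvariant

end SymRep

end

theorem mainTheorem2 (X : SymRep.FunctionSpace) (hX : X.IsRearrangementInvariant)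
    (hsep : TopologicalSpace.SeparableSpace X.Elem) (hfund : X.IsFundamentalType) :
    (X.lowerBoydInf ≤ X.upperBoydZero →
      X.symRep = X.crudeSymRep ∧
      X.symRep = Set.Icc (SymRep.recip X.upperBoyd) (SymRep.recip X.lowerBoyd)) ∧
    (X.upperBoydZero < X.lowerBoydInf →
      X.symRep = X.crudeSymRep ∧
      X.symRep =
        Set.Icc (SymRep.recip X.upperBoyd) (SymRep.recip X.lowerBoydInf) ∪
        Set.Icc (SymRep.recip X.upperBoydZero) (SymRep.recip X.lowerBoyd)) := by
  have hz0 := hX.upperBoydZero_nonneg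
  have hz1 := hX.upperBoydZero_le
  have hb1 := hX.upperBoyd_le_one
  have hi := hX.lowerBoyd_le_lowerBoydInf
  have hcrude := (hX.crudeSymRep_eq hfund).symm
  refine ⟨fun h => ⟨hcrude, Set.ext fun p => ?_⟩, fun h => ⟨hcrude, Set.ext fun p => ?_⟩⟩
  · rw [hX.mem_symRep_iff hfund, SymRep.mem_Icc_recip (hz0.trans hz1) hb1]
    refine and_congr_right fun _ => and_congr_right fun _ => and_iff_left ?_
    -- When α^∞ ≤ β^0 there is no gap, so the third condition holds for every θ.
    exact (le_or_gt (SymRep.expRecip p) X.upperBoydZero).imp_right fun h' => h.trans h'.le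
  · rw [hX.mem_symRep_iff hfund, Set.mem_union, SymRep.mem_Icc_recip (hz0.trans hz1) hb1,
      SymRep.mem_Icc_recip hz0 (hz1.trans hb1)]
    constructor
    · rintro ⟨hp, h1, h2, h3 | h3⟩
      · exact Or.inr ⟨hp, h1, h3⟩
      · exact Or.inl ⟨hp, h3, h2⟩
    · rintro (⟨hp, h1, h2⟩ | ⟨hp, h1, h2⟩)
      · exact ⟨hp, hi.trans h1, h2, Or.inr h1⟩
      · exact ⟨hp, h1, h2.trans hz1, Or.inl h2⟩
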